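/- **Setting.** Participants $i=1,2,\dots$ have covariates $X_i\in\mathcal X$, an observed binary treatment $W_i$, and potential submissions $B_i(1),B_i(0)\in\mathcal B$; the tuples $(X_i,B_i(1),B_i(0),W_i)$ are i.i.d. A treatment vector $\mathbf w\in\{0,1\}^n$ leads to the submissions $\mathbf B(\mathbf w)=(B_i(w_i))_{i\le n}$, a mechanism computes from them a vector of cutoffs $P_n(\mathbf w)\in\mathcal S\subseteq\mathbb R^J$ ($J\ge 1$ fixed), and participant $i$ obtains the allocation $D_i(\mathbf w)=d(B_i(w_i),P_n(\mathbf w))\in\mathbb R^J$ and the outcome $Y_i(\mathbf w)=y(B_i(w_i),P_n(\mathbf w))\in\mathbb R$, with known functions $d,y$. Norms are Euclidean. $\Pi$ is a class of measurable rules $\pi:\mathcal X\to[0,1]$ containing $\pi_1\equiv 1$ and $\pi_0\equiv 0$. Under $\pi$ the treatments are drawn as independent $W_i\sim\mathrm{Bernoulli}(\pi(X_i))$, and $\mathbb E_\pi$ is the expectation over these draws, holding $(X_i,B_i(1),B_i(0))_{i\le n}$ fixed. The capacities are $s^*\in[0,1]^J$. Put $$\bar V_n(\pi)=\mathbb E_\pi\Big[\tfrac1n\sum_{i=1}^n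 Y_i(\mathbf W)\Big],\qquad \bar\tau_{\mathrm{GTE}}=\tfrac1n\sum_{i=1}^n\big[Y_i(\mathbf 1_n)-Y_i(\mathbf 0_n)\big],$$ $$y_\pi(p)=\mathbb E[\pi(X_i)y(B_i(1),p)+(1-\pi(X_i))y(B_i(0),p)],\quad z_\pi(p)=\mathbb E[\pi(X_i)d(B_i(1),p)+(1-\pi(X_i))d(B_i(0),p)]-s^*.$$ **Assumptions.** There are constants $c_1,c_2,c_3,c_4,c',c>0$ such that the following hold. 1. *Identification.* $\{B_i(1),B_i(0)\}\perp W_i\mid X_i$, and $e(x)=P(W_i=1\mid X_i=x)$ satisfies $0<e(x)<1$ for all $x$. 2. *Cutoff mechanism.* Allocations $d(b,p)$ are bounded uniformly over $b\in\mathcal B$, $p\in\mathcal S$. There is a sequence $a_n$ with $\sqrt n\,a_n\to0$ such that, with $\mathcal C_{\mathbf w}=\{p\in\mathbb R^J:\|\frac1n\sum_{i\le n} d(B_i(w_i),p)-s^*\|\le a_n\}$: for every $\pi\in\Pi$ and $n\ge1$, when $\mathbf W$ is drawn from $\pi$, the set $\mathcal C_{\mathbf W}$ is non-empty with probability at least $1-e^{-cn}$;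 and, for every $\mathbf w$, almost surely $P_n(\mathbf w)\in\mathcal C_{\mathbf w}$ whenever $\mathcal C_{\mathbf w}\ne\emptyset$. 3. *Regularity of outcomes.* (i) For some $h_d,h_y,C>0$, the classes $\{b\mapsto d_j(b,p):p\in\mathcal S\}$, $j\le J$, and $\{b\mapsto y(b,p):p\in\mathcal S\}$ have $L_2(Q)$ $\epsilon$-covering numbers at most $C(1/\epsilon)^{h_d}$ and $C(1/\epsilon)^{h_y}$ respectively, for all $0<\epsilon<1$, uniformly over finitely discrete probability measures $Q$. (ii) $y$ is uniformly bounded on $\mathcal B\times\mathcal S$, and for some $L>0$, all $w\in\{0,1\}$, $j\le J$ and $p,p'\in\mathcal S$, $\mathbb E[(d_j(B_i(w),p)-d_j(B_i(w),p'))^2]\le L\|p-p'\|$ and $\mathbb E[(y(B_i(w),p)-y(B_i(w),p'))^2]\le L\|p-p'\|$. (iii) For all $w$ and $x$, (versions of) $\mathbb E[d(B_i(w),p)\mid X_i=x]$ and $\mathbb E[y(B_i(w),p)\mid X_i=x]$ are twice continuously differentiable in $p$ on the interior of $\mathcal S$, with first and second partial derivatives bounded by $c'$. (iv) For every $\pi\in\Pi$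 the singular values of the Jacobian $\nabla_p z_\pi(p^*_\pi)$ lie in $[c_3,c_4]$. 4. *Regularity of equilibrium.* $\mathcal S$ is compact. For every $\pi\in\Pi$, $p^*_\pi$ is the unique $p\in\mathcal S$ with $z_\pi(p)=0$, $\mathcal S$ contains the ball of radius $c_1$ centered at $p^*_\pi$, and $2\|z_\pi(p)\|\ge c_2$ for all $p\in\mathcal S$ with $\|p-p^*_\pi\|\ge c_3/(2Jc')$. Write $p^*_w=p^*_{\pi_w}$ for $w\in\{0,1\}$, and let $$V^*(\pi)=y_\pi(p^*_\pi),\qquad \tau^*_{\mathrm{GTE}}=\mathbb E[y(B_i(1),p^*_1)]-\mathbb E[y(B_i(0),p^*_0)],$$ $$\nu^*_w=\nabla_p^\top\mathbb E[y(B_i(w),p^*_w)]\,\big(\nabla_p\mathbb E[d(B_i(w),p^*_w)]\big)^{-1},\qquad q_w(b,p)=y(b,p)-\nu^*_w\,(d(b,p)-s^*).$$ **Theorem.** Under these assumptions, $\sqrt n\,(\bar V_n(\pi)-V^*(\pi))=O_p(1)$ for every $\pi\in\Pi$, and $$\bar\tau_{\mathrm{GTE}}-\tau^*_{\mathrm{GTE}}=\frac1n\sum_{i=1}^n\Big(q_1(B_i(1),p^*_1)-q_0(B_i(0),p^*_0)\Big)-\tau^*_{\mathrm{GTE}}+o_p(n^{-1/2}).$$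 -/

import Mathlib

open MeasureTheory ProbabilityTheory Filter Topology

noncomputable section

namespace CutoffMarket

/-- Cutoffs, allocations and capacities live in `ℝ^J` with its Euclidean norm. -/
abbrev RJ (J : ℕ) : Type := EuclideanSpace ℝ (Fin J)

/-! ### Stochastic order symbols -/

/-- `T n = O_p(1)`. -/
def BoundedInProbability {Ω : Type*} [MeasurableSpace Ω] (μ : Measure Ω)
    (T : ℕ → Ω → ℝ) : Prop :=
  ∀ ε : ℝ, 0 < ε → ∃ K : ℝ, ∀ᶠ n in atTop, μ {ω | K < |T n ω|} ≤ ENNReal.ofReal ε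

/-- `T n = o_p(r n)` for a sequence `r` of rates that are eventually positive. -/
def LittleOInProbability {Ω : Type*} [MeasurableSpace Ω] (μ : Measure Ω)
    (T : ℕ → Ω → ℝ) (r : ℕ → ℝ) : Prop :=
  TendstoInMeasure μ (fun n ω => T n ω / r n) atTop (fun _ => 0)

/-! ### Uniform covering numbers -/

/-- The `L₂(Q)` distance of two functions, where `Q = ∑ i, wt i • δ_(pt i)`. -/
def l2Dist {𝓑 : Type*} {k : ℕ} (pt : Fin k → 𝓑) (wt : Fin k → ℝ) (f g : 𝓑 → ℝ) : ℝ :=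
  Real.sqrt (∑ i, wt i * (f (pt i) - g (pt i)) ^ 2)

/-- `N(ε, F, L₂(Q))`: the least number of open `L₂(Q)`-balls of radius `ε` (with arbitrary
functions as centres) that cover `F`, where `Q = ∑ i, wt i • δ_(pt i)`. -/
def coveringNumber {𝓑 : Type*} {k : ℕ} (pt : Fin k → 𝓑) (wt : Fin k → ℝ) (ε : ℝ)
    (F : Set (𝓑 → ℝ)) : ℕ∞ :=
  ⨅ (G : Finset (𝓑 → ℝ)) (_ : ∀ f ∈ F, ∃ g ∈ G, l2Dist pt wt f g < ε), (G.card : ℕ∞)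

/-- The uniform covering number of `F`, the supremum of `N(ε, F, L₂(Q))` over all finitely
discrete probability measures `Q`, is at most `C (1/ε)^h` for every `0 < ε < 1`. -/
def UniformCoveringBound {𝓑 : Type*} (F : Set (𝓑 → ℝ)) (C h : ℝ) : Prop :=
  ∀ ε : ℝ, 0 < ε → ε < 1 →
    (⨆ (k : ℕ) (pt : Fin k → 𝓑) (wt : Fin k → ℝ) (_ : wt ∈ stdSimplex ℝ (Fin k)),
      (coveringNumber pt wt ε F : ENNReal)) ≤ ENNReal.ofReal (C * (1 / ε) ^ h)

/-! ### Smoothness with bounded derivatives -/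

/-- `f` is twice continuously differentiable on the open set `U`, and all its first and second
partial derivatives there are at most `c` in absolute value. -/
def SmoothBounded {J : ℕ} (f : RJ J → ℝ) (U : Set (RJ J)) (c : ℝ) : Prop :=
  ContDiffOn ℝ 2 f U ∧
    ∀ p ∈ U,
      (∀ j : Fin J, |fderiv ℝ f p (EuclideanSpace.single j 1)| ≤ c) ∧
      (∀ j k : Fin J, |iteratedFDeriv ℝ 2 f p
        ![EuclideanSpace.single j 1, EuclideanSpace.single k 1]| ≤ c)

/-! ### Random treatment assignment -/

/-- Probability that independent `W i ∼ Bernoulli (π (x i))` take the values `w i`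
(`true` is "treated"). -/
def policyWeight {𝓧 : Type*} {n : ℕ} (π : 𝓧 → ℝ) (x : Fin n → 𝓧) (w : Fin n → Bool) : ℝ :=
  ∏ i, if w i then π (x i) else 1 - π (x i)

/-- `E_π[f(W)]`: expectation over the random treatments only, given the covariates `x`. -/
def policyExp {𝓧 : Type*} {n : ℕ} (π : 𝓧 → ℝ) (x : Fin n → 𝓧) (f : (Fin n → Bool) → ℝ) : ℝ :=
  ∑ w : Fin n → Bool, policyWeight π x w * f w

/-- The rule that treats everybody (`w = true`) or nobody (`w = false`). -/
def constRule (𝓧 : Type*) (w : Bool) : 𝓧 → ℝ := fun _ => if w then 1 else 0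

/-! ### The market -/

/-- The data of the model. Participant `i` has covariates `X i`, observed treatment `W i` and
potential submissions `B true i`, `B false i`; a submission depends on the own treatment only.
Allocations and outcomes are known functions `d b p`, `y b p` of the own submission and of the
cutoffs, and `cutoff n` is the mechanism that computes the cutoffs from the `n` submissions. -/
structure Market (Ω 𝓧 𝓑 : Type*) (J : ℕ) where
  X : ℕ → Ω → 𝓧
  W : ℕ → Ω → Bool
  B : Bool → ℕ → Ω → 𝓑
  d : 𝓑 → RJ J → RJ J
  y : 𝓑 → RJ J → ℝ
  /-- fractional capacities `s*` -/
  cap : RJ J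
  /-- the set of cutoffs -/
  S : Set (RJ J)
  cutoff : (n : ℕ) → (Fin n → 𝓑) → RJ J

namespace Market

variable {Ω 𝓧 𝓑 : Type*} {J : ℕ} (M : Market Ω 𝓧 𝓑 J)

/-- The covariates of the first `n` participants. -/
def covariates (n : ℕ) (ω : Ω) : Fin n → 𝓧 := fun i => M.X i ω

/-- The submissions of the first `n` participants under the treatment vector `w`. -/
def bids (n : ℕ) (w : Fin n → Bool) (ω : Ω) : Fin n → 𝓑 := fun i => M.B (w i) i ω

/-- The finite-market cutoffs `P_n(w)`. -/
def P (n : ℕ) (w : Fin n → Bool) (ω : Ω) : RJ J := M.cutoff n (M.bids n w ω)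

/-- The potential allocation `D_i(w)`. -/
def allocation (n : ℕ) (w : Fin n → Bool) (i : Fin n) (ω : Ω) : RJ J :=
  M.d (M.B (w i) i ω) (M.P n w ω)

/-- The potential outcome `Y_i(w)`. -/
def outcome (n : ℕ) (w : Fin n → Bool) (i : Fin n) (ω : Ω) : ℝ :=
  M.y (M.B (w i) i ω) (M.P n w ω)

/-- The set of cutoffs that clear the `n`-participant market up to the error `a`. -/
def clearing (n : ℕ) (a : ℝ) (w : Fin n → Bool) (ω : Ω) : Set (RJ J) :=
  {p | ‖(∑ i : Fin n, (1 / (n : ℝ)) • M.d (M.B (w i) i ω) p) - M.cap‖ ≤ a}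

/-- The finite-market value of the rule `π`. -/
def finiteValue (n : ℕ) (π : 𝓧 → ℝ) (ω : Ω) : ℝ :=
  policyExp π (M.covariates n ω) fun w => (1 / (n : ℝ)) * ∑ i : Fin n, M.outcome n w i ω

/-- The finite-market global treatment effect. -/
def finiteGTE (n : ℕ) (ω : Ω) : ℝ :=
  (1 / (n : ℝ)) * ∑ i : Fin n,
    (M.outcome n (fun _ => true) i ω - M.outcome n (fun _ => false) i ω)

variable [MeasurableSpace Ω] (μ : Measure Ω)

/-- `E[y(B_i(w), p)]`. -/
def meanY (w : Bool) (p : RJ J) : ℝ := ∫ ω, M.y (M.B w 0 ω) p ∂μ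

/-- `E[d(B_i(w), p)]`. -/
def meanD (w : Bool) (p : RJ J) : RJ J := ∫ ω, M.d (M.B w 0 ω) p ∂μ

/-- `y_π(p) = E[π(X_i) y(B_i(1), p) + (1 - π(X_i)) y(B_i(0), p)]`. -/
def popY (π : 𝓧 → ℝ) (p : RJ J) : ℝ :=
  ∫ ω, (π (M.X 0 ω) * M.y (M.B true 0 ω) p
    + (1 - π (M.X 0 ω)) * M.y (M.B false 0 ω) p) ∂μ

/-- `z_π(p) = E[π(X_i) d(B_i(1), p) + (1 - π(X_i)) d(B_i(0), p)] - s*`. -/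
def popZ (π : 𝓧 → ℝ) (p : RJ J) : RJ J :=
  (∫ ω, (π (M.X 0 ω) • M.d (M.B true 0 ω) p
    + (1 - π (M.X 0 ω)) • M.d (M.B false 0 ω) p) ∂μ) - M.cap

/-- `p` is the unique element of `S` that clears the continuum market under the rule `π`. -/
def IsEquilibrium (π : 𝓧 → ℝ) (p : RJ J) : Prop :=
  p ∈ M.S ∧ M.popZ μ π p = 0 ∧ ∀ p' ∈ M.S, M.popZ μ π p' = 0 → p' = p

/-- The continuum-market value of `π` at the continuum cutoffs `pstar`. -/
def continuumValue (pstar : (𝓧 → ℝ) → RJ J) (π : 𝓧 → ℝ) : ℝ := M.popY μ π (pstar π)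

/-- The continuum-market global treatment effect. -/
def continuumGTE (pstar : (𝓧 → ℝ) → RJ J) : ℝ :=
  M.meanY μ true (pstar (constRule 𝓧 true)) - M.meanY μ false (pstar (constRule 𝓧 false))

/-- `ν_w(p) = ∇ᵀE[y(B_i(w), p)] (∇E[d(B_i(w), p)])⁻¹`, a row vector, that is, a linear form. -/
def nu (w : Bool) (p : RJ J) : RJ J →L[ℝ] ℝ :=
  (fderiv ℝ (M.meanY μ w) p).comp (fderiv ℝ (M.meanD μ w) p).inverse

/-- The corrected score `y(b, p) - ν*_w (d(b, p) - s*)`, with `ν*_w` evaluated at `pw`. -/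
def score (w : Bool) (pw : RJ J) (b : 𝓑) (p : RJ J) : ℝ :=
  M.y b p - M.nu μ w pw (M.d b p - M.cap)

/-! ### Assumptions -/

variable [MeasurableSpace 𝓧] [MeasurableSpace 𝓑]

/-- The participants are drawn i.i.d. from a population; everything is measurable. -/
structure Sampling : Prop where
  measurable_X : ∀ i, Measurable (M.X i)
  measurable_W : ∀ i, Measurable (M.W i)
  measurable_B : ∀ w i, Measurable (M.B w i)
  measurable_d : Measurable fun bp : 𝓑 × RJ J => M.d bp.1 bp.2
  measurable_y : Measurable fun bp : 𝓑 × RJ J => M.y bp.1 bp.2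
  measurable_cutoff : ∀ n, Measurable (M.cutoff n)
  indep : iIndepFun (fun i ω => (M.X i ω, M.B true i ω, M.B false i ω, M.W i ω)) μ
  identDistrib : ∀ i, IdentDistrib
    (fun ω => (M.X i ω, M.B true i ω, M.B false i ω, M.W i ω))
    (fun ω => (M.X 0 ω, M.B true 0 ω, M.B false 0 ω, M.W 0 ω)) μ μ

/-- Identification: unconfoundedness and overlap of the observed treatments. (That submissions
depend on the own treatment only, and allocations and outcomes on treatments only through the
submissions, is built into `Market`.) -/
structure Identification : Prop where
  unconfounded : ∀ i, ∀ s : Set (𝓑 × 𝓑), MeasurableSet s → ∀ t : Set Bool,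
    (μ⟦{ω | (M.B true i ω, M.B false i ω) ∈ s ∧ M.W i ω ∈ t} |
        MeasurableSpace.comap (M.X i) inferInstance⟧) =ᵐ[μ]
      (μ⟦{ω | (M.B true i ω, M.B false i ω) ∈ s} |
        MeasurableSpace.comap (M.X i) inferInstance⟧)
      * (μ⟦{ω | M.W i ω ∈ t} | MeasurableSpace.comap (M.X i) inferInstance⟧)
  overlap : ∃ e : 𝓧 → ℝ, Measurable e ∧
    (∀ i, (fun ω => e (M.X i ω)) =ᵐ[μ]
      (μ⟦{ω | M.W i ω = true} | MeasurableSpace.comap (M.X i) inferInstance⟧)) ∧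
    ∀ x, 0 < e x ∧ e x < 1

/-- Cutoff mechanism: the finite-market cutoffs are in `S`, allocations are bounded, and the
market clears up to `a n = o(n^(-1/2))` with probability at least `1 - exp (-c n)` when the
treatments are drawn from a rule in `Pol`. -/
structure CutoffMechanism (Pol : Set (𝓧 → ℝ)) : Prop where
  cap_mem : ∀ j, M.cap j ∈ Set.Icc (0 : ℝ) 1
  cutoff_mem : ∀ n : ℕ, 0 < n → ∀ b : Fin n → 𝓑, M.cutoff n b ∈ M.S
  bounded_d : ∃ K : ℝ, ∀ b, ∀ p ∈ M.S, ‖M.d b p‖ ≤ K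
  clears : ∃ (a : ℕ → ℝ) (c : ℝ), 0 < c ∧
    Tendsto (fun n : ℕ => a n * Real.sqrt n) atTop (𝓝 0) ∧
    (∀ π ∈ Pol, ∀ n : ℕ, 0 < n →
      1 - Real.exp (-c * n) ≤ ∫ ω, policyExp π (M.covariates n ω)
        (Set.indicator {w | (M.clearing n (a n) w ω).Nonempty} fun _ => 1) ∂μ) ∧
    (∀ n : ℕ, 0 < n → ∀ w : Fin n → Bool, ∀ᵐ ω ∂μ,
      (M.clearing n (a n) w ω).Nonempty → M.P n w ω ∈ M.clearing n (a n) w ω)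

/-- Regularity of outcomes. -/
structure RegularOutcomes (Pol : Set (𝓧 → ℝ)) (pstar : (𝓧 → ℝ) → RJ J)
    (c' c₃ c₄ : ℝ) : Prop where
  entropy : ∃ h_d h_y C : ℝ, 0 < h_d ∧ 0 < h_y ∧ 0 < C ∧
    (∀ j : Fin J, UniformCoveringBound ((fun p b => M.d b p j) '' M.S) C h_d) ∧
    UniformCoveringBound ((fun p b => M.y b p) '' M.S) C h_y
  bounded_y : ∃ K : ℝ, ∀ b, ∀ p ∈ M.S, |M.y b p| ≤ K
  weakly_continuous : ∃ L : ℝ, 0 < L ∧ ∀ w, ∀ p ∈ M.S, ∀ p' ∈ M.S,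
    (∀ j : Fin J, ∫ ω, (M.d (M.B w 0 ω) p j - M.d (M.B w 0 ω) p' j) ^ 2 ∂μ ≤ L * ‖p - p'‖) ∧
    ∫ ω, (M.y (M.B w 0 ω) p - M.y (M.B w 0 ω) p') ^ 2 ∂μ ≤ L * ‖p - p'‖
  /-- Versions `md w x p`, `my w x p` of the conditional means of `d(B_i(w), p)` and
  `y(B_i(w), p)` given `X_i = x` that are smooth in `p`. -/
  smooth : ∃ (md : Bool → 𝓧 → RJ J → RJ J) (my : Bool → 𝓧 → RJ J → ℝ),
    (∀ w, ∀ p ∈ M.S, Measurable (fun x => md w x p) ∧ Measurable (fun x => my w x p)) ∧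
    (∀ w i, ∀ p ∈ M.S,
      (fun ω => md w (M.X i ω) p) =ᵐ[μ]
        μ[fun ω => M.d (M.B w i ω) p | MeasurableSpace.comap (M.X i) inferInstance] ∧
      (fun ω => my w (M.X i ω) p) =ᵐ[μ]
        μ[fun ω => M.y (M.B w i ω) p | MeasurableSpace.comap (M.X i) inferInstance]) ∧
    (∀ w x, (∀ j : Fin J, SmoothBounded (fun p => md w x p j) (interior M.S) c') ∧
      SmoothBounded (my w x) (interior M.S) c')
  jacobian : ∀ π ∈ Pol, ∀ k : ℕ, k < J →
    (fderiv ℝ (M.popZ μ π) (pstar π)).toLinearMap.singularValues k ∈ Set.Icc c₃ c₄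

/-- Regularity of equilibrium. -/
structure RegularEquilibrium (Pol : Set (𝓧 → ℝ)) (pstar : (𝓧 → ℝ) → RJ J)
    (c' c₃ : ℝ) : Prop where
  compact : IsCompact M.S
  equilibrium : ∀ π ∈ Pol, M.IsEquilibrium μ π (pstar π)
  interior : ∃ c₁ : ℝ, 0 < c₁ ∧ ∀ π ∈ Pol, Metric.ball (pstar π) c₁ ⊆ M.S
  well_separated : ∃ c₂ : ℝ, 0 < c₂ ∧ ∀ π ∈ Pol, ∀ p ∈ M.S,
    c₃ / (2 * J * c') ≤ ‖p - pstar π‖ → c₂ ≤ 2 * ‖M.popZ μ π p‖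

end Market

end CutoffMarket

end

/-! Once both participants and treatments are integrated out, the n submissions under a rule π form
an i.i.d. sample from one law, `policyLaw` (`sum_map_bids_eq`). The finite treatment effect is the
difference of the average outcomes under the two constant rules. It is therefore enough to study the
average outcome at cutoffs P computed from an i.i.d. sample that they nearly clear
(`ClearingSequence`).

Let Y(p), Z(p) be the population outcome and excess demand, Ŷ, Ẑ their empirical versions and p₀ the
equilibrium. Suppose Ŷ - Y and Ẑ - Z change by only o(n^(-1/2)) between p₀ and P (stochastic
equicontinuity). Since Ẑ(P) = o(n^(-1/2)) and Z(p₀) = 0, it follows that Z(P) = -Ẑ(p₀) +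
o(n^(-1/2)). The form φ = Y'(p₀) Z'(p₀)⁻¹ gives Y(p) - Y(p₀) = φ Z(p) + o(‖p - p₀‖)
(`isLittleO_sub_comp_inverse`). Hence Ŷ(P) = Ŷ(p₀) - φ Ẑ(p₀) + o(n^(-1/2)), an average of i.i.d.
bounded corrected scores with mean Y(p₀) (`tendsto_linearization`). Both claims follow: the average
fluctuates at scale n^(-1/2), and the expansions for the two constant rules are subtracted. All
estimates are in mean; Markov's inequality is applied last.

Equicontinuity is obtained without chaining. A ghost sample symmetrizes the deviation, and a
quadratic penalty t·Σu²/n is subtracted from |Σσu|/n. The penalty cancels the sub-Gaussian moment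
generating function, so a net of N functions costs only log(2N)/(tn), whichever element the data
select (`avg_rademacher_offset_le`). Nets of radius of order 1/n have polynomial size, so a mean
deviation is at most of order t·(second moment) + log n/(tn), up to O(1/n). The choice t = n^(-1/2)
gives every rate n^(-α) with α < 1/2. Stability of the equilibrium (`exists_mul_norm_sub_le`) turns
this into E‖P - p₀‖ = o(n^(-1/8)), and mean-square continuity makes the second moments of the
increments o(n^(-1/8)). A second pass with t = n^(-3/8) then yields o(n^(-1/2)). -/

noncomputable section

namespace CutoffMarket

/-! ### A finite maximal inequality for Rademacher sums -/

/-- The sign attached to a Boolean. -/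
def boolSign (b : Bool) : ℝ := if b then 1 else -1

theorem abs_boolSign (b : Bool) : |boolSign b| = 1 := by
  cases b <;> simp [boolSign]

/-- The sum over sign vectors factorizes into factors 2 cosh(a i), each at most 2 exp(a i ^ 2 / 2).
-/
theorem sum_exp_boolSign_le {n : ℕ} (a : Fin n → ℝ) :
    ∑ σ : Fin n → Bool, Real.exp (∑ i, boolSign (σ i) * a i)
      ≤ 2 ^ n * Real.exp ((∑ i, a i ^ 2) / 2) := by
  have h1 : ∑ σ : Fin n → Bool, Real.exp (∑ i, boolSign (σ i) * a i)
      = ∏ i, ∑ b : Bool, Real.exp (boolSign b * a i) := by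
    rw [Finset.prod_univ_sum, Fintype.piFinset_univ]
    exact Finset.sum_congr rfl fun σ _ => Real.exp_sum _ _
  rw [h1]
  calc ∏ i, ∑ b : Bool, Real.exp (boolSign b * a i)
      ≤ ∏ i, 2 * Real.exp (a i ^ 2 / 2) := by
        refine Finset.prod_le_prod (fun i _ => by positivity) fun i _ => ?_
        have := Real.cosh_le_exp_half_sq (a i)
        rw [Real.cosh_eq] at this
        simp only [Fintype.sum_bool, boolSign, if_true, Bool.false_eq_true, if_false, one_mul,
          neg_mul]
        linarith
    _ = 2 ^ n * Real.exp ((∑ i, a i ^ 2) / 2) := by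
        rw [Finset.prod_mul_distrib, ← Real.exp_sum, Finset.sum_div]
        simp

/-- The vector may depend on the signs. By Jensen the exponential of t times the average is at most
a sum over A and -A of penalized exponential moments. Each of these is at most 1, because the
penalty cancels the sub-Gaussian bound exactly; no bound on the size of the vectors enters. -/
theorem avg_sup_rademacher_le {n : ℕ} (A : Finset (Fin n → ℝ)) {N : ℝ} (hN : (A.card : ℝ) ≤ N)
    (v : (Fin n → Bool) → Fin n → ℝ) (hv : ∀ σ, v σ ∈ A) {t : ℝ} (ht : 0 < t) :
    (1 / 2 ^ n : ℝ) * ∑ σ : Fin n → Bool,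
      (|∑ i, boolSign (σ i) * v σ i| - t / 2 * ∑ i, v σ i ^ 2) ≤ Real.log (2 * N) / t := by
  set x : (Fin n → Bool) → ℝ := fun σ =>
    t * (|∑ i, boolSign (σ i) * v σ i| - t / 2 * ∑ i, v σ i ^ 2) with hx
  have hpos : (0 : ℝ) < 2 ^ n := by positivity
  have hjensen : Real.exp (∑ σ : Fin n → Bool, (1 / 2 ^ n : ℝ) * x σ)
      ≤ ∑ σ : Fin n → Bool, (1 / 2 ^ n : ℝ) * Real.exp (x σ) := by
    have := convexOn_exp.map_sum_le (t := (Finset.univ : Finset (Fin n → Bool)))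
      (w := fun _ => (1 / 2 ^ n : ℝ)) (p := x) (fun _ _ => by positivity) (by simp)
      (fun _ _ => Set.mem_univ _)
    simpa using this
  have hexp : ∀ a : Fin n → ℝ, ∑ σ : Fin n → Bool,
      Real.exp (t * ((∑ i, boolSign (σ i) * a i) - t / 2 * ∑ i, a i ^ 2)) ≤ 2 ^ n := by
    intro a
    have h := sum_exp_boolSign_le (fun i => t * a i)
    have e1 : ∀ σ : Fin n → Bool,
        Real.exp (t * ((∑ i, boolSign (σ i) * a i) - t / 2 * ∑ i, a i ^ 2))
        = Real.exp (∑ i, boolSign (σ i) * (t * a i))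
          * (Real.exp ((∑ i, (t * a i) ^ 2) / 2))⁻¹ := by
      intro σ
      rw [← Real.exp_neg, ← Real.exp_add]
      congr 1
      simp only [mul_pow, ← Finset.mul_sum, mul_left_comm _ t]
      ring
    simp_rw [e1]
    rw [← Finset.sum_mul, ← div_eq_mul_inv, div_le_iff₀ (Real.exp_pos _)]
    exact h
  -- Adding the terms of -a removes the absolute value and causes the factor 2 in log(2N).
  have hterm : ∀ σ, Real.exp (x σ) ≤ ∑ a ∈ A,
      (Real.exp (t * ((∑ i, boolSign (σ i) * a i) - t / 2 * ∑ i, a i ^ 2))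
      + Real.exp (t * ((∑ i, boolSign (σ i) * (-a) i) - t / 2 * ∑ i, (-a) i ^ 2))) := by
    intro σ
    refine le_trans ?_ (Finset.single_le_sum
      (f := fun a : Fin n → ℝ =>
        Real.exp (t * ((∑ i, boolSign (σ i) * a i) - t / 2 * ∑ i, a i ^ 2))
        + Real.exp (t * ((∑ i, boolSign (σ i) * (-a) i) - t / 2 * ∑ i, (-a) i ^ 2)))
      (fun a _ => by positivity) (hv σ))
    simp only [hx, Pi.neg_apply, mul_neg, Finset.sum_neg_distrib, neg_sq]
    rcases abs_choice (∑ i, boolSign (σ i) * v σ i) with h | h <;> rw [h]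
    · exact le_add_of_nonneg_right (Real.exp_pos _).le
    · exact le_add_of_nonneg_left (Real.exp_pos _).le
  have hsum : ∑ σ, Real.exp (x σ) ≤ 2 ^ n * (2 * A.card) := by
    refine (Finset.sum_le_sum fun σ _ => hterm σ).trans ?_
    rw [Finset.sum_comm]
    refine (Finset.sum_le_card_nsmul A _ (2 ^ n + 2 ^ n) fun a _ => ?_).trans
      (le_of_eq (by rw [nsmul_eq_mul]; ring))
    rw [Finset.sum_add_distrib]
    exact add_le_add (hexp a) (hexp (-a))
  have hA : 0 < (A.card : ℝ) := by
    exact_mod_cast Finset.card_pos.2 ⟨_, hv fun _ => true⟩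
  have hle : ∑ σ : Fin n → Bool, (1 / 2 ^ n : ℝ) * x σ ≤ Real.log (2 * N) := by
    rw [Real.le_log_iff_exp_le (by linarith)]
    refine hjensen.trans ?_
    rw [← Finset.mul_sum, one_div, inv_mul_le_iff₀ hpos]
    exact hsum.trans (mul_le_mul_of_nonneg_left (by linarith) hpos.le)
  rw [le_div_iff₀ ht]
  refine le_trans (le_of_eq ?_) hle
  rw [← Finset.mul_sum, ← Finset.mul_sum]
  ring

theorem abs_sum_div_le_of_avg_sq_le {n : ℕ} (hn : 0 < n) (u : Fin n → ℝ) {δ : ℝ} (hδ : 0 ≤ δ)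
    (hu : (∑ i, u i ^ 2) / n ≤ δ ^ 2) (s : Fin n → Bool) :
    |∑ i, boolSign (s i) * u i| / n ≤ δ := by
  have hn' : (0 : ℝ) < n := by exact_mod_cast hn
  have h1 : (∑ i, boolSign (s i) * u i) ^ 2 ≤ n * ∑ i, u i ^ 2 := by
    have := sq_sum_le_card_mul_sum_sq (s := Finset.univ) (f := fun i => boolSign (s i) * u i)
    simp only [Finset.card_univ, Fintype.card_fin] at this
    refine this.trans (le_of_eq ?_)
    congr 1
    refine Finset.sum_congr rfl fun i _ => ?_
    rw [mul_pow, ← sq_abs (boolSign _), abs_boolSign]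
    ring
  rw [div_le_iff₀ hn'] at hu ⊢
  refine abs_le_of_sq_le_sq (h1.trans ?_) (by positivity)
  calc (n : ℝ) * ∑ i, u i ^ 2 ≤ n * (δ ^ 2 * n) := by gcongr
    _ = (δ * n) ^ 2 := by ring

/-- Replacing each vector by its neighbour in the net changes the linear part by at most δ
(Cauchy–Schwarz). The penalty coefficient goes from t/2 to t to pay for the change in the quadratic
part. -/
theorem avg_rademacher_offset_le {n : ℕ} (hn : 0 < n) (A : Finset (Fin n → ℝ)) {N : ℝ}
    (hN : (A.card : ℝ) ≤ N) (u : (Fin n → Bool) → Fin n → ℝ) {δ : ℝ} (hδ : 0 ≤ δ)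
    (hu : ∀ σ, ∃ a ∈ A, (∑ i, (u σ i - a i) ^ 2) / n ≤ δ ^ 2) {t : ℝ} (ht : 0 < t) :
    (1 / 2 ^ n : ℝ) * ∑ σ : Fin n → Bool,
      (|∑ i, boolSign (σ i) * u σ i| / n - t * ((∑ i, u σ i ^ 2) / n))
      ≤ δ + t * δ ^ 2 + Real.log (2 * N) / (t * n) := by
  have hn' : (0 : ℝ) < n := by exact_mod_cast hn
  choose v hvA hv using hu
  have key := avg_sup_rademacher_le A hN v hvA ht
  have hσ : ∀ σ : Fin n → Bool,
      |∑ i, boolSign (σ i) * u σ i| / n - t * ((∑ i, u σ i ^ 2) / n)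
      ≤ (δ + t * δ ^ 2)
        + (1 / n) * (|∑ i, boolSign (σ i) * v σ i| - t / 2 * ∑ i, v σ i ^ 2) := by
    intro σ
    have h1 := abs_sum_div_le_of_avg_sq_le hn (fun i => u σ i - v σ i) hδ (hv σ) σ
    have h2 : |∑ i, boolSign (σ i) * u σ i| / n
        ≤ |∑ i, boolSign (σ i) * v σ i| / n + δ := by
      have h3 : ∑ i, boolSign (σ i) * u σ i
          = ∑ i, boolSign (σ i) * v σ i + ∑ i, boolSign (σ i) * (u σ i - v σ i) := by
        rw [← Finset.sum_add_distrib]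
        exact Finset.sum_congr rfl fun i _ => by ring
      rw [h3]
      refine (div_le_div_of_nonneg_right (abs_add_le _ _) hn'.le).trans ?_
      rw [add_div]
      linarith
    have h4 : (∑ i, v σ i ^ 2) / n
        ≤ 2 * ((∑ i, u σ i ^ 2) / n) + 2 * ((∑ i, (u σ i - v σ i) ^ 2) / n) := by
      rw [← mul_div_assoc, ← mul_div_assoc, ← add_div, Finset.mul_sum, Finset.mul_sum,
        ← Finset.sum_add_distrib]
      refine div_le_div_of_nonneg_right (Finset.sum_le_sum fun i _ => ?_) hn'.le
      nlinarith [sq_nonneg (2 * u σ i - v σ i)]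
    have h5 := mul_le_mul_of_nonneg_left (h4.trans
      (add_le_add_right (mul_le_mul_of_nonneg_left (hv σ) zero_le_two) _)) ht.le
    have h6 : (1 / (n : ℝ)) * (|∑ i, boolSign (σ i) * v σ i| - t / 2 * ∑ i, v σ i ^ 2)
        = |∑ i, boolSign (σ i) * v σ i| / n - t * ((∑ i, v σ i ^ 2) / n) / 2 := by ring
    rw [h6]
    linarith
  calc (1 / 2 ^ n : ℝ) * ∑ σ : Fin n → Bool,
        (|∑ i, boolSign (σ i) * u σ i| / n - t * ((∑ i, u σ i ^ 2) / n))
      ≤ (1 / 2 ^ n : ℝ) * ∑ σ : Fin n → Bool, ((δ + t * δ ^ 2)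
        + (1 / n) * (|∑ i, boolSign (σ i) * v σ i| - t / 2 * ∑ i, v σ i ^ 2)) := by
        gcongr with σ _
        exact hσ σ
    _ = (δ + t * δ ^ 2) + (1 / n) * ((1 / 2 ^ n : ℝ) * ∑ σ : Fin n → Bool,
        (|∑ i, boolSign (σ i) * v σ i| - t / 2 * ∑ i, v σ i ^ 2)) := by
        rw [Finset.sum_add_distrib, ← Finset.mul_sum]
        simp only [Finset.sum_const, Finset.card_univ, Fintype.card_fun, Fintype.card_bool,
          Fintype.card_fin, nsmul_eq_mul, Nat.cast_pow, Nat.cast_ofNat]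
        generalize ∑ σ : Fin n → Bool,
          (|∑ i, boolSign (σ i) * v σ i| - t / 2 * ∑ i, v σ i ^ 2) = T
        field_simp
    _ ≤ (δ + t * δ ^ 2) + (1 / n) * (Real.log (2 * N) / t) := by gcongr
    _ = δ + t * δ ^ 2 + Real.log (2 * N) / (t * n) := by
        field_simp

/-! ### Covers in empirical `L₂` distances -/

/-- For every sample of size `m`, the class `F` has an `ε`-net of at most `N` functions in the
`L₂` distance of the empirical distribution. -/
def EmpiricalCover {𝓑 : Type*} (F : Set (𝓑 → ℝ)) (m : ℕ) (N ε : ℝ) : Prop :=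
  ∀ pt : Fin m → 𝓑, ∃ G : Finset (𝓑 → ℝ), (G.card : ℝ) ≤ N ∧
    ∀ f ∈ F, ∃ g ∈ G, (∑ i, (f (pt i) - g (pt i)) ^ 2) / m ≤ ε ^ 2

theorem UniformCoveringBound.empiricalCover {𝓑 : Type*} {F : Set (𝓑 → ℝ)} {C h : ℝ} (hC : 0 ≤ C)
    (hF : UniformCoveringBound F C h) {m : ℕ} (hm : 0 < m) {ε : ℝ} (hε : 0 < ε) (hε1 : ε < 1) :
    EmpiricalCover F m (C * (1 / ε) ^ h) ε := by
  intro pt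
  have hm' : (0 : ℝ) < m := by exact_mod_cast hm
  have hwt : (fun _ : Fin m => (1 / m : ℝ)) ∈ stdSimplex ℝ (Fin m) := by
    refine ⟨fun _ => by positivity, ?_⟩
    simp [hm'.ne']
  have h1 : (coveringNumber pt (fun _ : Fin m => (1 / m : ℝ)) ε F : ENNReal)
      ≤ ENNReal.ofReal (C * (1 / ε) ^ h) := by
    refine le_trans ?_ (hF ε hε hε1)
    exact le_iSup_of_le m (le_iSup_of_le pt (le_iSup_of_le _ (le_iSup_of_le hwt le_rfl)))
  set c := coveringNumber pt (fun _ : Fin m => (1 / m : ℝ)) ε F with hc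
  have hctop : c ≠ ⊤ := by
    intro h
    rw [h] at h1
    simp at h1
  -- The covering number is an infimum that is finite here, so a net of cardinality below c + 1 has
  -- cardinality at most c.
  have h2 : c < c + 1 := ENat.lt_add_one_iff hctop |>.2 le_rfl
  have h3 : ∃ G : Finset (𝓑 → ℝ),
      (∀ f ∈ F, ∃ g ∈ G, l2Dist pt (fun _ : Fin m => (1 / m : ℝ)) f g < ε) ∧
      (G.card : ℕ∞) < c + 1 := by
    rw [hc] at h2
    conv_lhs at h2 => rw [coveringNumber]
    simpa only [iInf_lt_iff, exists_prop] using h2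
  obtain ⟨G, hG, hcard⟩ := h3
  refine ⟨G, ?_, fun f hf => ?_⟩
  · have h4 : (G.card : ℕ∞) ≤ c := (ENat.lt_add_one_iff hctop).1 hcard
    have h5 : ((G.card : ℕ∞) : ENNReal) ≤ ENNReal.ofReal (C * (1 / ε) ^ h) :=
      (ENat.toENNReal_le.2 h4).trans h1
    have h6 : ENNReal.ofReal (G.card : ℝ) ≤ ENNReal.ofReal (C * (1 / ε) ^ h) := by
      simpa using h5
    exact (ENNReal.ofReal_le_ofReal_iff (by positivity)).1 h6
  · obtain ⟨g, hg, hlt⟩ := hG f hf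
    refine ⟨g, hg, ?_⟩
    have := (Real.sqrt_lt' hε).1 hlt
    rw [← Finset.mul_sum, one_div, inv_mul_eq_div] at this
    exact this.le

/-- The radius 1/n makes the discretization error negligible while the logarithm of the net size
stays O(log n). The 2n points are the sample pooled with its ghost copy; n ≥ 2 is needed for a
radius below 1. -/
theorem UniformCoveringBound.empiricalCover_natCast {𝓑 : Type*} {F : Set (𝓑 → ℝ)} {C h : ℝ}
    (hF : UniformCoveringBound F C h) (hC : 0 < C) {n : ℕ} (hn : 2 ≤ n) :
    EmpiricalCover F (n + n) (C * (n : ℝ) ^ h) (1 / n) := by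
  have hn' : (2 : ℝ) ≤ n := by exact_mod_cast hn
  have := hF.empiricalCover hC.le (m := n + n) (by omega) (ε := 1 / n) (by positivity)
    (by rw [div_lt_one (by linarith)]; linarith)
  rwa [one_div_one_div] at this

/-- The class of squared deviations `(f - f₀)²` of a uniformly bounded class inherits covers. -/
theorem EmpiricalCover.sq_sub {𝓑 : Type*} {F : Set (𝓑 → ℝ)} {m : ℕ} {N ε K : ℝ}
    (hF : EmpiricalCover F m N ε) (hK : 0 ≤ K) (hb : ∀ f ∈ F, ∀ b, |f b| ≤ K) {f₀ : 𝓑 → ℝ}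
    (h₀ : ∀ b, |f₀ b| ≤ K) :
    EmpiricalCover ((fun f b => (f b - f₀ b) ^ 2) '' F) m N (4 * K * ε) := by
  classical
  intro pt
  obtain ⟨G, hN, hG⟩ := hF pt
  -- Centres of a net are arbitrary functions. Truncating them to [-K, K] brings them no farther
  -- from the class and makes squaring Lipschitz with constant 4K.
  refine ⟨G.image fun g b => (max (-K) (min K (g b)) - f₀ b) ^ 2, ?_, ?_⟩
  · exact le_trans (by exact_mod_cast Finset.card_image_le) hN
  · rintro _ ⟨f, hf, rfl⟩
    obtain ⟨g, hg, hle⟩ := hG f hf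
    refine ⟨_, Finset.mem_image_of_mem _ hg, ?_⟩
    have hpt : ∀ b, ((f b - f₀ b) ^ 2 - (max (-K) (min K (g b)) - f₀ b) ^ 2) ^ 2
        ≤ (4 * K) ^ 2 * (f b - g b) ^ 2 := by
      intro b
      obtain ⟨f1, f2⟩ := abs_le.1 (hb f hf b)
      obtain ⟨g1, g2⟩ := abs_le.1 (h₀ b)
      set q := max (-K) (min K (g b)) with hq
      have q1 : -K ≤ q := le_max_left _ _
      have q2 : q ≤ K := max_le (by linarith) (min_le_left _ _)
      have hd : |f b - q| ≤ |f b - g b| := by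
        rcases le_total (g b) (-K) with h | h
        · have : q = -K := by rw [hq, min_eq_right (by linarith), max_eq_left h]
          rw [this, abs_of_nonneg (by linarith), abs_of_nonneg (by linarith)]
          linarith
        · rcases le_total (g b) K with h' | h'
          · have : q = g b := by rw [hq, min_eq_right h', max_eq_right h]
            rw [this]
          · have : q = K := by rw [hq, min_eq_left h', max_eq_right (by linarith)]
            rw [this, abs_of_nonpos (by linarith), abs_of_nonpos (by linarith)]
            linarith
      have e : (f b - f₀ b) ^ 2 - (q - f₀ b) ^ 2
          = (f b + q - 2 * f₀ b) * (f b - q) := by ring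
      rw [e, mul_pow]
      refine mul_le_mul ?_ (sq_le_sq.2 hd) (sq_nonneg _) (sq_nonneg _)
      exact sq_le_sq' (by linarith) (by linarith)
    calc (∑ i, ((f (pt i) - f₀ (pt i)) ^ 2
          - (max (-K) (min K (g (pt i))) - f₀ (pt i)) ^ 2) ^ 2) / m
        ≤ (∑ i, (4 * K) ^ 2 * (f (pt i) - g (pt i)) ^ 2) / m := by
          gcongr with i _
          exact hpt _
      _ = (4 * K) ^ 2 * ((∑ i, (f (pt i) - g (pt i)) ^ 2) / m) := by
          rw [← Finset.mul_sum, mul_div_assoc]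
      _ ≤ (4 * K) ^ 2 * ε ^ 2 := by gcongr
      _ = (4 * K * ε) ^ 2 := by ring

/-- The class of deviations `f - f₀` inherits covers. -/
theorem EmpiricalCover.sub_const {𝓑 : Type*} {F : Set (𝓑 → ℝ)} {m : ℕ} {N ε : ℝ}
    (hF : EmpiricalCover F m N ε) (f₀ : 𝓑 → ℝ) :
    EmpiricalCover ((fun f b => f b - f₀ b) '' F) m N ε := by
  classical
  intro pt
  obtain ⟨G, hN, hG⟩ := hF pt
  refine ⟨G.image fun g b => g b - f₀ b, ?_, ?_⟩
  · exact le_trans (by exact_mod_cast Finset.card_image_le) hN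
  · rintro _ ⟨f, hf, rfl⟩
    obtain ⟨g, hg, hle⟩ := hG f hf
    exact ⟨_, Finset.mem_image_of_mem _ hg, by simpa using hle⟩

/-! ### Symmetrization at a data-dependent index -/

section Symmetrization

variable {𝓑 Θ : Type*} {n : ℕ}

/-- Exchange the two samples in the coordinates where `σ` is `false`. -/
def swapBy (σ : Fin n → Bool) (z : (Fin n → 𝓑) × (Fin n → 𝓑)) : (Fin n → 𝓑) × (Fin n → 𝓑) :=
  (fun i => if σ i then z.1 i else z.2 i, fun i => if σ i then z.2 i else z.1 i)

theorem abs_avg_le {f : Fin n → ℝ} {K : ℝ} (hK0 : 0 ≤ K) (hK : ∀ i, |f i| ≤ K) :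
    |(∑ i, f i) / n| ≤ K := by
  rw [abs_div, Nat.abs_cast]
  refine div_le_of_le_mul₀ (Nat.cast_nonneg _) hK0 ?_
  refine (Finset.abs_sum_le_sum_abs _ _).trans ((Finset.sum_le_sum fun i _ => hK i).trans ?_)
  simp [mul_comm]

/-- The offset symmetrized deviation of two samples, at the index computed from the first. -/
def offsetDeviation (g : 𝓑 → Θ → ℝ) (P : (Fin n → 𝓑) → Θ) (t : ℝ)
    (z : (Fin n → 𝓑) × (Fin n → 𝓑)) : ℝ :=
  |∑ i, (g (z.1 i) (P z.1) - g (z.2 i) (P z.1))| / n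
    - t * ((∑ i, (g (z.1 i) (P z.1) - g (z.2 i) (P z.1)) ^ 2) / n)

/-- Swapping multiplies the i-th difference by a sign and leaves the pooled sample unchanged up to
order. One net on the 2n pooled points thus serves all swaps, although the selected index varies
with the swap. -/
theorem avg_offsetDeviation_swapBy_le (hn : 0 < n) {g : 𝓑 → Θ → ℝ} {S : Set Θ}
    {P : (Fin n → 𝓑) → Θ} (hPS : ∀ b, P b ∈ S) {N ε : ℝ} (hε : 0 ≤ ε)
    (hcov : EmpiricalCover ((fun p b => g b p) '' S) (n + n) N ε) {t : ℝ} (ht : 0 < t)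
    (z : (Fin n → 𝓑) × (Fin n → 𝓑)) :
    (1 / 2 ^ n : ℝ) * ∑ σ : Fin n → Bool, offsetDeviation g P t (swapBy σ z)
      ≤ 2 * ε + t * (2 * ε) ^ 2 + Real.log (2 * N) / (t * n) := by
  classical
  have hn' : (0 : ℝ) < n := by exact_mod_cast hn
  obtain ⟨G, hN, hG⟩ := hcov (Fin.append z.1 z.2)
  set p : (Fin n → Bool) → Θ := fun σ => P (swapBy σ z).1 with hp
  have key := avg_rademacher_offset_le hn (G.image fun h i => h (z.1 i) - h (z.2 i))
    (N := N) (le_trans (by exact_mod_cast Finset.card_image_le) hN)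
    (fun σ i => g (z.1 i) (p σ) - g (z.2 i) (p σ)) (δ := 2 * ε) (by positivity) ?_ ht
  · refine le_trans (le_of_eq ?_) key
    congr 1
    refine Finset.sum_congr rfl fun σ _ => ?_
    unfold offsetDeviation
    have e : ∀ i, g ((swapBy σ z).1 i) (P (swapBy σ z).1) - g ((swapBy σ z).2 i) (P (swapBy σ z).1)
        = boolSign (σ i) * (g (z.1 i) (p σ) - g (z.2 i) (p σ)) := by
      intro i
      by_cases h : σ i <;> simp [swapBy, boolSign, h, hp]
    simp only [e, mul_pow]
    have e2 : ∀ i, boolSign (σ i) ^ 2 = 1 := fun i => by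
      rw [← sq_abs, abs_boolSign, one_pow]
    simp only [e2, one_mul]
  · intro σ
    obtain ⟨h, hh, hle⟩ := hG _ ⟨p σ, hPS _, rfl⟩
    refine ⟨_, Finset.mem_image_of_mem _ hh, ?_⟩
    -- A mean square of ε² over 2n points is a sum of 2nε²; bounding the square of a difference
    -- doubles it to (2ε)²n.
    simp only [Fin.sum_univ_add, Fin.append_left, Fin.append_right, Nat.cast_add] at hle
    rw [div_le_iff₀ (by positivity)] at hle ⊢
    calc ∑ i, (g (z.1 i) (p σ) - g (z.2 i) (p σ) - (h (z.1 i) - h (z.2 i))) ^ 2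
        ≤ ∑ i, (2 * (g (z.1 i) (p σ) - h (z.1 i)) ^ 2
            + 2 * (g (z.2 i) (p σ) - h (z.2 i)) ^ 2) := by
          refine Finset.sum_le_sum fun i _ => ?_
          nlinarith [sq_nonneg (g (z.1 i) (p σ) - h (z.1 i) + (g (z.2 i) (p σ) - h (z.2 i)))]
      _ ≤ (2 * ε) ^ 2 * n := by
          rw [Finset.sum_add_distrib, ← Finset.mul_sum, ← Finset.mul_sum]
          linarith

variable [MeasurableSpace 𝓑] [MeasurableSpace Θ]

/-- Regarded as n independent pairs, the two samples are acted on pair by pair, and each pair has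
the exchangeable law ν × ν. -/
theorem measurePreserving_swapBy (ν : Measure 𝓑) [IsProbabilityMeasure ν] (σ : Fin n → Bool) :
    MeasurePreserving (swapBy σ)
      ((Measure.pi fun _ : Fin n => ν).prod (Measure.pi fun _ : Fin n => ν))
      ((Measure.pi fun _ : Fin n => ν).prod (Measure.pi fun _ : Fin n => ν)) := by
  have harrow := measurePreserving_arrowProdEquivProdArrow 𝓑 𝓑 (Fin n) (fun _ => ν) (fun _ => ν)
  have hmid : MeasurePreserving
      (fun (z : Fin n → 𝓑 × 𝓑) i => (if σ i then id else Prod.swap : 𝓑 × 𝓑 → 𝓑 × 𝓑) (z i))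
      (Measure.pi fun _ => ν.prod ν) (Measure.pi fun _ => ν.prod ν) := by
    refine measurePreserving_pi (fun _ => ν.prod ν) (fun _ => ν.prod ν) fun i => ?_
    by_cases h : σ i
    · simpa [h] using MeasurePreserving.id (ν.prod ν)
    · simpa [h] using Measure.measurePreserving_swap (μ := ν) (ν := ν)
  have h := (harrow.comp hmid).comp harrow.symm
  refine (congrArg (fun f => MeasurePreserving f _ _) ?_).mp h
  funext z
  refine Prod.ext (funext fun i => ?_) (funext fun i => ?_) <;>
  · by_cases h : σ i <;>
      simp [swapBy, MeasurableEquiv.arrowProdEquivProdArrow, Equiv.arrowProdEquivProdArrow, h]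

theorem integrable_of_abs_le {α : Type*} [MeasurableSpace α] {μ : Measure α} [IsFiniteMeasure μ]
    {f : α → ℝ} (hf : Measurable f) {K : ℝ} (h : ∀ a, |f a| ≤ K) : Integrable f μ :=
  Integrable.of_bound hf.aestronglyMeasurable K (Eventually.of_forall h)

theorem integral_pi_eval (ν : Measure 𝓑) [IsProbabilityMeasure ν] (f : 𝓑 → ℝ)
    (hf : Measurable f) (i : Fin n) :
    ∫ b, f (b i) ∂(Measure.pi fun _ : Fin n => ν) = ∫ x, f x ∂ν := by
  have h := measurePreserving_eval (fun _ : Fin n => ν) i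
  conv_rhs => rw [← h.map_eq, integral_map h.measurable.aemeasurable hf.aestronglyMeasurable]

theorem integral_pi_avg (hn : 0 < n) (ν : Measure 𝓑) [IsProbabilityMeasure ν] {f : 𝓑 → ℝ}
    (hf : Measurable f) {K : ℝ} (hK : ∀ x, |f x| ≤ K) :
    ∫ b, (∑ i, f (b i)) / n ∂(Measure.pi fun _ : Fin n => ν) = ∫ x, f x ∂ν := by
  have hn' : (n : ℝ) ≠ 0 := by exact_mod_cast hn.ne'
  rw [integral_div, integral_finsetSum]
  · simp only [integral_pi_eval ν f hf, Finset.sum_const, Finset.card_univ, Fintype.card_fin,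
      nsmul_eq_mul]
    field_simp
  · exact fun i _ => integrable_of_abs_le (hf.comp (measurable_pi_apply i)) fun b => hK _

/-- By exchangeability the integral equals the average over all swaps of the swapped integrands, and
that average is bounded pointwise. -/
theorem integral_offsetDeviation_le (hn : 0 < n) (ν : Measure 𝓑) [IsProbabilityMeasure ν]
    {g : 𝓑 → Θ → ℝ} (hg : Measurable fun z : 𝓑 × Θ => g z.1 z.2) {S : Set Θ} {K : ℝ}
    (hK : ∀ b, ∀ p ∈ S, |g b p| ≤ K)
    {P : (Fin n → 𝓑) → Θ} (hP : Measurable P) (hPS : ∀ b, P b ∈ S) {N ε : ℝ} (hε : 0 ≤ ε)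
    (hcov : EmpiricalCover ((fun p b => g b p) '' S) (n + n) N ε) {t : ℝ} (ht : 0 < t) :
    ∫ z, offsetDeviation g P t z
        ∂((Measure.pi fun _ : Fin n => ν).prod (Measure.pi fun _ : Fin n => ν))
      ≤ 2 * ε + t * (2 * ε) ^ 2 + Real.log (2 * N) / (t * n) := by
  set Q := (Measure.pi fun _ : Fin n => ν).prod (Measure.pi fun _ : Fin n => ν) with hQ
  have hm : Measurable (offsetDeviation g P t) := by
    have h1 : ∀ i, Measurable fun z : (Fin n → 𝓑) × (Fin n → 𝓑) => g (z.1 i) (P z.1) := fun i =>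
      hg.comp (((measurable_pi_apply i).comp measurable_fst).prodMk (hP.comp measurable_fst))
    have h2 : ∀ i, Measurable fun z : (Fin n → 𝓑) × (Fin n → 𝓑) => g (z.2 i) (P z.1) := fun i =>
      hg.comp (f := fun z : (Fin n → 𝓑) × (Fin n → 𝓑) => (z.2 i, P z.1))
        (((measurable_pi_apply i).comp measurable_snd).prodMk (hP.comp measurable_fst))
    unfold offsetDeviation
    refine ((Finset.measurable_sum _ fun i _ => (h1 i).sub (h2 i)).abs.div_const _).sub
      (((Finset.measurable_sum _ fun i _ => ((h1 i).sub (h2 i)).pow_const 2).div_const _).const_mul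
        _)
  -- A sample point is needed only to see that K ≥ 0; an empty space carries no probability measure.
  by_cases hne : Nonempty (Fin n → 𝓑)
  swap
  · have : IsEmpty ((Fin n → 𝓑) × (Fin n → 𝓑)) := ⟨fun z => hne ⟨z.1⟩⟩
    have := IsProbabilityMeasure.ne_zero Q
    exact absurd (Measure.eq_zero_of_isEmpty Q) this
  obtain ⟨b₀⟩ := hne
  have hK0 : 0 ≤ K := (abs_nonneg _).trans (hK (b₀ ⟨0, hn⟩) (P b₀) (hPS b₀))
  have hb : ∀ z, |offsetDeviation g P t z| ≤ 2 * K + t * (2 * K) ^ 2 := by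
    intro z
    have hi : ∀ i, |g (z.1 i) (P z.1) - g (z.2 i) (P z.1)| ≤ 2 * K := fun i =>
      (abs_sub _ _).trans (by linarith [hK (z.1 i) _ (hPS z.1), hK (z.2 i) _ (hPS z.1)])
    have h1 := abs_avg_le (by positivity) hi
    have h2 : |(∑ i, (g (z.1 i) (P z.1) - g (z.2 i) (P z.1)) ^ 2) / n| ≤ (2 * K) ^ 2 :=
      abs_avg_le (by positivity) fun i => by
        rw [abs_pow]
        exact pow_le_pow_left₀ (abs_nonneg _) (hi i) 2
    unfold offsetDeviation
    refine (abs_sub _ _).trans (add_le_add ?_ ?_)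
    · rw [abs_div, abs_abs, ← abs_div]
      exact h1
    · rw [abs_mul, abs_of_pos ht]
      exact mul_le_mul_of_nonneg_left h2 ht.le
  have hswap : ∀ σ : Fin n → Bool, ∫ z, offsetDeviation g P t (swapBy σ z) ∂Q
      = ∫ z, offsetDeviation g P t z ∂Q := by
    intro σ
    have h := measurePreserving_swapBy ν σ
    conv_rhs => rw [hQ, ← h.map_eq]
    rw [integral_map h.measurable.aemeasurable hm.aestronglyMeasurable]
  have hint : ∀ σ : Fin n → Bool, Integrable (fun z => offsetDeviation g P t (swapBy σ z)) Q :=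
    fun σ => integrable_of_abs_le (hm.comp (measurePreserving_swapBy ν σ).measurable) fun z => hb _
  calc ∫ z, offsetDeviation g P t z ∂Q
      = (1 / 2 ^ n : ℝ) * ∑ σ : Fin n → Bool, ∫ z, offsetDeviation g P t (swapBy σ z) ∂Q := by
        simp [hswap]
    _ = ∫ z, (1 / 2 ^ n : ℝ) * ∑ σ : Fin n → Bool, offsetDeviation g P t (swapBy σ z) ∂Q := by
        rw [integral_const_mul, integral_finsetSum _ fun σ _ => hint σ]
    _ ≤ ∫ _, (2 * ε + t * (2 * ε) ^ 2 + Real.log (2 * N) / (t * n)) ∂Q := by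
        refine integral_mono ((integrable_finsetSum _ fun σ _ => hint σ).const_mul _)
          (integrable_const _) fun z => ?_
        exact avg_offsetDeviation_swapBy_le hn hPS hε hcov ht z
    _ = _ := by simp

/-- Expected deviation of the empirical mean from the population mean, at an index computed from
the sample. -/
theorem integral_abs_avg_sub_integral_le (hn : 0 < n) (ν : Measure 𝓑) [IsProbabilityMeasure ν]
    {g : 𝓑 → Θ → ℝ} (hg : Measurable fun z : 𝓑 × Θ => g z.1 z.2) {S : Set Θ} {K : ℝ}
    (hK : ∀ b, ∀ p ∈ S, |g b p| ≤ K)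
    {P : (Fin n → 𝓑) → Θ} (hP : Measurable P) (hPS : ∀ b, P b ∈ S) {N ε : ℝ} (hε : 0 ≤ ε)
    (hcov : EmpiricalCover ((fun p b => g b p) '' S) (n + n) N ε) {t : ℝ} (ht : 0 < t) :
    ∫ b, |(∑ i, g (b i) (P b)) / n - ∫ x, g x (P b) ∂ν| ∂(Measure.pi fun _ : Fin n => ν)
      ≤ 2 * t * (∫ b, (∑ i, g (b i) (P b) ^ 2) / n ∂(Measure.pi fun _ : Fin n => ν)
          + ∫ b, ∫ x, g x (P b) ^ 2 ∂ν ∂(Measure.pi fun _ : Fin n => ν))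
        + (2 * ε + t * (2 * ε) ^ 2 + Real.log (2 * N) / (t * n)) := by
  have hn' : (0 : ℝ) < n := by exact_mod_cast hn
  have hoff := integral_offsetDeviation_le hn ν hg hK hP hPS hε hcov ht
  set Q := Measure.pi fun _ : Fin n => ν with hQ
  by_cases hne : Nonempty (Fin n → 𝓑)
  swap
  · have : IsEmpty (Fin n → 𝓑) := not_nonempty_iff.1 hne
    exact absurd (Measure.eq_zero_of_isEmpty Q) (IsProbabilityMeasure.ne_zero Q)
  obtain ⟨b₀⟩ := hne
  have hK0 : 0 ≤ K := (abs_nonneg _).trans (hK (b₀ ⟨0, hn⟩) (P b₀) (hPS b₀))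
  have h1 : ∀ i, Measurable fun z : (Fin n → 𝓑) × (Fin n → 𝓑) => g (z.1 i) (P z.1) := fun i =>
    hg.comp (((measurable_pi_apply i).comp measurable_fst).prodMk (hP.comp measurable_fst))
  have h2 : ∀ i, Measurable fun z : (Fin n → 𝓑) × (Fin n → 𝓑) => g (z.2 i) (P z.1) := fun i =>
    hg.comp (f := fun z : (Fin n → 𝓑) × (Fin n → 𝓑) => (z.2 i, P z.1))
        (((measurable_pi_apply i).comp measurable_snd).prodMk (hP.comp measurable_fst))
  have hgp : ∀ p, Measurable fun x => g x p := fun p =>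
    hg.comp (measurable_id.prodMk measurable_const)
  have hsq : ∀ b, ∀ p ∈ S, |g b p ^ 2| ≤ K ^ 2 := fun b p hp => by
    rw [abs_pow]; exact pow_le_pow_left₀ (abs_nonneg _) (hK b p hp) 2
  set A : (Fin n → 𝓑) × (Fin n → 𝓑) → ℝ := fun z =>
    |∑ i, (g (z.1 i) (P z.1) - g (z.2 i) (P z.1))| / n with hA
  have hAm : Measurable A :=
    (Finset.measurable_sum _ fun i _ => (h1 i).sub (h2 i)).abs.div_const _
  have hAb : ∀ z, |A z| ≤ 2 * K := fun z => by
    rw [hA]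
    dsimp only
    rw [abs_div, abs_abs, ← abs_div]
    exact abs_avg_le (by positivity) fun i =>
      (abs_sub _ _).trans (by linarith [hK (z.1 i) _ (hPS z.1), hK (z.2 i) _ (hPS z.1)])
  have hAi : Integrable A (Q.prod Q) := integrable_of_abs_le hAm hAb
  set V : (Fin n → 𝓑) × (Fin n → 𝓑) → ℝ := fun z =>
    (∑ i, (g (z.1 i) (P z.1) - g (z.2 i) (P z.1)) ^ 2) / n with hV
  have hVm : Measurable V :=
    (Finset.measurable_sum _ fun i _ => ((h1 i).sub (h2 i)).pow_const 2).div_const _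
  have hVi : Integrable V (Q.prod Q) := by
    refine integrable_of_abs_le (K := (2 * K) ^ 2) hVm fun z => abs_avg_le (by positivity) fun i => ?_
    rw [abs_pow]
    exact pow_le_pow_left₀ (abs_nonneg _) ((abs_sub _ _).trans
      (by linarith [hK (z.1 i) _ (hPS z.1), hK (z.2 i) _ (hPS z.1)])) 2
  set V₁ : (Fin n → 𝓑) × (Fin n → 𝓑) → ℝ := fun z => (∑ i, g (z.1 i) (P z.1) ^ 2) / n with hV₁
  set V₂ : (Fin n → 𝓑) × (Fin n → 𝓑) → ℝ := fun z => (∑ i, g (z.2 i) (P z.1) ^ 2) / n with hV₂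
  have hV₁i : Integrable V₁ (Q.prod Q) :=
    integrable_of_abs_le (K := K ^ 2)
      ((Finset.measurable_sum _ fun i _ => (h1 i).pow_const 2).div_const _)
      fun z => abs_avg_le (by positivity) fun i => hsq _ _ (hPS _)
  have hV₂i : Integrable V₂ (Q.prod Q) :=
    integrable_of_abs_le (K := K ^ 2)
      ((Finset.measurable_sum _ fun i _ => (h2 i).pow_const 2).div_const _)
      fun z => abs_avg_le (by positivity) fun i => hsq _ _ (hPS _)
  have hV₁e : ∫ z, V₁ z ∂(Q.prod Q) = ∫ b, (∑ i, g (b i) (P b) ^ 2) / n ∂Q := by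
    rw [integral_prod _ hV₁i]
    simp [hV₁]
  have hV₂e : ∫ z, V₂ z ∂(Q.prod Q) = ∫ b, ∫ x, g x (P b) ^ 2 ∂ν ∂Q := by
    rw [integral_prod _ hV₂i]
    refine integral_congr_ae (Eventually.of_forall fun b => ?_)
    exact integral_pi_avg hn ν ((hgp (P b)).pow_const 2) fun x => hsq _ _ (hPS b)
  have hVle : ∫ z, V z ∂(Q.prod Q) ≤ 2 * (∫ z, V₁ z ∂(Q.prod Q) + ∫ z, V₂ z ∂(Q.prod Q)) := by
    rw [← integral_add hV₁i hV₂i, ← integral_const_mul]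
    refine integral_mono hVi ((hV₁i.add hV₂i).const_mul 2) fun z => ?_
    simp only [hV, hV₁, hV₂]
    rw [← add_div, ← mul_div_assoc, ← Finset.sum_add_distrib, Finset.mul_sum]
    refine div_le_div_of_nonneg_right (Finset.sum_le_sum fun i _ => ?_) hn'.le
    nlinarith [sq_nonneg (g (z.1 i) (P z.1) + g (z.2 i) (P z.1))]
  have hoff' : ∫ z, A z ∂(Q.prod Q) - t * ∫ z, V z ∂(Q.prod Q)
      ≤ 2 * ε + t * (2 * ε) ^ 2 + Real.log (2 * N) / (t * n) := by
    rw [← integral_const_mul, ← integral_sub hAi (hVi.const_mul t)]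
    exact hoff
  -- The index depends on the first sample alone. With that sample fixed, the population mean is the
  -- expectation of the ghost average, and Jensen moves the absolute value inside.
  have hjensen : ∫ b, |(∑ i, g (b i) (P b)) / n - ∫ x, g x (P b) ∂ν| ∂Q
      ≤ ∫ z, A z ∂(Q.prod Q) := by
    rw [integral_prod _ hAi]
    refine integral_mono_of_nonneg (Eventually.of_forall fun b => abs_nonneg _)
      hAi.integral_prod_left (Eventually.of_forall fun b => ?_)
    have hf : Integrable (fun b' : Fin n → 𝓑 => (∑ i, g (b' i) (P b)) / n) Q :=
      integrable_of_abs_le (K := K)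
        ((Finset.measurable_sum _ fun i _ => (hgp (P b)).comp (measurable_pi_apply i)).div_const _)
        fun b' => abs_avg_le hK0 fun i => hK _ _ (hPS b)
    have e : (∑ i, g (b i) (P b)) / n - ∫ x, g x (P b) ∂ν
        = ∫ b', (∑ i, (g (b i) (P b) - g (b' i) (P b))) / n ∂Q := by
      rw [← integral_pi_avg hn ν (hgp (P b)) fun x => hK x _ (hPS b)]
      have : ∀ b' : Fin n → 𝓑, (∑ i, (g (b i) (P b) - g (b' i) (P b))) / n
          = (∑ i, g (b i) (P b)) / n - (∑ i, g (b' i) (P b)) / n := fun b' => by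
        rw [Finset.sum_sub_distrib, sub_div]
      simp_rw [this]
      rw [integral_sub (integrable_const _) hf, integral_const, probReal_univ, one_smul]
    dsimp only
    rw [e]
    refine (abs_integral_le_integral_abs).trans (le_of_eq ?_)
    refine integral_congr_ae (Eventually.of_forall fun b' => ?_)
    simp only [hA, abs_div, Nat.abs_cast]
  rw [hV₁e, hV₂e] at hVle
  have := mul_le_mul_of_nonneg_left hVle ht.le
  linarith

end Symmetrization

/-! ### Rates for empirical deviations at a data-dependent index -/

/-- The law of an i.i.d. sample of size `n`. -/
abbrev sampleLaw {𝓑 : Type*} [MeasurableSpace 𝓑] (ν : Measure 𝓑) (n : ℕ) : Measure (Fin n → 𝓑) :=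
  Measure.pi fun _ : Fin n => ν

/-- Empirical mean minus population mean of `g` at an index computed from the sample. -/
def empDev {𝓑 Θ : Type*} [MeasurableSpace 𝓑] {n : ℕ} (ν : Measure 𝓑) (g : 𝓑 → Θ → ℝ)
    (P : (Fin n → 𝓑) → Θ) (b : Fin n → 𝓑) : ℝ :=
  (∑ i, g (b i) (P b)) / n - ∫ x, g x (P b) ∂ν

theorem tendsto_natCast_rpow_zero {s : ℝ} (hs : s < 0) :
    Tendsto (fun n : ℕ => (n : ℝ) ^ s) atTop (𝓝 0) := by
  have := (tendsto_rpow_neg_atTop (y := -s) (by linarith)).comp tendsto_natCast_atTop_atTop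
  simpa [Function.comp_def] using this

theorem tendsto_natCast_rpow_mul_log_zero {s : ℝ} (hs : s < 0) :
    Tendsto (fun n : ℕ => (n : ℝ) ^ s * Real.log n) atTop (𝓝 0) := by
  have h := (isLittleO_log_rpow_atTop (r := -s) (by linarith)).tendsto_div_nhds_zero.comp
    tendsto_natCast_atTop_atTop
  refine h.congr' ?_
  filter_upwards [eventually_gt_atTop 0] with n hn
  have hn' : (0 : ℝ) < n := by exact_mod_cast hn
  simp only [Function.comp_apply]
  rw [Real.rpow_neg hn'.le, div_inv_eq_mul, mul_comm]

section

variable {𝓑 Θ : Type*} [MeasurableSpace 𝓑]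

theorem abs_integral_le_of_abs_le (ν : Measure 𝓑) [IsProbabilityMeasure ν] {f : 𝓑 → ℝ} {K : ℝ} (hK : ∀ x, |f x| ≤ K) :
    |∫ x, f x ∂ν| ≤ K := by
  simpa using norm_integral_le_of_norm_le_const (μ := ν) (f := f) (Eventually.of_forall hK)

theorem abs_empDev_le (ν : Measure 𝓑) [IsProbabilityMeasure ν] {n : ℕ} (hn : 0 < n) {g : 𝓑 → Θ → ℝ} {S : Set Θ} {K : ℝ}
    (hK : ∀ b, ∀ p ∈ S, |g b p| ≤ K) {P : (Fin n → 𝓑) → Θ} (hPS : ∀ b, P b ∈ S)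
    (b : Fin n → 𝓑) : |empDev ν g P b| ≤ 2 * K := by
  have hK0 : 0 ≤ K := (abs_nonneg _).trans (hK (b ⟨0, hn⟩) (P b) (hPS b))
  have h1 : |(∑ i, g (b i) (P b)) / n| ≤ K := abs_avg_le hK0 fun i => hK _ _ (hPS b)
  have h2 := abs_integral_le_of_abs_le ν fun x => hK x _ (hPS b)
  exact (abs_sub _ _).trans (by linarith)

variable [MeasurableSpace Θ]

theorem measurable_apply_eval {n : ℕ} {g : 𝓑 → Θ → ℝ} (hg : Measurable fun z : 𝓑 × Θ => g z.1 z.2)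
    {P : (Fin n → 𝓑) → Θ} (hP : Measurable P) (i : Fin n) :
    Measurable fun b : Fin n → 𝓑 => g (b i) (P b) :=
  hg.comp ((measurable_pi_apply i).prodMk hP)

theorem measurable_section {g : 𝓑 → Θ → ℝ} (hg : Measurable fun z : 𝓑 × Θ => g z.1 z.2) (p : Θ) :
    Measurable fun x => g x p :=
  hg.comp (measurable_id.prodMk measurable_const)

theorem measurable_avg {n : ℕ} {g : 𝓑 → Θ → ℝ} (hg : Measurable fun z : 𝓑 × Θ => g z.1 z.2)
    {P : (Fin n → 𝓑) → Θ} (hP : Measurable P) :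
    Measurable fun b : Fin n → 𝓑 => (∑ i, g (b i) (P b)) / n :=
  (Finset.measurable_sum _ fun i _ => measurable_apply_eval hg hP i).div_const _

variable (ν : Measure 𝓑) [IsProbabilityMeasure ν]

theorem measurable_integral_comp {n : ℕ} {g : 𝓑 → Θ → ℝ}
    (hg : Measurable fun z : 𝓑 × Θ => g z.1 z.2) {P : (Fin n → 𝓑) → Θ} (hP : Measurable P) :
    Measurable fun b : Fin n → 𝓑 => ∫ x, g x (P b) ∂ν :=
  (StronglyMeasurable.integral_prod_left' (f := fun z : 𝓑 × (Fin n → 𝓑) => g z.1 (P z.2))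
    (hg.comp (f := fun z : 𝓑 × (Fin n → 𝓑) => (z.1, P z.2))
      (measurable_fst.prodMk (hP.comp measurable_snd))).stronglyMeasurable).measurable

theorem measurable_empDev {n : ℕ} {g : 𝓑 → Θ → ℝ} (hg : Measurable fun z : 𝓑 × Θ => g z.1 z.2)
    {P : (Fin n → 𝓑) → Θ} (hP : Measurable P) : Measurable (empDev ν g P) :=
  (measurable_avg hg hP).sub (measurable_integral_comp ν hg hP)

theorem integrable_empDev {n : ℕ} (hn : 0 < n) {g : 𝓑 → Θ → ℝ}
    (hg : Measurable fun z : 𝓑 × Θ => g z.1 z.2) {S : Set Θ} {K : ℝ}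
    (hK : ∀ b, ∀ p ∈ S, |g b p| ≤ K) {P : (Fin n → 𝓑) → Θ} (hP : Measurable P)
    (hPS : ∀ b, P b ∈ S) : Integrable (empDev ν g P) (sampleLaw ν n) :=
  integrable_of_abs_le (measurable_empDev ν hg hP) (abs_empDev_le ν hn hK hPS)

variable {g : 𝓑 → Θ → ℝ} (hg : Measurable fun z : 𝓑 × Θ => g z.1 z.2) {S : Set Θ} {K : ℝ}
  (hK : ∀ b, ∀ p ∈ S, |g b p| ≤ K) {P : ∀ n, (Fin n → 𝓑) → Θ} (hP : ∀ n, Measurable (P n))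
  (hPS : ∀ n, 0 < n → ∀ b, P n b ∈ S) {C h c : ℝ} (hC : 0 < C) (hc : 0 ≤ c)
  (hcov : ∀ n : ℕ, 2 ≤ n →
    EmpiricalCover ((fun p b => g b p) '' S) (n + n) (C * (n : ℝ) ^ h) (c / n))

include hg hK hP hPS hC hc hcov

/-- The penalty is t = n^(-β). The entropy term is then of order n^(α+β-1) log n, which vanishes
since α + β < 1, and the second moments are multiplied by n^(α-β), which is the product that `hV`
controls. -/
theorem tendsto_rpow_mul_integral_abs_empDev {α β : ℝ} (hβ : 0 ≤ β) (hα : α < 1)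
    (hαβ : α + β < 1)
    (hV : Tendsto (fun n : ℕ => (n : ℝ) ^ (α - β) *
      (∫ b, (∑ i, g (b i) (P n b) ^ 2) / n ∂(sampleLaw ν n)
        + ∫ b, ∫ x, g x (P n b) ^ 2 ∂ν ∂(sampleLaw ν n))) atTop (𝓝 0)) :
    Tendsto (fun n : ℕ => (n : ℝ) ^ α * ∫ b, |empDev ν g (P n) b| ∂(sampleLaw ν n))
      atTop (𝓝 0) := by
  have hlim : Tendsto (fun n : ℕ => 2 * ((n : ℝ) ^ (α - β) *
      (∫ b, (∑ i, g (b i) (P n b) ^ 2) / n ∂(sampleLaw ν n)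
        + ∫ b, ∫ x, g x (P n b) ^ 2 ∂ν ∂(sampleLaw ν n)))
      + (2 * c * (n : ℝ) ^ (α - 1) + 4 * c ^ 2 * (n : ℝ) ^ (α - β - 2)
        + (Real.log (2 * C) * (n : ℝ) ^ (α + β - 1)
          + h * ((n : ℝ) ^ (α + β - 1) * Real.log n)))) atTop (𝓝 0) := by
    have h1 := tendsto_natCast_rpow_zero (s := α - 1) (by linarith)
    have h2 := tendsto_natCast_rpow_zero (s := α - β - 2) (by linarith)
    have h3 := tendsto_natCast_rpow_zero (s := α + β - 1) (by linarith)
    have h4 := tendsto_natCast_rpow_mul_log_zero (s := α + β - 1) (by linarith)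
    have := (hV.const_mul 2).add (((h1.const_mul (2 * c)).add (h2.const_mul (4 * c ^ 2))).add
      ((h3.const_mul (Real.log (2 * C))).add (h4.const_mul h)))
    simpa using this
  refine squeeze_zero' (Eventually.of_forall fun n => mul_nonneg (by positivity)
    (integral_nonneg fun b => abs_nonneg _)) ?_ hlim
  filter_upwards [eventually_ge_atTop 2] with n hn
  have hn0 : 0 < n := by omega
  have hn' : (0 : ℝ) < n := by exact_mod_cast hn0
  have key := integral_abs_avg_sub_integral_le hn0 ν hg hK (hP n) (hPS n hn0)
    (by positivity) (hcov n hn) (t := (n : ℝ) ^ (-β)) (by positivity)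
  refine (mul_le_mul_of_nonneg_left key (by positivity)).trans (le_of_eq ?_)
  have e1 : (n : ℝ) ^ (α - β) = (n : ℝ) ^ α * (n : ℝ) ^ (-β) := by
    rw [← Real.rpow_add hn']; rfl
  have e2 : (n : ℝ) ^ (α - 1) = (n : ℝ) ^ α / n := by
    rw [Real.rpow_sub hn', Real.rpow_one]
  have e3 : (n : ℝ) ^ (α - β - 2) = (n : ℝ) ^ α * (n : ℝ) ^ (-β) / n ^ 2 := by
    rw [Real.rpow_sub hn', e1]; norm_num
  have e4 : (n : ℝ) ^ (α + β - 1) = (n : ℝ) ^ α / ((n : ℝ) ^ (-β) * n) := by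
    rw [Real.rpow_sub hn', Real.rpow_one, Real.rpow_add hn', Real.rpow_neg hn'.le]
    field_simp
  have e5 : Real.log (2 * (C * (n : ℝ) ^ h)) = Real.log (2 * C) + h * Real.log n := by
    rw [← mul_assoc, Real.log_mul (by positivity) (by positivity), Real.log_rpow hn']
  rw [e1, e2, e3, e4, e5]
  ring

/-- A crude rate, valid without any localization of the index. -/
theorem tendsto_rpow_mul_integral_abs_empDev_of_bounded {α : ℝ} (hα : α < 1 / 2) :
    Tendsto (fun n : ℕ => (n : ℝ) ^ α * ∫ b, |empDev ν g (P n) b| ∂(sampleLaw ν n))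
      atTop (𝓝 0) := by
  refine tendsto_rpow_mul_integral_abs_empDev ν hg hK hP hPS hC hc hcov (β := 1 / 2)
    (by norm_num) (by linarith) (by linarith) ?_
  have hlim := (tendsto_natCast_rpow_zero (s := α - 1 / 2) (by linarith)).mul_const (2 * K ^ 2)
  rw [zero_mul] at hlim
  refine squeeze_zero' (Eventually.of_forall fun n => ?_) ?_ hlim
  · refine mul_nonneg (by positivity) (add_nonneg (integral_nonneg fun b => ?_)
      (integral_nonneg fun b => integral_nonneg fun x => sq_nonneg _))
    exact div_nonneg (Finset.sum_nonneg fun i _ => sq_nonneg _) (Nat.cast_nonneg _)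
  · filter_upwards [eventually_gt_atTop 0] with n hn
    refine mul_le_mul_of_nonneg_left ?_ (by positivity)
    have hsq : ∀ x b, |g x (P n b) ^ 2| ≤ K ^ 2 := fun x b => by
      rw [abs_pow]; exact pow_le_pow_left₀ (abs_nonneg _) (hK _ _ (hPS n hn b)) 2
    have h1 := (le_abs_self _).trans (abs_integral_le_of_abs_le (sampleLaw ν n)
      (f := fun b => (∑ i, g (b i) (P n b) ^ 2) / n) (K := K ^ 2)
      fun b => abs_avg_le (by positivity) fun i => hsq _ _)
    have h2 := (le_abs_self _).trans (abs_integral_le_of_abs_le (sampleLaw ν n)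
      (f := fun b => ∫ x, g x (P n b) ^ 2 ∂ν) (K := K ^ 2)
      fun b => abs_integral_le_of_abs_le ν fun x => hsq _ _)
    linarith

/-- Stochastic equicontinuity at `p₀`, in mean: if the index converges to `p₀` at some polynomial
rate in `L₂(ν)`, then the recentred empirical process vanishes. -/
theorem tendsto_sqrt_mul_integral_abs_empDev_sub {p₀ : Θ} (hp₀ : p₀ ∈ S)
    (hconv : Tendsto (fun n : ℕ => (n : ℝ) ^ (1 / 8 : ℝ) *
      ∫ b, ∫ x, (g x (P n b) - g x p₀) ^ 2 ∂ν ∂(sampleLaw ν n)) atTop (𝓝 0)) :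
    Tendsto (fun n : ℕ => (n : ℝ) ^ (1 / 2 : ℝ) *
      ∫ b, |empDev ν (fun x p => g x p - g x p₀) (P n) b| ∂(sampleLaw ν n)) atTop (𝓝 0) := by
  by_cases hB : Nonempty 𝓑
  swap
  · have : IsEmpty 𝓑 := not_nonempty_iff.1 hB
    exact absurd (Measure.eq_zero_of_isEmpty ν) (IsProbabilityMeasure.ne_zero ν)
  obtain ⟨x₀⟩ := hB
  have hK0 : 0 ≤ K := (abs_nonneg _).trans (hK x₀ p₀ hp₀)
  have hg₀ : Measurable fun z : 𝓑 × Θ => g z.1 z.2 - g z.1 p₀ :=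
    hg.sub ((measurable_section hg p₀).comp measurable_fst)
  have hK₀ : ∀ b, ∀ p ∈ S, |g b p - g b p₀| ≤ 2 * K := fun b p hp =>
    (abs_sub _ _).trans (by linarith [hK b p hp, hK b p₀ hp₀])
  have hKsq : ∀ b, ∀ p ∈ S, |(g b p - g b p₀) ^ 2| ≤ (2 * K) ^ 2 := fun b p hp => by
    rw [abs_pow]; exact pow_le_pow_left₀ (abs_nonneg _) (hK₀ b p hp) 2
  -- The crude rate for the squared increments reduces their empirical second moment to the
  -- population one.
  have hsq := tendsto_rpow_mul_integral_abs_empDev_of_bounded ν (hg₀.pow_const 2) hKsq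
    hP hPS hC (c := 4 * K * c) (h := h) (by positivity) (fun n hn => by
      have h1 := (hcov n hn).sq_sub hK0 (f₀ := fun b => g b p₀)
        (by rintro _ ⟨p, hp, rfl⟩ b; exact hK b p hp) (fun b => hK b p₀ hp₀)
      rw [Set.image_image] at h1
      rwa [mul_div_assoc]) (α := 1 / 8) (by norm_num)
  -- With α = 1/2 and β = 3/8 the sum is 7/8 < 1, and the second moments are required to be
  -- o(n^(-1/8)).
  refine tendsto_rpow_mul_integral_abs_empDev ν hg₀ hK₀ hP hPS hC hc (fun n hn => by
    have h1 := (hcov n hn).sub_const (fun b => g b p₀)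
    rwa [Set.image_image] at h1) (β := 3 / 8) (by norm_num) (by norm_num) (by norm_num) ?_
  have hlim := hsq.add (hconv.const_mul 2)
  rw [mul_zero, add_zero] at hlim
  refine squeeze_zero' (Eventually.of_forall fun n => ?_) ?_ hlim
  · refine mul_nonneg (by positivity) (add_nonneg (integral_nonneg fun b => ?_)
      (integral_nonneg fun b => integral_nonneg fun x => sq_nonneg _))
    exact div_nonneg (Finset.sum_nonneg fun i _ => sq_nonneg _) (Nat.cast_nonneg _)
  · filter_upwards [eventually_gt_atTop 0] with n hn
    have e : (1 / 2 - 3 / 8 : ℝ) = 1 / 8 := by norm_num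
    rw [e, mul_left_comm 2, ← mul_add]
    refine mul_le_mul_of_nonneg_left ?_ (by positivity)
    have hi1 := integrable_empDev ν hn (hg₀.pow_const 2) hKsq (hP n) (hPS n hn)
    have hi2 : Integrable (fun b : Fin n → 𝓑 => ∫ x, (g x (P n b) - g x p₀) ^ 2 ∂ν)
        (sampleLaw ν n) :=
      integrable_of_abs_le (measurable_integral_comp ν (g := fun x p => (g x p - g x p₀) ^ 2)
        (hg₀.pow_const 2) (hP n))
        fun b => abs_integral_le_of_abs_le ν fun x => hKsq x _ (hPS n hn b)
    have hi3 : Integrable (fun b : Fin n → 𝓑 => (∑ i, (g (b i) (P n b) - g (b i) p₀) ^ 2) / n)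
        (sampleLaw ν n) :=
      integrable_of_abs_le (measurable_avg (g := fun x p => (g x p - g x p₀) ^ 2)
        (hg₀.pow_const 2) (hP n))
        fun b => abs_avg_le (by positivity) fun i => hKsq _ _ (hPS n hn b)
    have hle : ∫ b, (∑ i, (g (b i) (P n b) - g (b i) p₀) ^ 2) / n ∂(sampleLaw ν n)
        ≤ ∫ b, |empDev ν (fun x p => (g x p - g x p₀) ^ 2) (P n) b| ∂(sampleLaw ν n)
          + ∫ b, ∫ x, (g x (P n b) - g x p₀) ^ 2 ∂ν ∂(sampleLaw ν n) := by
      rw [← integral_add hi1.abs hi2]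
      refine integral_mono hi3 (hi1.abs.add hi2) fun b => ?_
      have := le_abs_self (empDev ν (fun x p => (g x p - g x p₀) ^ 2) (P n) b)
      simp only [empDev] at this ⊢
      linarith
    linarith

end

/-! ### Asymptotic linearity of outcomes at approximately clearing cutoffs -/

theorem norm_le_sum_abs_apply {J : ℕ} (v : RJ J) : ‖v‖ ≤ ∑ j, |v j| := by
  refine le_of_sq_le_sq ?_ (Finset.sum_nonneg fun j _ => abs_nonneg _)
  rw [EuclideanSpace.real_norm_sq_eq]
  have := Finset.sum_sq_le_sq_sum_of_nonneg (s := Finset.univ) (f := fun j => |v j|)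
    fun j _ => abs_nonneg _
  simpa using this

theorem abs_apply_le_norm {J : ℕ} (v : RJ J) (j : Fin J) : |v j| ≤ ‖v‖ := by
  simpa using PiLp.norm_apply_le v j

/-! ### Moment bounds for centred i.i.d. averages at a fixed index. -/

section Variance

variable {𝓑 : Type*} [MeasurableSpace 𝓑] (ν : Measure 𝓑) [IsProbabilityMeasure ν] {n : ℕ}
  {f : 𝓑 → ℝ} {K : ℝ}

theorem integral_sq_avg_sub_le (hn : 0 < n) (hf : Measurable f) (hK : ∀ x, |f x| ≤ K) :
    ∫ b, ((∑ i, f (b i)) / n - ∫ x, f x ∂ν) ^ 2 ∂(sampleLaw ν n) ≤ K ^ 2 / n := by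
  have hn' : (0 : ℝ) < n := by exact_mod_cast hn
  have hmem : MemLp f 2 ν := MemLp.of_bound hf.aestronglyMeasurable K (Eventually.of_forall hK)
  have hvar := variance_sum_pi (μ := fun _ : Fin n => ν) (X := fun _ => f) fun _ => hmem
  have hVf : Var[f; ν] ≤ K ^ 2 := by
    refine (variance_le_expectation_sq hf.aestronglyMeasurable).trans ?_
    refine (le_abs_self _).trans (abs_integral_le_of_abs_le ν fun x => ?_)
    simp only [Pi.pow_apply, abs_pow]
    exact pow_le_pow_left₀ (abs_nonneg _) (hK x) 2
  have hmeas : Measurable (∑ i : Fin n, fun b : Fin n → 𝓑 => f (b i)) := by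
    have e : (∑ i : Fin n, fun b : Fin n → 𝓑 => f (b i)) = fun b => ∑ i, f (b i) := by
      ext; simp
    rw [e]
    exact Finset.measurable_sum _ fun i _ => hf.comp (measurable_pi_apply i)
  rw [variance_eq_integral hmeas.aemeasurable] at hvar
  have hmean : ∫ b, (∑ i : Fin n, fun b : Fin n → 𝓑 => f (b i)) b ∂(sampleLaw ν n)
      = n * ∫ x, f x ∂ν := by
    rw [← integral_pi_avg hn ν hf hK, integral_div]
    simp only [Finset.sum_apply]
    field_simp
  rw [hmean] at hvar
  have e : ∀ b : Fin n → 𝓑, ((∑ i, f (b i)) / n - ∫ x, f x ∂ν) ^ 2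
      = (1 / n ^ 2) * ((∑ i : Fin n, fun b : Fin n → 𝓑 => f (b i)) b - n * ∫ x, f x ∂ν) ^ 2 := by
    intro b
    simp only [Finset.sum_apply]
    field_simp
  simp_rw [e]
  rw [integral_const_mul, hvar]
  simp only [Finset.sum_const, Finset.card_univ, Fintype.card_fin, nsmul_eq_mul]
  calc (1 / (n : ℝ) ^ 2) * (n * Var[f; ν]) = Var[f; ν] / n := by field_simp
    _ ≤ K ^ 2 / n := by gcongr

theorem integral_abs_avg_sub_le (hn : 0 < n) (hf : Measurable f) (hK : ∀ x, |f x| ≤ K)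
    (hK0 : 0 ≤ K) :
    ∫ b, |(∑ i, f (b i)) / n - ∫ x, f x ∂ν| ∂(sampleLaw ν n) ≤ K / Real.sqrt n := by
  have hn' : (0 : ℝ) < n := by exact_mod_cast hn
  have hm : Measurable fun b : Fin n → 𝓑 => (∑ i, f (b i)) / n - ∫ x, f x ∂ν :=
    ((Finset.measurable_sum _ fun i _ => hf.comp (measurable_pi_apply i)).div_const _).sub_const _
  have hb : ∀ b : Fin n → 𝓑, |(∑ i, f (b i)) / n - ∫ x, f x ∂ν| ≤ 2 * K := fun b =>
    (abs_sub _ _).trans (by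
      linarith [abs_avg_le hK0 fun i => hK (b i), abs_integral_le_of_abs_le ν hK])
  have hmem : MemLp (fun b : Fin n → 𝓑 => |(∑ i, f (b i)) / n - ∫ x, f x ∂ν|) 2 (sampleLaw ν n) :=
    MemLp.of_bound hm.abs.aestronglyMeasurable (2 * K)
      (Eventually.of_forall fun b => by rw [Real.norm_eq_abs, abs_abs]; exact hb b)
  -- Nonnegativity of the variance of |Z| is the inequality (E|Z|)² ≤ E[Z²].
  have hv := variance_nonneg (fun b : Fin n → 𝓑 => |(∑ i, f (b i)) / n - ∫ x, f x ∂ν|)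
    (sampleLaw ν n)
  rw [variance_eq_sub hmem] at hv
  have hsq := integral_sq_avg_sub_le ν hn hf hK
  refine le_of_sq_le_sq ?_ (by positivity)
  rw [div_pow, Real.sq_sqrt hn'.le]
  refine le_trans ?_ hsq
  simp only [Pi.pow_apply, sq_abs] at hv
  linarith

end Variance

/-- The vector of means `E[d(b, p)]`, coordinatewise. -/
def meanVec {𝓑 : Type*} [MeasurableSpace 𝓑] {J : ℕ} (ν : Measure 𝓑) (d : 𝓑 → RJ J → RJ J)
    (p : RJ J) : RJ J := WithLp.toLp 2 fun j => ∫ x, d x p j ∂ν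

/-- Cutoffs `P n`, computed from i.i.d. submissions with law `ν`, that clear the market up to
`o(n^(-1/2))` in mean, when the population market has the well-behaved equilibrium `p₀`. -/
structure ClearingSequence {𝓑 : Type*} [MeasurableSpace 𝓑] {J : ℕ} (ν : Measure 𝓑)
    (d : 𝓑 → RJ J → RJ J) (y : 𝓑 → RJ J → ℝ) (cap : RJ J) (S : Set (RJ J))
    (P : ∀ n, (Fin n → 𝓑) → RJ J) (p₀ : RJ J) (K : ℝ) : Prop where
  measurable_d : Measurable fun z : 𝓑 × RJ J => d z.1 z.2
  measurable_y : Measurable fun z : 𝓑 × RJ J => y z.1 z.2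
  measurable_P : ∀ n, Measurable (P n)
  mem : ∀ n, 0 < n → ∀ b, P n b ∈ S
  mem_base : p₀ ∈ S
  bound_nonneg : 0 ≤ K
  bounded_d : ∀ b, ∀ p ∈ S, ‖d b p‖ ≤ K
  bounded_y : ∀ b, ∀ p ∈ S, |y b p| ≤ K
  cover_d : ∃ C h : ℝ, 0 < C ∧ ∀ j : Fin J, ∀ n : ℕ, 2 ≤ n →
    EmpiricalCover ((fun p b => d b p j) '' S) (n + n) (C * (n : ℝ) ^ h) (1 / n)
  cover_y : ∃ C h : ℝ, 0 < C ∧ ∀ n : ℕ, 2 ≤ n →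
    EmpiricalCover ((fun p b => y b p) '' S) (n + n) (C * (n : ℝ) ^ h) (1 / n)
  continuous : ∃ L : ℝ, ∀ p ∈ S, (∀ j, ∫ x, (d x p j - d x p₀ j) ^ 2 ∂ν ≤ L * ‖p - p₀‖) ∧
    ∫ x, (y x p - y x p₀) ^ 2 ∂ν ≤ L * ‖p - p₀‖
  clears : Tendsto (fun n : ℕ => (n : ℝ) ^ (1 / 2 : ℝ) *
    ∫ b, ‖(∑ i, (1 / (n : ℝ)) • d (b i) (P n b)) - cap‖ ∂(sampleLaw ν n)) atTop (𝓝 0)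
  mean_base : meanVec ν d p₀ = cap
  stable : ∃ κ : ℝ, 0 < κ ∧ ∀ p ∈ S, κ * ‖p - p₀‖ ≤ ∑ j, |(meanVec ν d p - cap) j|

namespace ClearingSequence

variable {𝓑 : Type*} {J : ℕ} {d : 𝓑 → RJ J → RJ J} {y : 𝓑 → RJ J → ℝ} {cap : RJ J}
  {S : Set (RJ J)} {P : ∀ n, (Fin n → 𝓑) → RJ J} {p₀ : RJ J} {K : ℝ}

/-- The norm of the excess demand. -/
def excess {n : ℕ} (d : 𝓑 → RJ J → RJ J) (cap : RJ J) (P : (Fin n → 𝓑) → RJ J)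
    (b : Fin n → 𝓑) : ℝ := ‖(∑ i, (1 / (n : ℝ)) • d (b i) (P b)) - cap‖

theorem avg_apply {n : ℕ} (v : Fin n → RJ J) (w : RJ J) (j : Fin J) :
    ((∑ i, (1 / (n : ℝ)) • v i) - w) j = (∑ i, v i j) / n - w j := by
  rw [← Finset.smul_sum]
  simp only [PiLp.sub_apply, PiLp.smul_apply, smul_eq_mul]
  rw [WithLp.ofLp_sum, Finset.sum_apply]
  ring

theorem abs_avg_sub_le_excess {n : ℕ} (P : (Fin n → 𝓑) → RJ J) (b : Fin n → 𝓑) (j : Fin J) :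
    |(∑ i, d (b i) (P b) j) / n - cap j| ≤ excess d cap P b := by
  rw [← avg_apply]
  exact abs_apply_le_norm _ j

theorem excess_le (cap : RJ J) {n : ℕ} (hn : 0 < n) (hK : ∀ b, ∀ p ∈ S, ‖d b p‖ ≤ K)
    {P : (Fin n → 𝓑) → RJ J} (hPS : ∀ b, P b ∈ S) (b : Fin n → 𝓑) :
    excess d cap P b ≤ K + ‖cap‖ := by
  have hn' : (0 : ℝ) < n := by exact_mod_cast hn
  refine (norm_sub_le _ _).trans (add_le_add ((norm_sum_le _ _).trans ?_) le_rfl)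
  calc ∑ i, ‖(1 / (n : ℝ)) • d (b i) (P b)‖ ≤ ∑ _i : Fin n, (1 / (n : ℝ)) * K := by
        refine Finset.sum_le_sum fun i _ => ?_
        rw [norm_smul, Real.norm_of_nonneg (by positivity)]
        exact mul_le_mul_of_nonneg_left (hK _ _ (hPS b)) (by positivity)
    _ = K := by
        rw [Finset.sum_const, Finset.card_univ, Fintype.card_fin, nsmul_eq_mul]
        field_simp

variable [MeasurableSpace 𝓑] {ν : Measure 𝓑}

theorem measurable_excess (cap : RJ J) (hd : Measurable fun z : 𝓑 × RJ J => d z.1 z.2) {n : ℕ}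
    {P : (Fin n → 𝓑) → RJ J} (hP : Measurable P) : Measurable (excess d cap P) := by
  have hi : ∀ i, Measurable fun b : Fin n → 𝓑 => (1 / (n : ℝ)) • d (b i) (P b) := fun i =>
    (hd.comp ((measurable_pi_apply i).prodMk hP)).const_smul (1 / (n : ℝ))
  exact ((Finset.measurable_sum _ fun i _ => hi i).sub_const _).norm

theorem measurable_d_apply (H : ClearingSequence ν d y cap S P p₀ K) (j : Fin J) :
    Measurable fun z : 𝓑 × RJ J => d z.1 z.2 j :=
  (EuclideanSpace.proj (𝕜 := ℝ) j).continuous.measurable.comp H.measurable_d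

theorem bounded_d_apply (H : ClearingSequence ν d y cap S P p₀ K) (j : Fin J) :
    ∀ b, ∀ p ∈ S, |d b p j| ≤ K :=
  fun b p hp => (abs_apply_le_norm _ j).trans (H.bounded_d b p hp)

theorem measurable_d_base (H : ClearingSequence ν d y cap S P p₀ K) (j : Fin J) :
    Measurable fun x => d x p₀ j :=
  measurable_section (g := fun x p => d x p j) (H.measurable_d_apply j) p₀

theorem measurable_baseDemand_term (H : ClearingSequence ν d y cap S P p₀ K) {n : ℕ} (j : Fin J) :
    Measurable fun b : Fin n → 𝓑 => |(∑ i, d (b i) p₀ j) / n - ∫ x, d x p₀ j ∂ν| :=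
  (((Finset.measurable_sum _ fun i _ => (H.measurable_d_base j).comp
    (measurable_pi_apply i)).div_const _).sub_const _).abs

variable [IsProbabilityMeasure ν]

theorem integrable_excess (H : ClearingSequence ν d y cap S P p₀ K) {n : ℕ} (hn : 0 < n) :
    Integrable (excess d cap (P n)) (sampleLaw ν n) :=
  integrable_of_abs_le (measurable_excess cap H.measurable_d (H.measurable_P n)) fun b => by
    rw [excess, abs_norm]
    exact excess_le cap hn H.bounded_d (H.mem n hn) b

/-- Stability bounds the distance by the population excess demand at P n, which differs from the
nearly vanishing empirical one by deviations of crude rate. The exponent 1/8 is what equicontinuity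
needs later. -/
theorem tendsto_rpow_mul_integral_dist (H : ClearingSequence ν d y cap S P p₀ K) :
    Tendsto (fun n : ℕ => (n : ℝ) ^ (1 / 8 : ℝ) * ∫ b, ‖P n b - p₀‖ ∂(sampleLaw ν n))
      atTop (𝓝 0) := by
  obtain ⟨C, h, hC, hcov⟩ := H.cover_d
  obtain ⟨κ, hκ, hst⟩ := H.stable
  have h1 : ∀ j, Tendsto (fun n : ℕ => (n : ℝ) ^ (1 / 8 : ℝ) *
      ∫ b, |empDev ν (fun x p => d x p j) (P n) b| ∂(sampleLaw ν n)) atTop (𝓝 0) := fun j =>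
    tendsto_rpow_mul_integral_abs_empDev_of_bounded ν (H.measurable_d_apply j)
      (H.bounded_d_apply j) H.measurable_P H.mem hC zero_le_one (hcov j) (by norm_num)
  have h2 : Tendsto (fun n : ℕ => (n : ℝ) ^ (1 / 8 : ℝ) *
      ∫ b, excess d cap (P n) b ∂(sampleLaw ν n)) atTop (𝓝 0) := by
    refine squeeze_zero' (Eventually.of_forall fun n => mul_nonneg (by positivity)
      (integral_nonneg fun b => norm_nonneg _)) ?_ H.clears
    filter_upwards [eventually_ge_atTop 1] with n hn
    refine mul_le_mul_of_nonneg_right ?_ (integral_nonneg fun b => norm_nonneg _)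
    exact Real.rpow_le_rpow_of_exponent_le (by exact_mod_cast hn) (by norm_num)
  have hlim := ((tendsto_finsetSum Finset.univ fun j _ => h1 j).add
    (h2.const_mul (J : ℝ))).const_mul κ⁻¹
  simp only [Finset.sum_const_zero, mul_zero, add_zero] at hlim
  refine squeeze_zero' (Eventually.of_forall fun n => mul_nonneg (by positivity)
    (integral_nonneg fun b => norm_nonneg _)) ?_ hlim
  filter_upwards [eventually_gt_atTop 0] with n hn
  have hi1 : ∀ j, Integrable (fun b => |empDev ν (fun x p => d x p j) (P n) b|) (sampleLaw ν n) :=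
    fun j => (integrable_empDev ν hn (H.measurable_d_apply j) (H.bounded_d_apply j)
      (H.measurable_P n) (H.mem n hn)).abs
  have hi2 := H.integrable_excess hn
  have hle : ∫ b, ‖P n b - p₀‖ ∂(sampleLaw ν n)
      ≤ ∫ b, κ⁻¹ * ((∑ j, |empDev ν (fun x p => d x p j) (P n) b|)
        + J * excess d cap (P n) b) ∂(sampleLaw ν n) := by
    refine integral_mono_of_nonneg (Eventually.of_forall fun b => norm_nonneg _)
      (((integrable_finsetSum _ fun j _ => hi1 j).add (hi2.const_mul _)).const_mul _)
      (Eventually.of_forall fun b => ?_)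
    dsimp only
    rw [inv_mul_eq_div, le_div_iff₀ hκ, mul_comm]
    refine (hst _ (H.mem n hn b)).trans ?_
    have : (J : ℝ) * excess d cap (P n) b = ∑ _j : Fin J, excess d cap (P n) b := by simp
    rw [this, ← Finset.sum_add_distrib]
    refine Finset.sum_le_sum fun j _ => ?_
    have e : (meanVec ν d (P n b) - cap) j
        = ((∑ i, d (b i) (P n b) j) / n - cap j) - empDev ν (fun x p => d x p j) (P n) b := by
      simp [meanVec, empDev]
    rw [e, add_comm]
    exact (abs_sub _ _).trans (add_le_add (abs_avg_sub_le_excess _ _ _) le_rfl)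
  rw [integral_const_mul, integral_add (integrable_finsetSum _ fun j _ => hi1 j)
    (hi2.const_mul _), integral_finsetSum _ fun j _ => hi1 j, integral_const_mul] at hle
  refine (mul_le_mul_of_nonneg_left hle (by positivity)).trans (le_of_eq ?_)
  rw [← Finset.mul_sum]
  ring

/-- Mean-square continuity at p₀ converts the rate for the cutoffs into the L₂ rate required for
equicontinuity. -/
theorem tendsto_integral_abs_recentred (H : ClearingSequence ν d y cap S P p₀ K)
    {g : 𝓑 → RJ J → ℝ} (hg : Measurable fun z : 𝓑 × RJ J => g z.1 z.2)
    (hK : ∀ b, ∀ p ∈ S, |g b p| ≤ K) {C h : ℝ} (hC : 0 < C)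
    (hcov : ∀ n : ℕ, 2 ≤ n →
      EmpiricalCover ((fun p b => g b p) '' S) (n + n) (C * (n : ℝ) ^ h) (1 / n))
    {L : ℝ} (hL : ∀ p ∈ S, ∫ x, (g x p - g x p₀) ^ 2 ∂ν ≤ L * ‖p - p₀‖) :
    Tendsto (fun n : ℕ => (n : ℝ) ^ (1 / 2 : ℝ) *
      ∫ b, |empDev ν (fun x p => g x p - g x p₀) (P n) b| ∂(sampleLaw ν n)) atTop (𝓝 0) := by
  refine tendsto_sqrt_mul_integral_abs_empDev_sub ν hg hK H.measurable_P H.mem hC zero_le_one hcov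
    H.mem_base ?_
  have hlim := H.tendsto_rpow_mul_integral_dist.const_mul (max L 0)
  rw [mul_zero] at hlim
  refine squeeze_zero' (Eventually.of_forall fun n => mul_nonneg (by positivity)
    (integral_nonneg fun b => integral_nonneg fun x => sq_nonneg _)) ?_ hlim
  filter_upwards [eventually_gt_atTop 0] with n hn
  rw [mul_left_comm]
  refine mul_le_mul_of_nonneg_left ?_ (by positivity)
  rw [← integral_const_mul]
  obtain ⟨κ, hκ, hst⟩ := H.stable
  -- Stability and bounded demand keep the cutoffs bounded; this serves integrability only.
  have hdist : ∀ p ∈ S, ‖p - p₀‖ ≤ κ⁻¹ * (∑ _j : Fin J, 2 * K) := fun p hp => by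
    rw [inv_mul_eq_div, le_div_iff₀ hκ, mul_comm]
    refine (hst p hp).trans (Finset.sum_le_sum fun j _ => ?_)
    rw [← H.mean_base]
    simp only [meanVec, PiLp.sub_apply]
    refine (abs_sub _ _).trans ?_
    linarith [abs_integral_le_of_abs_le ν fun x => H.bounded_d_apply j x p hp,
      abs_integral_le_of_abs_le ν fun x => H.bounded_d_apply j x p₀ H.mem_base]
  refine integral_mono_of_nonneg
    (Eventually.of_forall fun b => integral_nonneg fun x => sq_nonneg _)
    (Integrable.const_mul ?_ _) (Eventually.of_forall fun b => ?_)
  · exact integrable_of_abs_le ((H.measurable_P n).sub_const _).norm fun b => by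
      rw [abs_norm]; exact hdist _ (H.mem n hn b)
  · exact (hL _ (H.mem n hn b)).trans
      (mul_le_mul_of_nonneg_right (le_max_left _ _) (norm_nonneg _))

end ClearingSequence

theorem integrable_linear_combination {α : Type*} [MeasurableSpace α] {μ : Measure α}
    {f₀ f₁ f₂ f₃ f₄ : α → ℝ} (h₀ : Integrable f₀ μ) (h₁ : Integrable f₁ μ) (h₂ : Integrable f₂ μ)
    (h₃ : Integrable f₃ μ) (h₄ : Integrable f₄ μ) {a₁ a₂ a₃ a₄ : ℝ} :
    Integrable (fun x => f₀ x + a₁ * f₁ x + a₂ * f₂ x + a₃ * f₃ x + a₄ * f₄ x) μ :=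
  (((h₀.add (h₁.const_mul a₁)).add (h₂.const_mul a₂)).add (h₃.const_mul a₃)).add (h₄.const_mul a₄)

theorem integral_linear_combination {α : Type*} [MeasurableSpace α] {μ : Measure α}
    {f₀ f₁ f₂ f₃ f₄ : α → ℝ} (h₀ : Integrable f₀ μ) (h₁ : Integrable f₁ μ) (h₂ : Integrable f₂ μ)
    (h₃ : Integrable f₃ μ) (h₄ : Integrable f₄ μ) {a₁ a₂ a₃ a₄ : ℝ} :
    ∫ x, (f₀ x + a₁ * f₁ x + a₂ * f₂ x + a₃ * f₃ x + a₄ * f₄ x) ∂μ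
      = ∫ x, f₀ x ∂μ + a₁ * ∫ x, f₁ x ∂μ + a₂ * ∫ x, f₂ x ∂μ + a₃ * ∫ x, f₃ x ∂μ
        + a₄ * ∫ x, f₄ x ∂μ := by
  have i₁ : Integrable (fun x => f₀ x + a₁ * f₁ x) μ := h₀.add (h₁.const_mul a₁)
  have i₂ : Integrable (fun x => f₀ x + a₁ * f₁ x + a₂ * f₂ x) μ := i₁.add (h₂.const_mul a₂)
  have i₃ : Integrable (fun x => f₀ x + a₁ * f₁ x + a₂ * f₂ x + a₃ * f₃ x) μ :=
    i₂.add (h₃.const_mul a₃)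
  rw [integral_add i₃ (h₄.const_mul a₄), integral_add i₂ (h₃.const_mul a₃),
    integral_add i₁ (h₂.const_mul a₂), integral_add h₀ (h₁.const_mul a₁), integral_const_mul,
    integral_const_mul, integral_const_mul, integral_const_mul]

/-! ### Decomposition of the average outcome and control of the nonlinear remainder. -/

namespace ClearingSequence

variable {𝓑 : Type*} [MeasurableSpace 𝓑] {J : ℕ} {ν : Measure 𝓑} [IsProbabilityMeasure ν]
  {d : 𝓑 → RJ J → RJ J} {y : 𝓑 → RJ J → ℝ} {cap : RJ J} {S : Set (RJ J)}
  {P : ∀ n, (Fin n → 𝓑) → RJ J} {p₀ : RJ J} {K : ℝ}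

/-- The remainder of the outcome after eliminating the cutoffs with the linear form `φ`. -/
def remainder (ν : Measure 𝓑) (d : 𝓑 → RJ J → RJ J) (y : 𝓑 → RJ J → ℝ) (cap : RJ J)
    (p₀ : RJ J) (φ : RJ J →L[ℝ] ℝ) (p : RJ J) : ℝ :=
  (∫ x, y x p ∂ν) - (∫ x, y x p₀ ∂ν) - φ (meanVec ν d p - cap)

/-- The total deviation of the excess demand from its mean, recentred at the equilibrium. -/
def recentredDemand {n : ℕ} (ν : Measure 𝓑) (d : 𝓑 → RJ J → RJ J) (p₀ : RJ J)
    (P : (Fin n → 𝓑) → RJ J) (b : Fin n → 𝓑) : ℝ :=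
  ∑ j, |empDev ν (fun x p => d x p j - d x p₀ j) P b|

/-- The total deviation of the demand at the equilibrium from its mean. -/
def baseDemand {n : ℕ} (ν : Measure 𝓑) (d : 𝓑 → RJ J → RJ J) (p₀ : RJ J) (b : Fin n → 𝓑) : ℝ :=
  ∑ j, |(∑ i, d (b i) p₀ j) / n - ∫ x, d x p₀ j ∂ν|

theorem empDev_sub_eq {n : ℕ} {g : 𝓑 → RJ J → ℝ} (hg : Measurable fun z : 𝓑 × RJ J => g z.1 z.2)
    (hK : ∀ b, ∀ p ∈ S, |g b p| ≤ K) (hp₀ : p₀ ∈ S) (P : (Fin n → 𝓑) → RJ J) (b : Fin n → 𝓑)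
    (hb : P b ∈ S) :
    empDev ν (fun x p => g x p - g x p₀) P b
      = (∑ i, g (b i) (P b)) / n - (∑ i, g (b i) p₀) / n
        - ((∫ x, g x (P b) ∂ν) - ∫ x, g x p₀ ∂ν) := by
  have hi : ∀ p ∈ S, Integrable (fun x => g x p) ν := fun p hp =>
    integrable_of_abs_le (measurable_section hg p) fun x => hK x p hp
  unfold empDev
  rw [Finset.sum_sub_distrib, sub_div, integral_sub (hi _ hb) (hi _ hp₀)]

/-- Population excess demand at P n is the empirical one, minus the recentred deviation, minus the
deviation at p₀. Only the last is of order n^(-1/2); the other two are smaller. -/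
theorem sum_abs_meanVec_sub_le (H : ClearingSequence ν d y cap S P p₀ K) {n : ℕ} (hn : 0 < n)
    (b : Fin n → 𝓑) :
    ∑ j, |(meanVec ν d (P n b) - cap) j|
      ≤ J * excess d cap (P n) b + recentredDemand ν d p₀ (P n) b + baseDemand ν d p₀ b := by
  have : (J : ℝ) * excess d cap (P n) b = ∑ _j : Fin J, excess d cap (P n) b := by simp
  rw [this, recentredDemand, baseDemand, ← Finset.sum_add_distrib, ← Finset.sum_add_distrib]
  refine Finset.sum_le_sum fun j _ => ?_
  have hcap : cap j = ∫ x, d x p₀ j ∂ν := by rw [← H.mean_base]; rfl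
  have e : (meanVec ν d (P n b) - cap) j
      = ((∑ i, d (b i) (P n b) j) / n - cap j)
        - empDev ν (fun x p => d x p j - d x p₀ j) (P n) b
        - ((∑ i, d (b i) p₀ j) / n - ∫ x, d x p₀ j ∂ν) := by
    rw [empDev_sub_eq (H.measurable_d_apply j) (H.bounded_d_apply j) H.mem_base (P n) b
      (H.mem n hn b), PiLp.sub_apply, hcap]
    simp only [meanVec]
    ring
  rw [e]
  refine (abs_sub _ _).trans (add_le_add ((abs_sub _ _).trans (add_le_add ?_ le_rfl)) le_rfl)
  exact abs_avg_sub_le_excess _ _ _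

/-- An exact identity, valid for any φ: φ of the population excess demand plus φ of the empirical
one at p₀ equals φ of the empirical one at P n, up to φ of the recentred deviation. The displacement
of the cutoffs thus survives only in the remainder. -/
theorem abs_avg_sub_avg_le (H : ClearingSequence ν d y cap S P p₀ K) (φ : RJ J →L[ℝ] ℝ) {n : ℕ}
    (hn : 0 < n) (b : Fin n → 𝓑) :
    |(∑ i, y (b i) (P n b)) / n - (∑ i, (y (b i) p₀ - φ (d (b i) p₀ - cap))) / n|
      ≤ |empDev ν (fun x p => y x p - y x p₀) (P n) b|
        + |remainder ν d y cap p₀ φ (P n b)|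
        + ‖φ‖ * (recentredDemand ν d p₀ (P n) b + excess d cap (P n) b) := by
  have hn' : (n : ℝ) ≠ 0 := by exact_mod_cast hn.ne'
  set avg : RJ J → RJ J := fun p => ∑ i, (1 / (n : ℝ)) • d (b i) p with havg
  set D : RJ J := avg (P n b) - avg p₀ - (meanVec ν d (P n b) - cap) with hD
  have hDle : ‖D‖ ≤ recentredDemand ν d p₀ (P n) b := by
    refine (norm_le_sum_abs_apply D).trans (le_of_eq (Finset.sum_congr rfl fun j _ => ?_))
    have hcap : cap j = ∫ x, d x p₀ j ∂ν := by rw [← H.mean_base]; rfl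
    rw [empDev_sub_eq (H.measurable_d_apply j) (H.bounded_d_apply j) H.mem_base (P n) b
      (H.mem n hn b)]
    have e1 : ∀ p, avg p j = (∑ i, d (b i) p j) / n := fun p => by
      have := avg_apply (fun i => d (b i) p) 0 j
      rwa [sub_zero, PiLp.zero_apply, sub_zero] at this
    simp only [hD, PiLp.sub_apply, e1, hcap, meanVec]
  have hφ : (∑ i, (y (b i) p₀ - φ (d (b i) p₀ - cap))) / n
      = (∑ i, y (b i) p₀) / n - φ (avg p₀ - cap) := by
    rw [Finset.sum_sub_distrib, sub_div]
    congr 1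
    simp only [map_sub, Finset.sum_sub_distrib, Finset.sum_const, Finset.card_univ,
      Fintype.card_fin, nsmul_eq_mul, havg, map_sum, map_smul, smul_eq_mul, ← Finset.mul_sum]
    field_simp
  have e : (∑ i, y (b i) (P n b)) / n - (∑ i, (y (b i) p₀ - φ (d (b i) p₀ - cap))) / n
      = empDev ν (fun x p => y x p - y x p₀) (P n) b + remainder ν d y cap p₀ φ (P n b)
        + φ (avg (P n b) - cap - D) := by
    rw [hφ, empDev_sub_eq H.measurable_y H.bounded_y H.mem_base (P n) b (H.mem n hn b)]
    simp only [remainder, hD, map_sub]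
    ring
  rw [e]
  refine (abs_add_le _ _).trans (add_le_add (abs_add_le _ _) ?_)
  refine (φ.le_opNorm _).trans (mul_le_mul_of_nonneg_left ?_ (norm_nonneg _))
  refine (norm_sub_le _ _).trans ?_
  rw [add_comm]
  exact add_le_add hDle le_rfl

theorem abs_remainder_le (H : ClearingSequence ν d y cap S P p₀ K) (φ : RJ J →L[ℝ] ℝ) {p : RJ J}
    (hp : p ∈ S) : |remainder ν d y cap p₀ φ p| ≤ 2 * K + ‖φ‖ * (J * (2 * K)) := by
  have h1 := abs_integral_le_of_abs_le ν fun x => H.bounded_y x p hp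
  have h2 := abs_integral_le_of_abs_le ν fun x => H.bounded_y x p₀ H.mem_base
  refine (abs_sub _ _).trans (add_le_add ((abs_sub _ _).trans (by linarith)) ?_)
  refine (φ.le_opNorm _).trans (mul_le_mul_of_nonneg_left ?_ (norm_nonneg _))
  refine (norm_le_sum_abs_apply _).trans ?_
  have : (J : ℝ) * (2 * K) = ∑ _j : Fin J, 2 * K := by simp
  rw [this, ← H.mean_base]
  refine Finset.sum_le_sum fun j _ => ?_
  simp only [meanVec, PiLp.sub_apply]
  refine (abs_sub _ _).trans ?_
  linarith [abs_integral_le_of_abs_le ν fun x => H.bounded_d_apply j x p hp,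
    abs_integral_le_of_abs_le ν fun x => H.bounded_d_apply j x p₀ H.mem_base]

/-- The remainder is controlled by the deviations: a small multiple of `baseDemand`, plus terms
of smaller order. -/
theorem exists_abs_remainder_le (H : ClearingSequence ν d y cap S P p₀ K) (φ : RJ J →L[ℝ] ℝ)
    (hφ : remainder ν d y cap p₀ φ =o[𝓝 p₀] fun p => p - p₀) {η : ℝ} (hη : 0 < η) :
    ∃ c₁ c₂ : ℝ, 0 ≤ c₁ ∧ 0 ≤ c₂ ∧ ∀ n, 0 < n → ∀ b : Fin n → 𝓑,
      |remainder ν d y cap p₀ φ (P n b)|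
        ≤ c₁ * (J * excess d cap (P n) b + recentredDemand ν d p₀ (P n) b)
          + η * baseDemand ν d p₀ b + c₂ * baseDemand ν d p₀ b ^ 2 := by
  obtain ⟨κ, hκ, hst⟩ := H.stable
  obtain ⟨δ, hδ, hnear⟩ := Metric.eventually_nhds_iff.1 (hφ.def (mul_pos hη hκ))
  set M := 2 * K + ‖φ‖ * (J * (2 * K)) with hM
  have hM0 : 0 ≤ M := by have := H.bound_nonneg; positivity
  have hκδ : 0 < κ * δ := mul_pos hκ hδ
  -- Within δ of p₀ differentiability bounds the remainder by η(A + B). Farther away it is at most M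
  -- while κδ ≤ A + B, so either A or B is at least κδ/2. In the second case B² is used, since its
  -- mean is O(1/n).
  refine ⟨η + 2 * M / (κ * δ), 4 * M / (κ * δ) ^ 2, by positivity, by positivity,
    fun n hn b => ?_⟩
  have hA : 0 ≤ J * excess d cap (P n) b + recentredDemand ν d p₀ (P n) b :=
    add_nonneg (mul_nonneg (Nat.cast_nonneg _) (norm_nonneg _))
      (Finset.sum_nonneg fun j _ => abs_nonneg _)
  have hB : 0 ≤ baseDemand ν d p₀ b := Finset.sum_nonneg fun j _ => abs_nonneg _
  have hdist := (hst _ (H.mem n hn b)).trans (H.sum_abs_meanVec_sub_le hn b)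
  set A := J * excess d cap (P n) b + recentredDemand ν d p₀ (P n) b with hAdef
  set B := baseDemand ν d p₀ b with hBdef
  have hx : 0 ≤ 2 * M / (κ * δ) * A := by positivity
  have hx2 : 0 ≤ 4 * M / (κ * δ) ^ 2 * B ^ 2 := by positivity
  have hx3 : 0 ≤ η * A := by positivity
  have hx4 : 0 ≤ η * B := by positivity
  by_cases hlt : dist (P n b) p₀ < δ
  · have h1 := hnear hlt
    rw [Real.norm_eq_abs] at h1
    have h2 : η * κ * ‖P n b - p₀‖ ≤ η * (A + B) := by
      rw [mul_assoc]; exact mul_le_mul_of_nonneg_left hdist hη.le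
    linarith
  · rw [not_lt, dist_eq_norm] at hlt
    have h1 := H.abs_remainder_le φ (H.mem n hn b)
    have h2 : κ * δ ≤ A + B := (mul_le_mul_of_nonneg_left hlt hκ.le).trans hdist
    rcases le_total (κ * δ) (2 * A) with h3 | h3
    · have h4 : M ≤ 2 * M / (κ * δ) * A := by
        rw [div_mul_eq_mul_div, le_div_iff₀ hκδ]
        nlinarith
      linarith
    · have h5 : κ * δ ≤ 2 * B := by linarith
      have h4 : M ≤ 4 * M / (κ * δ) ^ 2 * B ^ 2 := by
        rw [div_mul_eq_mul_div, le_div_iff₀ (by positivity)]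
        have : (κ * δ) ^ 2 ≤ (2 * B) ^ 2 := pow_le_pow_left₀ hκδ.le h5 2
        nlinarith
      linarith

theorem abs_baseDemand_term_le (H : ClearingSequence ν d y cap S P p₀ K) {n : ℕ} (j : Fin J)
    (b : Fin n → 𝓑) : |(∑ i, d (b i) p₀ j) / n - ∫ x, d x p₀ j ∂ν| ≤ 2 * K := by
  have h := fun x => H.bounded_d_apply j x p₀ H.mem_base
  refine (abs_sub _ _).trans ?_
  linarith [abs_avg_le H.bound_nonneg fun i => h (b i), abs_integral_le_of_abs_le ν h]

theorem integrable_baseDemand (H : ClearingSequence ν d y cap S P p₀ K) (n : ℕ) :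
    Integrable (baseDemand (n := n) ν d p₀) (sampleLaw ν n) :=
  integrable_finsetSum _ fun j _ => integrable_of_abs_le (H.measurable_baseDemand_term j)
    fun b => by rw [abs_abs]; exact H.abs_baseDemand_term_le j b

theorem integrable_baseDemand_sq (H : ClearingSequence ν d y cap S P p₀ K) (n : ℕ) :
    Integrable (fun b => baseDemand (n := n) ν d p₀ b ^ 2) (sampleLaw ν n) := by
  refine integrable_of_abs_le (K := (∑ _j : Fin J, 2 * K) ^ 2)
    ((Finset.measurable_sum _ fun j _ => H.measurable_baseDemand_term j).pow_const 2) fun b => ?_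
  rw [abs_pow]
  refine pow_le_pow_left₀ (abs_nonneg _) ?_ 2
  rw [baseDemand, abs_of_nonneg (Finset.sum_nonneg fun j _ => abs_nonneg _)]
  exact Finset.sum_le_sum fun j _ => H.abs_baseDemand_term_le j b

theorem integral_baseDemand_le (H : ClearingSequence ν d y cap S P p₀ K) {n : ℕ} (hn : 0 < n) :
    ∫ b, baseDemand ν d p₀ b ∂(sampleLaw ν n) ≤ J * K / Real.sqrt n := by
  unfold baseDemand
  rw [integral_finsetSum _ fun j _ => integrable_of_abs_le (H.measurable_baseDemand_term j)
    fun b => by rw [abs_abs]; exact H.abs_baseDemand_term_le j b]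
  refine (Finset.sum_le_sum fun j _ => integral_abs_avg_sub_le ν hn
    (H.measurable_d_base j)
    (fun x => H.bounded_d_apply j x p₀ H.mem_base) H.bound_nonneg).trans (le_of_eq ?_)
  rw [Finset.sum_const, Finset.card_univ, Fintype.card_fin, nsmul_eq_mul, mul_div_assoc]

theorem integral_baseDemand_sq_le (H : ClearingSequence ν d y cap S P p₀ K) {n : ℕ} (hn : 0 < n) :
    ∫ b, baseDemand ν d p₀ b ^ 2 ∂(sampleLaw ν n) ≤ J * (J * (K ^ 2 / n)) := by
  have hi : ∀ j : Fin J, Integrable (fun b : Fin n → 𝓑 =>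
      ((∑ i, d (b i) p₀ j) / n - ∫ x, d x p₀ j ∂ν) ^ 2) (sampleLaw ν n) := fun j => by
    refine integrable_of_abs_le (K := (2 * K) ^ 2) ?_ fun b => ?_
    · have h := (H.measurable_baseDemand_term (n := n) j).pow_const 2
      exact (congrArg Measurable (funext fun b => sq_abs _)).mp h
    · rw [abs_pow]
      exact pow_le_pow_left₀ (abs_nonneg _) (H.abs_baseDemand_term_le j b) 2
  have hle : ∫ b, baseDemand ν d p₀ b ^ 2 ∂(sampleLaw ν n)
      ≤ ∫ b, J * ∑ j, ((∑ i, d (b i) p₀ j) / n - ∫ x, d x p₀ j ∂ν) ^ 2 ∂(sampleLaw ν n) := by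
    refine integral_mono (H.integrable_baseDemand_sq n)
      ((integrable_finsetSum _ fun j _ => hi j).const_mul _) fun b => ?_
    have := sq_sum_le_card_mul_sum_sq (s := Finset.univ)
      (f := fun j : Fin J => |(∑ i, d (b i) p₀ j) / n - ∫ x, d x p₀ j ∂ν|)
    simpa [baseDemand] using this
  refine hle.trans ?_
  rw [integral_const_mul, integral_finsetSum _ fun j _ => hi j]
  refine mul_le_mul_of_nonneg_left ?_ (Nat.cast_nonneg _)
  refine (Finset.sum_le_sum fun j _ => integral_sq_avg_sub_le ν hn
    (H.measurable_d_base j)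
    (fun x => H.bounded_d_apply j x p₀ H.mem_base)).trans (le_of_eq ?_)
  rw [Finset.sum_const, Finset.card_univ, Fintype.card_fin, nsmul_eq_mul]

theorem measurable_sub_base {g : 𝓑 → RJ J → ℝ} (hg : Measurable fun z : 𝓑 × RJ J => g z.1 z.2)
    (p₀ : RJ J) : Measurable fun z : 𝓑 × RJ J => g z.1 z.2 - g z.1 p₀ :=
  hg.sub ((measurable_section hg p₀).comp measurable_fst)

/-- Average outcomes at approximately clearing cutoffs are asymptotically linear, in mean. -/
theorem tendsto_linearization (H : ClearingSequence ν d y cap S P p₀ K) (φ : RJ J →L[ℝ] ℝ)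
    (hφ : remainder ν d y cap p₀ φ =o[𝓝 p₀] fun p => p - p₀) :
    Tendsto (fun n : ℕ => (n : ℝ) ^ (1 / 2 : ℝ) *
      ∫ b, |(∑ i, y (b i) (P n b)) / n - (∑ i, (y (b i) p₀ - φ (d (b i) p₀ - cap))) / n|
        ∂(sampleLaw ν n)) atTop (𝓝 0) := by
  obtain ⟨Cd, hd, hCd, hcovd⟩ := H.cover_d
  obtain ⟨Cy, hy, hCy, hcovy⟩ := H.cover_y
  obtain ⟨L, hL⟩ := H.continuous
  have hbd : ∀ j b, ∀ p ∈ S, |d b p j - d b p₀ j| ≤ 2 * K := fun j b p hp =>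
    (abs_sub _ _).trans (by
      linarith [H.bounded_d_apply j b p hp, H.bounded_d_apply j b p₀ H.mem_base])
  have hby : ∀ b, ∀ p ∈ S, |y b p - y b p₀| ≤ 2 * K := fun b p hp =>
    (abs_sub _ _).trans (by linarith [H.bounded_y b p hp, H.bounded_y b p₀ H.mem_base])
  have hiR : ∀ n, 0 < n → Integrable (fun b =>
      |empDev ν (fun x p => y x p - y x p₀) (P n) b|) (sampleLaw ν n) := fun n hn =>
    (integrable_empDev ν hn (g := fun x p => y x p - y x p₀) (measurable_sub_base H.measurable_y p₀)
      hby (H.measurable_P n) (H.mem n hn)).abs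
  have hiDj : ∀ n, 0 < n → ∀ j, Integrable (fun b =>
      |empDev ν (fun x p => d x p j - d x p₀ j) (P n) b|) (sampleLaw ν n) := fun n hn j =>
    (integrable_empDev ν hn (g := fun x p => d x p j - d x p₀ j)
      (measurable_sub_base (g := fun x p => d x p j) (H.measurable_d_apply j) p₀)
      (hbd j) (H.measurable_P n) (H.mem n hn)).abs
  have hiD : ∀ n, 0 < n → Integrable (recentredDemand ν d p₀ (P n)) (sampleLaw ν n) :=
    fun n hn => integrable_finsetSum _ fun j _ => hiDj n hn j
  have hR := H.tendsto_integral_abs_recentred H.measurable_y H.bounded_y hCy hcovy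
    fun p hp => (hL p hp).2
  have hD : Tendsto (fun n : ℕ => (n : ℝ) ^ (1 / 2 : ℝ) *
      ∫ b, recentredDemand ν d p₀ (P n) b ∂(sampleLaw ν n)) atTop (𝓝 0) := by
    have := tendsto_finsetSum Finset.univ fun j _ =>
      H.tendsto_integral_abs_recentred (H.measurable_d_apply j) (H.bounded_d_apply j) hCd (hcovd j)
        fun p hp => (hL p hp).1 j
    rw [Finset.sum_const_zero] at this
    refine this.congr' ?_
    filter_upwards [eventually_gt_atTop 0] with n hn
    unfold recentredDemand
    rw [integral_finsetSum _ fun j _ => hiDj n hn j, Finset.mul_sum]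
  have hB2 : Tendsto (fun n : ℕ => (n : ℝ) ^ (1 / 2 : ℝ) *
      ∫ b, baseDemand ν d p₀ b ^ 2 ∂(sampleLaw ν n)) atTop (𝓝 0) := by
    have hlim := (tendsto_natCast_rpow_zero (s := -(1 / 2)) (by norm_num)).mul_const
      (J * (J * K ^ 2) : ℝ)
    rw [zero_mul] at hlim
    refine squeeze_zero' (Eventually.of_forall fun n => mul_nonneg (by positivity)
      (integral_nonneg fun b => sq_nonneg _)) ?_ hlim
    filter_upwards [eventually_gt_atTop 0] with n hn
    have hn' : (0 : ℝ) < n := by exact_mod_cast hn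
    refine (mul_le_mul_of_nonneg_left (H.integral_baseDemand_sq_le hn) (by positivity)).trans
      (le_of_eq ?_)
    have : (n : ℝ) ^ (-(1 / 2) : ℝ) = (n : ℝ) ^ (1 / 2 : ℝ) / n := by
      rw [← Real.rpow_sub_one hn'.ne']; norm_num
    rw [this]
    ring
  rw [Metric.tendsto_atTop']
  intro ε hε
  have hJK : 0 ≤ (J : ℝ) * K := mul_nonneg (Nat.cast_nonneg _) H.bound_nonneg
  -- The term with coefficient η is the only one that does not vanish after scaling by √n: its
  -- scaled mean is at most ηJK < ε/2.
  set η := ε / (2 * (J * K + 1)) with hη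
  have hη0 : 0 < η := by positivity
  obtain ⟨c₁, c₂, hc₁, hc₂, hrem⟩ := H.exists_abs_remainder_le φ hφ hη0
  have hlim := ((hR.add (H.clears.const_mul (c₁ * J + ‖φ‖))).add (hD.const_mul (c₁ + ‖φ‖))).add
    (hB2.const_mul c₂)
  simp only [mul_zero, add_zero] at hlim
  obtain ⟨N, hN⟩ := eventually_atTop.1 (hlim.eventually (gt_mem_nhds (half_pos hε)))
  refine ⟨N, fun n hn => ?_⟩
  have hn0 : 0 < n := by omega
  have hn' : (0 : ℝ) < n := by exact_mod_cast hn0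
  specialize hN n (by omega)
  have hiE := H.integrable_excess hn0
  have hiB := H.integrable_baseDemand n
  have hiB2 := H.integrable_baseDemand_sq n
  have hle : ∫ b, |(∑ i, y (b i) (P n b)) / n - (∑ i, (y (b i) p₀ - φ (d (b i) p₀ - cap))) / n|
        ∂(sampleLaw ν n)
      ≤ ∫ b, ((((|empDev ν (fun x p => y x p - y x p₀) (P n) b|
          + (c₁ * J + ‖φ‖) * excess d cap (P n) b)
          + (c₁ + ‖φ‖) * recentredDemand ν d p₀ (P n) b)
          + c₂ * baseDemand ν d p₀ b ^ 2) + η * baseDemand ν d p₀ b) ∂(sampleLaw ν n) := by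
    refine integral_mono_of_nonneg (Eventually.of_forall fun b => abs_nonneg _)
      (integrable_linear_combination (hiR n hn0) hiE (hiD n hn0) hiB2 hiB)
      (Eventually.of_forall fun b => ?_)
    have h1 := H.abs_avg_sub_avg_le φ hn0 b
    have h2 := hrem n hn0 b
    dsimp only
    linarith
  rw [integral_linear_combination (hiR n hn0) hiE (hiD n hn0) hiB2 hiB] at hle
  have hlast : (n : ℝ) ^ (1 / 2 : ℝ) * (η * ∫ b, baseDemand ν d p₀ b ∂(sampleLaw ν n)) < ε / 2 := by
    have h1 := mul_le_mul_of_nonneg_left (H.integral_baseDemand_le hn0)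
      (show 0 ≤ η * (n : ℝ) ^ (1 / 2 : ℝ) by positivity)
    rw [← Real.sqrt_eq_rpow] at h1 ⊢
    have h2 : η * Real.sqrt n * (J * K / Real.sqrt n) = η * (J * K) := by
      have := Real.sqrt_pos.2 hn'
      field_simp
    have h3 : η * (J * K) < ε / 2 := by
      rw [hη, div_mul_eq_mul_div, div_lt_div_iff₀ (by positivity) two_pos]
      nlinarith
    linarith
  rw [Real.dist_0_eq_abs, abs_of_nonneg (mul_nonneg (by positivity)
    (integral_nonneg fun b => abs_nonneg _))]
  have hfin := mul_le_mul_of_nonneg_left hle (show 0 ≤ (n : ℝ) ^ (1 / 2 : ℝ) by positivity)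
  unfold excess at hfin
  linarith

end ClearingSequence

/-! ### The law of submissions under a treatment rule -/

/-- Probability that the rule `π` assigns the treatment `w` to covariates `x`. -/
def ruleWeight {𝓧 : Type*} (π : 𝓧 → ℝ) (w : Bool) (x : 𝓧) : ℝ := if w then π x else 1 - π x

section Weights

variable {𝓧 : Type*} {π : 𝓧 → ℝ}

theorem ruleWeight_nonneg (h01 : ∀ x, π x ∈ Set.Icc (0 : ℝ) 1) (w : Bool) (x : 𝓧) :
    0 ≤ ruleWeight π w x := by
  have := h01 x
  cases w <;> simp [ruleWeight, this.1, this.2]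

theorem ruleWeight_le_one (h01 : ∀ x, π x ∈ Set.Icc (0 : ℝ) 1) (w : Bool) (x : 𝓧) :
    ruleWeight π w x ≤ 1 := by
  have := h01 x
  cases w <;> simp [ruleWeight, this.1, this.2]

theorem measurable_ruleWeight [MeasurableSpace 𝓧] (hπ : Measurable π) (w : Bool) :
    Measurable (ruleWeight π w) := by
  cases w
  · exact hπ.const_sub 1
  · exact hπ

theorem policyWeight_eq_prod {n : ℕ} (π : 𝓧 → ℝ) (x : Fin n → 𝓧) (w : Fin n → Bool) :
    policyWeight π x w = ∏ i, ruleWeight π (w i) (x i) := rfl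

theorem policyWeight_nonneg (h01 : ∀ x, π x ∈ Set.Icc (0 : ℝ) 1) {n : ℕ} (x : Fin n → 𝓧)
    (w : Fin n → Bool) : 0 ≤ policyWeight π x w :=
  Finset.prod_nonneg fun i _ => ruleWeight_nonneg h01 (w i) (x i)

theorem policyWeight_le_one (h01 : ∀ x, π x ∈ Set.Icc (0 : ℝ) 1) {n : ℕ} (x : Fin n → 𝓧)
    (w : Fin n → Bool) : policyWeight π x w ≤ 1 :=
  Finset.prod_le_one (fun i _ => ruleWeight_nonneg h01 (w i) (x i))
    fun i _ => ruleWeight_le_one h01 (w i) (x i)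

theorem sum_policyWeight {n : ℕ} (π : 𝓧 → ℝ) (x : Fin n → 𝓧) :
    ∑ w : Fin n → Bool, policyWeight π x w = 1 := by
  simp_rw [policyWeight_eq_prod]
  rw [← Fintype.piFinset_univ, ← Finset.prod_univ_sum (fun _ : Fin n => (Finset.univ : Finset Bool))
    fun i b => ruleWeight π b (x i)]
  simp [ruleWeight]

theorem policyExp_constRule {n : ℕ} (w : Bool) (x : Fin n → 𝓧) (f : (Fin n → Bool) → ℝ) :
    policyExp (constRule 𝓧 w) x f = f fun _ => w := by
  have hw : ∀ b, ∀ x : 𝓧, ruleWeight (constRule 𝓧 w) b x = if b = w then 1 else 0 := by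
    intro b x
    cases b <;> cases w <;> simp [ruleWeight, constRule]
  unfold policyExp
  rw [Finset.sum_eq_single fun _ => w]
  · simp [policyWeight_eq_prod, hw]
  · intro w' _ hne
    obtain ⟨i, hi⟩ := Function.ne_iff.1 hne
    rw [policyWeight_eq_prod, Finset.prod_eq_zero (Finset.mem_univ i) (by simp [hw, hi]), zero_mul]
  · simp

end Weights

/-! ### Reduction of random treatments to i.i.d. submissions. -/

namespace Market

variable {Ω 𝓧 𝓑 : Type*} {J : ℕ} (M : Market Ω 𝓧 𝓑 J)

/-- The contribution of a participant with data `t` to the event that the treatment is `w` and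
the submission lies in `s`. -/
def boxWeight (π : 𝓧 → ℝ) (w : Bool) (s : Set 𝓑) (t : 𝓧 × 𝓑 × 𝓑 × Bool) : ENNReal :=
  s.indicator (fun _ => ENNReal.ofReal (ruleWeight π w t.1)) (if w then t.2.1 else t.2.2.1)

theorem boxWeight_apply (π : 𝓧 → ℝ) (w : Bool) (s : Set 𝓑) (i : ℕ) (ω : Ω) :
    boxWeight π w s (M.X i ω, M.B true i ω, M.B false i ω, M.W i ω)
      = s.indicator (fun _ => ENNReal.ofReal (ruleWeight π w (M.X i ω))) (M.B w i ω) := by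
  cases w <;> rfl

variable [MeasurableSpace Ω] [MeasurableSpace 𝓧] [MeasurableSpace 𝓑] (μ : Measure Ω)

/-- The law of the submission of a participant who is treated according to the rule `π`. -/
def policyLaw (π : 𝓧 → ℝ) : Measure 𝓑 :=
  ∑ w : Bool, (μ.withDensity fun ω => ENNReal.ofReal (ruleWeight π w (M.X 0 ω))).map (M.B w 0)

variable {M μ} {π : 𝓧 → ℝ} (hM : M.Sampling μ) (hπ : Measurable π)
  (h01 : ∀ x, π x ∈ Set.Icc (0 : ℝ) 1)

include hπ in
theorem measurable_boxWeight (w : Bool) {s : Set 𝓑} (hs : MeasurableSet s) :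
    Measurable (boxWeight (𝓑 := 𝓑) π w s) := by
  have h1 : Measurable fun t : 𝓧 × 𝓑 × 𝓑 × Bool => if w then t.2.1 else t.2.2.1 := by
    cases w
    · simpa using measurable_snd.snd.fst
    · simpa using measurable_snd.fst
  have e : boxWeight (𝓑 := 𝓑) π w s
      = ((fun t : 𝓧 × 𝓑 × 𝓑 × Bool => if w then t.2.1 else t.2.2.1) ⁻¹' s).indicator
        fun t => ENNReal.ofReal (ruleWeight π w t.1) := by
    funext t
    rfl
  rw [e]
  exact (((measurable_ruleWeight hπ w).comp measurable_fst).ennreal_ofReal).indicator (h1 hs)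

include hM in
theorem policyLaw_apply {s : Set 𝓑} (hs : MeasurableSet s) :
    M.policyLaw μ π s = ∑ w : Bool,
      ∫⁻ ω, boxWeight π w s (M.X 0 ω, M.B true 0 ω, M.B false 0 ω, M.W 0 ω) ∂μ := by
  unfold policyLaw
  rw [Measure.finsetSum_apply]
  refine Finset.sum_congr rfl fun w _ => ?_
  have hpre := hM.measurable_B w 0 hs
  rw [Measure.map_apply (hM.measurable_B w 0) hs, withDensity_apply _ hpre,
    ← lintegral_indicator hpre]
  exact lintegral_congr fun ω => (boxWeight_apply M π w s 0 ω).symm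

include hM hπ h01

theorem isProbabilityMeasure_policyLaw [IsProbabilityMeasure μ] :
    IsProbabilityMeasure (M.policyLaw μ π) := by
  refine ⟨?_⟩
  rw [policyLaw_apply hM MeasurableSet.univ, ← lintegral_finsetSum]
  · have : ∀ ω, ∑ w : Bool, boxWeight (𝓑 := 𝓑) π w Set.univ
        (M.X 0 ω, M.B true 0 ω, M.B false 0 ω, M.W 0 ω) = 1 := by
      intro ω
      simp only [boxWeight_apply, Set.indicator_univ, Fintype.sum_bool]
      rw [← ENNReal.ofReal_add (ruleWeight_nonneg h01 _ _) (ruleWeight_nonneg h01 _ _)]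
      simp [ruleWeight]
    rw [lintegral_congr this, lintegral_one, measure_univ]
  · intro w _
    exact (measurable_boxWeight hπ w MeasurableSet.univ).comp ((hM.measurable_X 0).prodMk
      ((hM.measurable_B true 0).prodMk ((hM.measurable_B false 0).prodMk (hM.measurable_W 0))))

omit h01 hπ in
theorem measurable_bids (n : ℕ) (w : Fin n → Bool) : Measurable (M.bids n w) :=
  measurable_pi_lambda _ fun i => hM.measurable_B (w i) i

omit h01 in
theorem measurable_policyWeight {n : ℕ} (w : Fin n → Bool) :
    Measurable fun ω => policyWeight π (M.covariates n ω) w :=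
  Finset.measurable_prod _ fun i _ => (measurable_ruleWeight hπ (w i)).comp (hM.measurable_X i)

/-- It suffices to compare both measures on boxes. There the product of the two-term sums over
treatments expands into a sum over treatment vectors, and each summand factorizes because the policy
weight is a product and participants are independent. -/
theorem sum_map_bids_eq [IsProbabilityMeasure μ] (n : ℕ) :
    ∑ w : Fin n → Bool, (μ.withDensity fun ω =>
      ENNReal.ofReal (policyWeight π (M.covariates n ω) w)).map (M.bids n w)
      = sampleLaw (M.policyLaw μ π) n := by
  have := isProbabilityMeasure_policyLaw hM hπ h01
  refine (Measure.pi_eq fun s hs => ?_).symm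
  have htup : ∀ i, Measurable fun ω => (M.X i ω, M.B true i ω, M.B false i ω, M.W i ω) := fun i =>
    (hM.measurable_X i).prodMk ((hM.measurable_B true i).prodMk
      ((hM.measurable_B false i).prodMk (hM.measurable_W i)))
  have hbox : MeasurableSet (Set.univ.pi s) := MeasurableSet.univ_pi hs
  simp_rw [policyLaw_apply hM (hs _)]
  rw [Finset.prod_univ_sum, Fintype.piFinset_univ, Measure.finsetSum_apply]
  refine Finset.sum_congr rfl fun w _ => ?_
  have hpre := measurable_bids hM n w hbox
  rw [Measure.map_apply (measurable_bids hM n w) hbox, withDensity_apply _ hpre,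
    ← lintegral_indicator hpre]
  have hind : iIndepFun (fun (i : Fin n) ω => boxWeight π (w i) (s i)
      (M.X i ω, M.B true i ω, M.B false i ω, M.W i ω)) μ :=
    (hM.indep.precomp Fin.val_injective).comp (fun i => boxWeight π (w i) (s i))
      fun i => measurable_boxWeight hπ (w i) (hs i)
  have hmeas : ∀ i : Fin n, Measurable fun ω => boxWeight π (w i) (s i)
      (M.X i ω, M.B true i ω, M.B false i ω, M.W i ω) := fun i =>
    (measurable_boxWeight hπ (w i) (hs i)).comp (htup i)
  have hid : ∀ i : Fin n, ∫⁻ ω, boxWeight π (w i) (s i)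
        (M.X 0 ω, M.B true 0 ω, M.B false 0 ω, M.W 0 ω) ∂μ
      = ∫⁻ ω, boxWeight π (w i) (s i)
        (M.X i ω, M.B true i ω, M.B false i ω, M.W i ω) ∂μ := fun i =>
    ((hM.identDistrib i).comp (measurable_boxWeight hπ (w i) (hs i))).lintegral_eq.symm
  simp_rw [hid]
  rw [← lintegral_prod_eq_prod_lintegral_of_indepFun _ _ hind hmeas]
  refine lintegral_congr fun ω => ?_
  simp only [boxWeight_apply]
  by_cases hω : ∀ i, M.B (w i) i ω ∈ s i
  · rw [Set.indicator_of_mem (show ω ∈ M.bids n w ⁻¹' Set.univ.pi s from fun i _ => hω i),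
      policyWeight_eq_prod, ENNReal.ofReal_prod_of_nonneg fun i _ => ruleWeight_nonneg h01 _ _]
    refine Finset.prod_congr rfl fun i _ => ?_
    rw [Set.indicator_of_mem (hω i)]
    rfl
  · rw [Set.indicator_of_notMem (show ω ∉ M.bids n w ⁻¹' Set.univ.pi s from
      fun h => hω fun i => h i trivial)]
    obtain ⟨i, hi⟩ := not_forall.1 hω
    exact (Finset.prod_eq_zero (Finset.mem_univ i) (Set.indicator_of_notMem hi _)).symm

/-- Averaging over treatments and participants is averaging over i.i.d. submissions. -/
theorem integral_policyExp_bids [IsProbabilityMeasure μ] (n : ℕ) {F : (Fin n → 𝓑) → ℝ}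
    (hF : Measurable F) {K : ℝ} (hK : ∀ b, |F b| ≤ K) :
    ∫ ω, policyExp π (M.covariates n ω) (fun w => F (M.bids n w ω)) ∂μ
      = ∫ b, F b ∂(sampleLaw (M.policyLaw μ π) n) := by
  have := isProbabilityMeasure_policyLaw hM hπ h01
  have hfin : ∀ w, IsFiniteMeasure ((μ.withDensity fun ω =>
      ENNReal.ofReal (policyWeight π (M.covariates n ω) w)).map (M.bids n w)) := fun w => by
    have : IsFiniteMeasure (μ.withDensity fun ω =>
        ENNReal.ofReal (policyWeight π (M.covariates n ω) w)) := by
      refine isFiniteMeasure_withDensity (ne_top_of_le_ne_top ENNReal.one_ne_top ?_)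
      calc ∫⁻ ω, ENNReal.ofReal (policyWeight π (M.covariates n ω) w) ∂μ ≤ ∫⁻ _, 1 ∂μ :=
            lintegral_mono fun ω => ENNReal.ofReal_le_one.2 (policyWeight_le_one h01 _ _)
        _ = 1 := by simp
    infer_instance
  rw [← sum_map_bids_eq hM hπ h01 n, integral_finsetSum_measure fun w _ =>
    integrable_of_abs_le hF hK]
  unfold policyExp
  rw [integral_finsetSum]
  · refine Finset.sum_congr rfl fun w _ => ?_
    rw [integral_map (measurable_bids hM n w).aemeasurable hF.aestronglyMeasurable,
      integral_withDensity_eq_integral_toReal_smul (measurable_policyWeight hM hπ w).ennreal_ofReal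
        (Eventually.of_forall fun _ => ENNReal.ofReal_lt_top)]
    refine integral_congr_ae (Eventually.of_forall fun ω => ?_)
    dsimp only
    rw [ENNReal.toReal_ofReal (policyWeight_nonneg h01 _ _), smul_eq_mul]
  · intro w _
    refine integrable_of_abs_le (K := K) ((measurable_policyWeight hM hπ w).mul
      (hF.comp (measurable_bids hM n w))) fun ω => ?_
    rw [abs_mul, abs_of_nonneg (policyWeight_nonneg h01 _ _)]
    exact (mul_le_of_le_one_left (abs_nonneg _) (policyWeight_le_one h01 _ _)).trans (hK _)

/-- This is the preceding identity for a sample of size one. -/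
theorem integral_policyLaw [IsProbabilityMeasure μ] {f : 𝓑 → ℝ} (hf : Measurable f) {K : ℝ}
    (hK : ∀ b, |f b| ≤ K) :
    ∫ b, f b ∂(M.policyLaw μ π)
      = ∫ ω, (π (M.X 0 ω) * f (M.B true 0 ω) + (1 - π (M.X 0 ω)) * f (M.B false 0 ω)) ∂μ := by
  have := isProbabilityMeasure_policyLaw hM hπ h01
  rw [← integral_pi_eval (n := 1) (M.policyLaw μ π) f hf 0,
    ← integral_policyExp_bids hM hπ h01 1 (F := fun b => f (b 0))
      (hf.comp (measurable_pi_apply 0)) fun b => hK _]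
  refine integral_congr_ae (Eventually.of_forall fun ω => ?_)
  dsimp only [policyExp]
  rw [← (Equiv.funUnique (Fin 1) Bool).symm.sum_comp]
  simp [policyWeight_eq_prod, ruleWeight, covariates, bids]

end Market

/-! ### Differentiability of population means -/

section Smooth

variable {J : ℕ} {U : Set (RJ J)} {c : ℝ}

theorem sum_apply_smul_single (v : RJ J) : ∑ j, v j • EuclideanSpace.single j (1 : ℝ) = v := by
  ext k
  simp [WithLp.ofLp_sum, Finset.sum_apply, Pi.single_apply]

theorem clm_apply_eq_sum (D : RJ J →L[ℝ] ℝ) (v : RJ J) :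
    D v = ∑ j, v j * D (EuclideanSpace.single j 1) := by
  conv_lhs => rw [← sum_apply_smul_single v]
  simp only [map_sum, map_smul, smul_eq_mul]

/-- Bounded partial derivatives bound the whole gradient, which supplies the constant dominating
function below. -/
theorem norm_clm_le {D : RJ J →L[ℝ] ℝ} (hc : 0 ≤ c)
    (hD : ∀ j, |D (EuclideanSpace.single j 1)| ≤ c) : ‖D‖ ≤ J * c := by
  refine D.opNorm_le_bound (by positivity) fun v => ?_
  rw [clm_apply_eq_sum, Real.norm_eq_abs]
  refine (Finset.abs_sum_le_sum_abs _ _).trans ?_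
  calc ∑ j, |v j * D (EuclideanSpace.single j 1)| ≤ ∑ _j : Fin J, c * ‖v‖ := by
        refine Finset.sum_le_sum fun j _ => ?_
        rw [abs_mul, mul_comm]
        exact mul_le_mul (hD j) (abs_apply_le_norm v j) (abs_nonneg _) hc
    _ = J * c * ‖v‖ := by simp [mul_assoc]

theorem SmoothBounded.hasFDerivAt {f : RJ J → ℝ} (hf : SmoothBounded f U c) (hU : IsOpen U)
    {p : RJ J} (hp : p ∈ U) : HasFDerivAt f (fderiv ℝ f p) p :=
  ((hf.1.contDiffAt (hU.mem_nhds hp)).differentiableAt (by norm_num)).hasFDerivAt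

/-- The gradients of a family of functions that is measurable in a parameter are measurable. -/
theorem stronglyMeasurable_fderiv {𝓧 : Type*} [MeasurableSpace 𝓧] {m : 𝓧 → RJ J → ℝ} {p : RJ J}
    (hU : U ∈ 𝓝 p) (hm : ∀ q ∈ U, Measurable fun x => m x q)
    (hd : ∀ x, HasFDerivAt (m x) (fderiv ℝ (m x) p) p) :
    StronglyMeasurable fun x => fderiv ℝ (m x) p := by
  have hpU := mem_of_mem_nhds hU
  have hcoord : ∀ j, Measurable fun x => fderiv ℝ (m x) p (EuclideanSpace.single j 1) := by
    intro j
    set v : RJ J := EuclideanSpace.single j 1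
    have hseq : Tendsto (fun k : ℕ => p + (k : ℝ)⁻¹ • v) atTop (𝓝 p) := by
      have h := (tendsto_inv_atTop_zero.comp (tendsto_natCast_atTop_atTop (R := ℝ))).smul_const v
      simpa using h.const_add p
    -- Partial derivatives are limits of difference quotients. The shift by N keeps the points p +
    -- v/k in U, where measurability in the parameter is known.
    obtain ⟨N, hN⟩ := eventually_atTop.1 (hseq.eventually hU)
    have hlim : ∀ x, Tendsto (fun k : ℕ => ((k + N : ℕ) : ℝ) •
        (m x (p + ((k + N : ℕ) : ℝ)⁻¹ • v) - m x p)) atTop (𝓝 (fderiv ℝ (m x) p v)) := fun x =>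
      (((hd x).lim_real v).comp (tendsto_natCast_atTop_atTop (R := ℝ))).comp (tendsto_add_atTop_nat N)
    refine measurable_of_tendsto_metrizable (fun k => ?_) (tendsto_pi_nhds.2 hlim)
    exact ((hm _ (hN _ (Nat.le_add_left N k))).sub (hm p hpU)).const_smul ((k + N : ℕ) : ℝ)
  have e : (fun x => fderiv ℝ (m x) p) = fun x => ∑ j,
      fderiv ℝ (m x) p (EuclideanSpace.single j 1) • (EuclideanSpace.proj (𝕜 := ℝ) j) := by
    funext x
    ext v
    rw [clm_apply_eq_sum]
    simp [mul_comm]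
  rw [e]
  exact Finset.stronglyMeasurable_fun_sum _ fun j _ =>
    (hcoord j).stronglyMeasurable.smul_const _

/-- Differentiation under the integral sign, with the gradients dominated on all of U by J * c. -/
theorem differentiableAt_integral_mul {Ω 𝓧 : Type*} [MeasurableSpace Ω] [MeasurableSpace 𝓧]
    {μ : Measure Ω} [IsProbabilityMeasure μ] {X : Ω → 𝓧} (hX : Measurable X) {ρ : 𝓧 → ℝ}
    (hρ : Measurable ρ) (hρ1 : ∀ x, |ρ x| ≤ 1) (hc : 0 ≤ c) (hU : IsOpen U) {p : RJ J} (hp : p ∈ U)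
    {m : 𝓧 → RJ J → ℝ} (hm : ∀ q ∈ U, Measurable fun x => m x q)
    (hint : Integrable (fun ω => m (X ω) p) μ) (hs : ∀ x, SmoothBounded (m x) U c) :
    DifferentiableAt ℝ (fun q => ∫ ω, ρ (X ω) * m (X ω) q ∂μ) p := by
  have hmeas : ∀ q ∈ U, AEStronglyMeasurable (fun ω => ρ (X ω) * m (X ω) q) μ := fun q hq =>
    ((hρ.comp hX).mul ((hm q hq).comp hX)).aestronglyMeasurable
  refine (hasFDerivAt_integral_of_dominated_of_fderiv_le (𝕜 := ℝ) (μ := μ) (s := U)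
    (bound := fun _ => J * c)
    (F := fun q ω => ρ (X ω) * m (X ω) q) (F' := fun q ω => ρ (X ω) • fderiv ℝ (m (X ω)) q)
    (hU.mem_nhds hp) ?_ ?_ ?_ ?_ (integrable_const _) ?_).differentiableAt
  · filter_upwards [hU.mem_nhds hp] with q hq using hmeas q hq
  · exact hint.bdd_mul (hρ.comp hX).aestronglyMeasurable (c := 1)
      (Eventually.of_forall fun ω => hρ1 _)
  · refine ((hρ.comp hX).stronglyMeasurable.smul ?_).aestronglyMeasurable
    exact (stronglyMeasurable_fderiv (hU.mem_nhds hp) hm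
      fun x => (hs x).hasFDerivAt hU hp).comp_measurable hX
  · refine Eventually.of_forall fun ω q hq => ?_
    rw [norm_smul]
    refine (mul_le_of_le_one_left (norm_nonneg _) (hρ1 _)).trans (norm_clm_le hc fun j => ?_)
    exact ((hs (X ω)).2 q hq).1 j
  · exact Eventually.of_forall fun ω q hq => ((hs (X ω)).hasFDerivAt hU hq).const_mul (ρ (X ω))

/-- Conditional means may replace a bounded random variable under a weight that depends on the
conditioning variable only. -/
theorem integral_mul_eq_of_condExp {Ω 𝓧 : Type*} [MeasurableSpace Ω] [MeasurableSpace 𝓧]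
    {μ : Measure Ω} [IsProbabilityMeasure μ] {X : Ω → 𝓧} (hX : Measurable X) {ρ : 𝓧 → ℝ}
    (hρ : Measurable ρ) (hρ1 : ∀ x, |ρ x| ≤ 1) {f : Ω → ℝ} (hf : Integrable f μ) {m : 𝓧 → ℝ}
    (hm : (fun ω => m (X ω)) =ᵐ[μ] μ[f | MeasurableSpace.comap X inferInstance]) :
    ∫ ω, ρ (X ω) * f ω ∂μ = ∫ ω, ρ (X ω) * m (X ω) ∂μ := by
  have hle : MeasurableSpace.comap X inferInstance ≤ (inferInstance : MeasurableSpace Ω) :=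
    hX.comap_le
  have hsm : StronglyMeasurable[MeasurableSpace.comap X inferInstance] fun ω => ρ (X ω) :=
    (hρ.comp (comap_measurable X)).stronglyMeasurable
  have hi : Integrable ((fun ω => ρ (X ω)) * f) μ :=
    hf.bdd_mul (hρ.comp hX).aestronglyMeasurable (c := 1) (Eventually.of_forall fun ω => hρ1 _)
  have hpull := condExp_mul_of_stronglyMeasurable_left hsm hi hf
  calc ∫ ω, ρ (X ω) * f ω ∂μ
      = ∫ ω, (μ[(fun ω => ρ (X ω)) * f | MeasurableSpace.comap X inferInstance]) ω ∂μ :=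
        (integral_condExp hle).symm
    _ = ∫ ω, ρ (X ω) * m (X ω) ∂μ := by
        refine integral_congr_ae ?_
        filter_upwards [hpull, hm] with ω h1 h2
        rw [h1, Pi.mul_apply, ← h2]

end Smooth

/-! ### Stability of an isolated zero -/

/-- Near p₀ the injective derivative is bounded below by A⁻¹, half of which absorbs the
linearization error. Away from p₀ the continuous function ‖z‖ has no zero on a compact set, hence a
positive minimum, while ‖p - p₀‖ is bounded. -/
theorem exists_mul_norm_sub_le {E F : Type*} [NormedAddCommGroup E] [NormedSpace ℝ E]
    [FiniteDimensional ℝ E] [NormedAddCommGroup F] [NormedSpace ℝ F] {S : Set E} (hS : IsCompact S)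
    {z : E → F} (hz : ContinuousOn z S) {p₀ : E} (hz₀ : z p₀ = 0)
    (huniq : ∀ p ∈ S, z p = 0 → p = p₀) {D : E →L[ℝ] F} (hD : HasFDerivAt z D p₀)
    (hinj : Function.Injective D) : ∃ κ : ℝ, 0 < κ ∧ ∀ p ∈ S, κ * ‖p - p₀‖ ≤ ‖z p‖ := by
  obtain ⟨A, hA', hlow⟩ : ∃ A : ℝ, 0 < A ∧ ∀ v, ‖v‖ ≤ A * ‖D v‖ := by
    obtain ⟨A, hA, hanti⟩ := D.toLinearMap.exists_antilipschitzWith (LinearMap.ker_eq_bot.2 hinj)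
    exact ⟨A, hA, fun v => by simpa using hanti.le_mul_dist v 0⟩
  have hloc : ∀ᶠ p in 𝓝 p₀, (2 * A)⁻¹ * ‖p - p₀‖ ≤ ‖z p‖ := by
    filter_upwards [hD.isLittleO.def (show (0 : ℝ) < (2 * A)⁻¹ by positivity)] with p hp
    rw [hz₀, sub_zero] at hp
    have h1 := hlow (p - p₀)
    have h2 : ‖D (p - p₀)‖ ≤ ‖z p‖ + ‖z p - D (p - p₀)‖ := by
      have := norm_sub_le (z p) (z p - D (p - p₀))
      rwa [sub_sub_cancel] at this
    have h3 : A⁻¹ * ‖p - p₀‖ ≤ ‖D (p - p₀)‖ := by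
      rw [inv_mul_le_iff₀ hA']; exact h1
    have h4 : A⁻¹ = (2 * A)⁻¹ + (2 * A)⁻¹ := by rw [mul_inv]; ring
    rw [h4, add_mul] at h3
    linarith
  obtain ⟨δ, hδ, hball⟩ := Metric.eventually_nhds_iff.1 hloc
  have hT : IsCompact (S ∩ {p | δ ≤ dist p p₀}) :=
    hS.inter_right (isClosed_le continuous_const (continuous_id.dist continuous_const))
  obtain ⟨r, hr, hfar⟩ : ∃ r : ℝ, 0 < r ∧ ∀ p ∈ S ∩ {p | δ ≤ dist p p₀}, r ≤ ‖z p‖ := by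
    rcases (S ∩ {p | δ ≤ dist p p₀}).eq_empty_or_nonempty with he | hne
    · exact ⟨1, one_pos, fun p hp => by rw [he] at hp; exact hp.elim⟩
    · obtain ⟨q, hq, hmin⟩ := hT.exists_isMinOn hne
        ((hz.mono Set.inter_subset_left).norm)
      refine ⟨‖z q‖, norm_pos_iff.2 fun h0 => ?_, fun p hp => hmin hp⟩
      have hq2 : δ ≤ dist q p₀ := hq.2
      rw [huniq q hq.1 h0, dist_self] at hq2
      linarith
  obtain ⟨R, hR⟩ := hS.isBounded.subset_ball p₀
  refine ⟨min (2 * A)⁻¹ (r / max R 1), lt_min (by positivity) (by positivity), fun p hp => ?_⟩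
  by_cases hlt : dist p p₀ < δ
  · exact (mul_le_mul_of_nonneg_right (min_le_left _ _) (norm_nonneg _)).trans (hball hlt)
  · refine le_trans ?_ (hfar p ⟨hp, not_lt.1 hlt⟩)
    have h1 : ‖p - p₀‖ ≤ max R 1 := by
      rw [← dist_eq_norm]; exact (Metric.mem_ball.1 (hR hp)).le.trans (le_max_left _ _)
    calc min (2 * A)⁻¹ (r / max R 1) * ‖p - p₀‖ ≤ r / max R 1 * max R 1 := by
          refine mul_le_mul (min_le_right _ _) h1 (norm_nonneg _) (by positivity)
      _ = r := div_mul_cancel₀ _ (by positivity)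

/-- The derivative of the outcome, expressed through that of the demand, leaves a remainder of
smaller order. -/
theorem isLittleO_sub_comp_inverse {E : Type*} [NormedAddCommGroup E] [NormedSpace ℝ E]
    [FiniteDimensional ℝ E] {z : E → E} {u : E → ℝ} {p₀ : E} (hz₀ : z p₀ = 0)
    (hz : DifferentiableAt ℝ z p₀) (hu : DifferentiableAt ℝ u p₀)
    (hinj : Function.Injective (fderiv ℝ z p₀)) :
    (fun p => u p - u p₀ - ((fderiv ℝ u p₀).comp (fderiv ℝ z p₀).inverse) (z p))
      =o[𝓝 p₀] fun p => p - p₀ := by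
  -- An injective endomorphism in finite dimension is invertible, so `inverse` is the true inverse
  -- and not its default value 0.
  set e := (LinearEquiv.ofInjectiveEndo (fderiv ℝ z p₀).toLinearMap hinj).toContinuousLinearEquiv
    with he
  have hDe : fderiv ℝ z p₀ = (e : E →L[ℝ] E) := by
    ext v; rfl
  set φ := (fderiv ℝ u p₀).comp (fderiv ℝ z p₀).inverse with hφ
  have hcomp : φ.comp (fderiv ℝ z p₀) = fderiv ℝ u p₀ := by
    ext v
    simp only [hφ, hDe, ContinuousLinearMap.inverse_equiv, ContinuousLinearMap.comp_apply,
      ContinuousLinearEquiv.coe_coe, ContinuousLinearEquiv.symm_apply_apply]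
  have h := hu.hasFDerivAt.sub (φ.hasFDerivAt.comp p₀ hz.hasFDerivAt)
  rw [hcomp, sub_self] at h
  refine h.isLittleO.congr_left fun p => ?_
  simp only [Pi.sub_apply, Function.comp_apply, hz₀, map_zero, zero_apply]
  ring

theorem measure_ge_le_of_integral_abs {Ω : Type*} [MeasurableSpace Ω] {μ : Measure Ω}
    [IsFiniteMeasure μ] {f : Ω → ℝ} (hf : Integrable f μ) {t : ℝ} (ht : 0 < t) :
    μ {ω | t ≤ |f ω|} ≤ ENNReal.ofReal ((∫ ω, |f ω| ∂μ) / t) := by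
  have h := mul_meas_ge_le_integral_of_nonneg (Eventually.of_forall fun ω => abs_nonneg (f ω))
    hf.abs t
  rw [← ofReal_measureReal]
  refine ENNReal.ofReal_le_ofReal ?_
  rw [le_div_iff₀ ht, mul_comm]
  exact h

/-! ### Clearing, means and derivatives under the law of submissions. -/

namespace Market

variable {Ω 𝓧 𝓑 : Type*} {J : ℕ} {M : Market Ω 𝓧 𝓑 J} [MeasurableSpace Ω] [MeasurableSpace 𝓧]
  [MeasurableSpace 𝓑] {μ : Measure Ω}

theorem measurable_d_coord (hM : M.Sampling μ) (j : Fin J) :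
    Measurable fun z : 𝓑 × RJ J => M.d z.1 z.2 j :=
  (EuclideanSpace.proj (𝕜 := ℝ) j).continuous.measurable.comp hM.measurable_d

variable [IsProbabilityMeasure μ] {Pol : Set (𝓧 → ℝ)}

/-- Almost surely the market can be cleared exactly if the mechanism clears it. -/
theorem real_clearing_ge (hM : M.Sampling μ) {π : 𝓧 → ℝ} (hπ : Measurable π)
    (h01 : ∀ x, π x ∈ Set.Icc (0 : ℝ) 1) {n : ℕ} {a r : ℝ}
    (hr : r ≤ ∫ ω, policyExp π (M.covariates n ω)
      (Set.indicator {w | (M.clearing n a w ω).Nonempty} fun _ => 1) ∂μ)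
    (hP : ∀ w : Fin n → Bool, ∀ᵐ ω ∂μ,
      (M.clearing n a w ω).Nonempty → M.P n w ω ∈ M.clearing n a w ω) :
    r ≤ (sampleLaw (M.policyLaw μ π) n).real
      {b | ClearingSequence.excess M.d M.cap (M.cutoff n) b ≤ a} := by
  set A : Set (Fin n → 𝓑) := {b | ClearingSequence.excess M.d M.cap (M.cutoff n) b ≤ a} with hA
  have hAm : MeasurableSet A := measurableSet_le
    (ClearingSequence.measurable_excess M.cap hM.measurable_d (hM.measurable_cutoff n))
    measurable_const
  have h := integral_policyExp_bids hM hπ h01 n (F := A.indicator fun _ => (1 : ℝ))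
    (measurable_const.indicator hAm) (K := 1) fun b => by
      by_cases hb : b ∈ A <;> simp [hb]
  rw [integral_indicator_const _ hAm, smul_eq_mul, mul_one] at h
  rw [← h]
  refine hr.trans (le_of_eq (integral_congr_ae ?_))
  filter_upwards [ae_all_iff.2 hP] with ω hω
  unfold policyExp
  refine Finset.sum_congr rfl fun w _ => ?_
  -- Almost surely, clearability is the same as being cleared by the mechanism. The latter is an
  -- event about the submissions alone, to which the transfer to the i.i.d. law applies.
  have hiff : w ∈ {w | (M.clearing n a w ω).Nonempty} ↔ M.bids n w ω ∈ A :=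
    ⟨fun hne => hω w hne, fun hmem => ⟨M.P n w ω, hmem⟩⟩
  dsimp only
  by_cases hw : M.bids n w ω ∈ A
  · rw [Set.indicator_of_mem hw, Set.indicator_of_mem (hiff.2 hw)]
  · rw [Set.indicator_of_notMem hw, Set.indicator_of_notMem fun h => hw (hiff.1 h)]

/-- The excess is at most |a n| when the market clears and bounded otherwise. The second case has
probability at most exp(-c n), so both contributions are o(n^(-1/2)) in mean. -/
theorem tendsto_integral_excess (hM : M.Sampling μ) (hC : M.CutoffMechanism μ Pol) {π : 𝓧 → ℝ}
    (hmem : π ∈ Pol) (hπ : Measurable π) (h01 : ∀ x, π x ∈ Set.Icc (0 : ℝ) 1) :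
    Tendsto (fun n : ℕ => (n : ℝ) ^ (1 / 2 : ℝ) *
      ∫ b, ClearingSequence.excess M.d M.cap (M.cutoff n) b ∂(sampleLaw (M.policyLaw μ π) n))
      atTop (𝓝 0) := by
  have hprob := isProbabilityMeasure_policyLaw hM hπ h01
  obtain ⟨K, hK⟩ := hC.bounded_d
  obtain ⟨a, c, hc, ha, hclear, hP⟩ := hC.clears
  have hexp : Tendsto (fun n : ℕ => (n : ℝ) ^ (1 / 2 : ℝ) * Real.exp (-c * n)) atTop (𝓝 0) :=
    (tendsto_rpow_mul_exp_neg_mul_atTop_nhds_zero (1 / 2) c hc).comp tendsto_natCast_atTop_atTop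
  have hlim := ha.abs.add (hexp.const_mul (max (K + ‖M.cap‖) 0))
  rw [abs_zero, mul_zero, add_zero] at hlim
  refine squeeze_zero' (Eventually.of_forall fun n => mul_nonneg (by positivity)
    (integral_nonneg fun b => norm_nonneg _)) ?_ hlim
  filter_upwards [eventually_gt_atTop 0] with n hn
  set Q := sampleLaw (M.policyLaw μ π) n with hQ
  set f := ClearingSequence.excess M.d M.cap (M.cutoff n) with hf
  set A : Set (Fin n → 𝓑) := {b | f b ≤ a n} with hA
  have hfm : Measurable f :=
    ClearingSequence.measurable_excess M.cap hM.measurable_d (hM.measurable_cutoff n)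
  have hAm : MeasurableSet A := measurableSet_le hfm measurable_const
  have hreal : 1 - Real.exp (-c * n) ≤ Q.real A :=
    real_clearing_ge hM hπ h01 (hclear π hmem n hn) (hP n hn)
  have hle : ∫ b, f b ∂Q ≤ ∫ b, (|a n| + Aᶜ.indicator (fun _ => max (K + ‖M.cap‖) 0) b) ∂Q := by
    refine integral_mono_of_nonneg (Eventually.of_forall fun b => norm_nonneg _)
      ((integrable_const _).add ((integrable_const _).indicator hAm.compl))
      (Eventually.of_forall fun b => ?_)
    dsimp only
    by_cases hb : b ∈ A
    · rw [Set.indicator_of_notMem (by simpa using hb), add_zero]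
      exact le_trans hb (le_abs_self _)
    · rw [Set.indicator_of_mem hb]
      have := ClearingSequence.excess_le M.cap hn hK (hC.cutoff_mem n hn) b
      linarith [le_max_left (K + ‖M.cap‖) 0, abs_nonneg (a n)]
  rw [integral_add (integrable_const _) ((integrable_const _).indicator hAm.compl),
    integral_indicator_const _ hAm.compl, integral_const, probReal_univ, one_smul,
    probReal_compl_eq_one_sub hAm, smul_eq_mul] at hle
  have h2 : (1 - Q.real A) * max (K + ‖M.cap‖) 0 ≤ Real.exp (-c * n) * max (K + ‖M.cap‖) 0 :=
    mul_le_mul_of_nonneg_right (by linarith) (le_max_right _ _)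
  refine (mul_le_mul_of_nonneg_left (hle.trans (add_le_add le_rfl h2)) (by positivity)).trans
    (le_of_eq ?_)
  rw [abs_mul, abs_of_nonneg (Real.sqrt_nonneg _), Real.sqrt_eq_rpow]
  ring

theorem popY_eq (hM : M.Sampling μ) {π : 𝓧 → ℝ} (hπ : Measurable π)
    (h01 : ∀ x, π x ∈ Set.Icc (0 : ℝ) 1) {K : ℝ} {p : RJ J} (hK : ∀ b, |M.y b p| ≤ K) :
    M.popY μ π p = ∫ b, M.y b p ∂(M.policyLaw μ π) :=
  (integral_policyLaw hM hπ h01 (measurable_section hM.measurable_y p) hK).symm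

theorem integrable_d (hM : M.Sampling μ) {K : ℝ} {p : RJ J} (hK : ∀ b, ‖M.d b p‖ ≤ K) (w : Bool)
    (i : ℕ) : Integrable (fun ω => M.d (M.B w i ω) p) μ :=
  Integrable.of_bound ((hM.measurable_d.comp ((hM.measurable_B w i).prodMk
    measurable_const)).aestronglyMeasurable) K (Eventually.of_forall fun _ => hK _)

theorem popZ_eq (hM : M.Sampling μ) {π : 𝓧 → ℝ} (hπ : Measurable π)
    (h01 : ∀ x, π x ∈ Set.Icc (0 : ℝ) 1) {K : ℝ} {p : RJ J} (hK : ∀ b, ‖M.d b p‖ ≤ K) :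
    M.popZ μ π p = meanVec (M.policyLaw μ π) M.d p - M.cap := by
  have hw : ∀ w, Integrable (fun ω => ruleWeight π w (M.X 0 ω) • M.d (M.B w 0 ω) p) μ := fun w =>
    (integrable_d hM hK w 0).bdd_smul 1
      ((measurable_ruleWeight hπ w).comp (hM.measurable_X 0)).aestronglyMeasurable
      (Eventually.of_forall fun ω => by
        rw [Function.comp_apply, Real.norm_of_nonneg (ruleWeight_nonneg h01 _ _)]
        exact ruleWeight_le_one h01 _ _)
  have hi : Integrable (fun ω => π (M.X 0 ω) • M.d (M.B true 0 ω) p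
      + (1 - π (M.X 0 ω)) • M.d (M.B false 0 ω) p) μ := (hw true).add (hw false)
  unfold popZ
  congr 1
  ext j
  have h1 := (EuclideanSpace.proj (𝕜 := ℝ) j).integral_comp_comm hi
  have h2 := integral_policyLaw hM hπ h01
    (measurable_section (g := fun b p => M.d b p j) (measurable_d_coord hM j) p)
    fun b => (abs_apply_le_norm _ j).trans (hK b)
  simp only [meanVec]
  rw [h2]
  exact h1.symm

/-- The function f may be discontinuous in p. The tower property replaces it by its conditional
means, which are smooth, under weights that depend on the covariates only. -/
theorem differentiableAt_integral_policyLaw (hM : M.Sampling μ) {π : 𝓧 → ℝ} (hπ : Measurable π)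
    (h01 : ∀ x, π x ∈ Set.Icc (0 : ℝ) 1) {f : 𝓑 → RJ J → ℝ}
    (hf : Measurable fun z : 𝓑 × RJ J => f z.1 z.2) {S : Set (RJ J)} {K c : ℝ} (hc : 0 ≤ c)
    (hK : ∀ b, ∀ p ∈ S, |f b p| ≤ K) {m : Bool → 𝓧 → RJ J → ℝ}
    (hm : ∀ w, ∀ p ∈ S, Measurable fun x => m w x p)
    (hcond : ∀ w, ∀ p ∈ S, (fun ω => m w (M.X 0 ω) p) =ᵐ[μ]
      μ[fun ω => f (M.B w 0 ω) p | MeasurableSpace.comap (M.X 0) inferInstance])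
    (hs : ∀ w x, SmoothBounded (m w x) (interior S) c) {p₀ : RJ J} (hp₀ : p₀ ∈ interior S) :
    DifferentiableAt ℝ (fun p => ∫ b, f b p ∂(M.policyLaw μ π)) p₀ := by
  have hρ1 : ∀ w x, |ruleWeight π w x| ≤ 1 := fun w x => by
    rw [abs_of_nonneg (ruleWeight_nonneg h01 w x)]; exact ruleWeight_le_one h01 w x
  have hfi : ∀ w, ∀ p ∈ S, Integrable (fun ω => f (M.B w 0 ω) p) μ := fun w p hp =>
    integrable_of_abs_le ((measurable_section hf p).comp (hM.measurable_B w 0)) fun ω => hK _ p hp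
  have hd : ∀ w, DifferentiableAt ℝ
      (fun p => ∫ ω, ruleWeight π w (M.X 0 ω) * m w (M.X 0 ω) p ∂μ) p₀ := fun w =>
    differentiableAt_integral_mul (hM.measurable_X 0) (measurable_ruleWeight hπ w) (hρ1 w) hc
      isOpen_interior hp₀ (fun q hq => hm w q (interior_subset hq))
      ((integrable_condExp).congr (hcond w p₀ (interior_subset hp₀)).symm) (hs w)
  refine ((hd true).add (hd false)).congr_of_eventuallyEq ?_
  filter_upwards [isOpen_interior.mem_nhds hp₀] with p hp
  have hpS := interior_subset hp
  have hmul : ∀ w, Integrable (fun ω => ruleWeight π w (M.X 0 ω) * f (M.B w 0 ω) p) μ := fun w =>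
    (hfi w p hpS).bdd_mul
      ((measurable_ruleWeight hπ w).comp (hM.measurable_X 0)).aestronglyMeasurable (c := 1)
      (Eventually.of_forall fun ω => hρ1 w _)
  rw [integral_policyLaw hM hπ h01 (measurable_section hf p) fun b => hK b p hpS]
  have e : ∀ w, ∫ ω, ruleWeight π w (M.X 0 ω) * f (M.B w 0 ω) p ∂μ
      = ∫ ω, ruleWeight π w (M.X 0 ω) * m w (M.X 0 ω) p ∂μ := fun w =>
    integral_mul_eq_of_condExp (m := fun x => m w x p) (hM.measurable_X 0) (measurable_ruleWeight hπ w) (hρ1 w)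
      (hfi w p hpS) (hcond w p hpS)
  rw [Pi.add_apply, ← e true, ← e false]
  exact integral_add (hmul true) (hmul false)

/-- Treatment probabilities are at most 1, so the law of submissions is dominated by the sum of the
laws of the two potential submissions. -/
theorem integral_policyLaw_le (hM : M.Sampling μ) {π : 𝓧 → ℝ} (hπ : Measurable π)
    (h01 : ∀ x, π x ∈ Set.Icc (0 : ℝ) 1) {f : 𝓑 → ℝ} (hf : Measurable f) {K : ℝ}
    (hK : ∀ b, |f b| ≤ K) (h0 : ∀ b, 0 ≤ f b) {B : ℝ} (hB : ∀ w, ∫ ω, f (M.B w 0 ω) ∂μ ≤ B) :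
    ∫ b, f b ∂(M.policyLaw μ π) ≤ 2 * B := by
  have hi : ∀ w, Integrable (fun ω => f (M.B w 0 ω)) μ := fun w =>
    integrable_of_abs_le (hf.comp (hM.measurable_B w 0)) fun ω => hK _
  rw [integral_policyLaw hM hπ h01 hf hK]
  calc _ ≤ ∫ ω, (f (M.B true 0 ω) + f (M.B false 0 ω)) ∂μ := by
        refine integral_mono_of_nonneg (Eventually.of_forall fun ω => ?_)
          ((hi true).add (hi false)) (Eventually.of_forall fun ω => ?_)
        · have := h01 (M.X 0 ω)
          exact add_nonneg (mul_nonneg this.1 (h0 _)) (mul_nonneg (by linarith [this.2]) (h0 _))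
        · have := h01 (M.X 0 ω)
          exact add_le_add (mul_le_of_le_one_left (h0 _) this.2)
            (mul_le_of_le_one_left (h0 _) (by linarith [this.1]))
    _ ≤ 2 * B := by
        rw [integral_add (hi true) (hi false)]
        linarith [hB true, hB false]

end Market

theorem abs_integral_le_sqrt_integral_sq {α : Type*} [MeasurableSpace α] {ν : Measure α}
    [IsProbabilityMeasure ν] {f : α → ℝ} (hf : Measurable f) {K : ℝ} (hK : ∀ x, |f x| ≤ K) :
    |∫ x, f x ∂ν| ≤ Real.sqrt (∫ x, f x ^ 2 ∂ν) := by
  have hmem : MemLp f 2 ν := MemLp.of_bound hf.aestronglyMeasurable K (Eventually.of_forall hK)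
  have hv := variance_nonneg f ν
  rw [variance_eq_sub hmem] at hv
  simp only [Pi.pow_apply] at hv
  exact Real.abs_le_sqrt (by linarith)

/-- Mean-square Hölder continuity of the demand makes the mean demand continuous. -/
theorem continuousOn_meanVec {𝓑 : Type*} [MeasurableSpace 𝓑] {J : ℕ} {ν : Measure 𝓑}
    [IsProbabilityMeasure ν] {d : 𝓑 → RJ J → RJ J} {S : Set (RJ J)} {K L : ℝ}
    (hd : ∀ j, Measurable fun z : 𝓑 × RJ J => d z.1 z.2 j) (hK : ∀ b, ∀ p ∈ S, ‖d b p‖ ≤ K)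
    (hL : ∀ p ∈ S, ∀ p' ∈ S, ∀ j, ∫ x, (d x p j - d x p' j) ^ 2 ∂ν ≤ L * ‖p - p'‖) :
    ContinuousOn (meanVec ν d) S := by
  have hcoord : ∀ j, ContinuousOn (fun p => ∫ x, d x p j ∂ν) S := by
    intro j p' hp'
    rw [ContinuousWithinAt, tendsto_iff_norm_sub_tendsto_zero]
    have hlim : Tendsto (fun p => Real.sqrt (L * ‖p - p'‖)) (𝓝[S] p') (𝓝 0) := by
      have : Continuous fun p : RJ J => Real.sqrt (L * ‖p - p'‖) := by fun_prop
      simpa using (this.tendsto p').mono_left nhdsWithin_le_nhds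
    refine squeeze_zero' (Eventually.of_forall fun p => norm_nonneg _) ?_ hlim
    filter_upwards [self_mem_nhdsWithin] with p hp
    have hm : ∀ q, Measurable fun x => d x q j := fun q =>
      measurable_section (g := fun x q => d x q j) (hd j) q
    have hb : ∀ q ∈ S, ∀ x, |d x q j| ≤ K := fun q hq x =>
      (abs_apply_le_norm _ j).trans (hK x q hq)
    rw [← integral_sub (integrable_of_abs_le (hm p) (hb p hp))
      (integrable_of_abs_le (hm p') (hb p' hp')), Real.norm_eq_abs]
    refine (abs_integral_le_sqrt_integral_sq ((hm p).sub (hm p')) (K := 2 * K) fun x => ?_).trans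
      (Real.sqrt_le_sqrt (hL p hp p' hp' j))
    exact (abs_sub _ _).trans (by linarith [hb p hp x, hb p' hp' x])
  exact (PiLp.continuous_toLp 2 _).comp_continuousOn (continuousOn_pi.2 hcoord)

/-! ### The market under a rule as a clearing sequence. -/

namespace Market

variable {Ω 𝓧 𝓑 : Type*} {J : ℕ} {M : Market Ω 𝓧 𝓑 J} [MeasurableSpace Ω] [MeasurableSpace 𝓧]
  [MeasurableSpace 𝓑] {μ : Measure Ω}

/-- The linear form that eliminates the cutoffs from outcomes, under the rule `π`. -/
def shadowPrice (M : Market Ω 𝓧 𝓑 J) (μ : Measure Ω) (π : 𝓧 → ℝ) (p : RJ J) : RJ J →L[ℝ] ℝ :=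
  (fderiv ℝ (M.popY μ π) p).comp (fderiv ℝ (M.popZ μ π) p).inverse

variable [IsProbabilityMeasure μ] {Pol : Set (𝓧 → ℝ)} {pstar : (𝓧 → ℝ) → RJ J} {c' c₃ c₄ : ℝ}

section

variable (hM : M.Sampling μ) (hC : M.CutoffMechanism μ Pol)
  (hO : M.RegularOutcomes μ Pol pstar c' c₃ c₄) (hE : M.RegularEquilibrium μ Pol pstar c' c₃)
  (hc' : 0 < c') (hc₃ : 0 < c₃) {π : 𝓧 → ℝ} (hmem : π ∈ Pol) (hπ : Measurable π)
  (h01 : ∀ x, π x ∈ Set.Icc (0 : ℝ) 1)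

omit [MeasurableSpace 𝓧] [MeasurableSpace 𝓑] [IsProbabilityMeasure μ] in
include hE hmem in
theorem pstar_mem_interior : pstar π ∈ interior M.S := by
  obtain ⟨c₁, hc₁, hball⟩ := hE.interior
  exact mem_interior.2 ⟨_, hball π hmem, Metric.isOpen_ball, Metric.mem_ball_self hc₁⟩

include hM hO hE hc' hmem hπ h01

theorem differentiableAt_popY : DifferentiableAt ℝ (M.popY μ π) (pstar π) := by
  have hint := pstar_mem_interior hE hmem
  obtain ⟨K, hK⟩ := hO.bounded_y
  obtain ⟨md, my, hmeas, hver, hs⟩ := hO.smooth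
  refine (differentiableAt_integral_policyLaw hM hπ h01 hM.measurable_y hc'.le hK
    (fun w p hp => (hmeas w p hp).2) (fun w p hp => (hver w 0 p hp).2)
    (fun w x => (hs w x).2) hint).congr_of_eventuallyEq ?_
  filter_upwards [isOpen_interior.mem_nhds hint] with p hp
  exact popY_eq hM hπ h01 fun b => hK b p (interior_subset hp)

include hC

theorem differentiableAt_popZ : DifferentiableAt ℝ (M.popZ μ π) (pstar π) := by
  have hint := pstar_mem_interior hE hmem
  obtain ⟨K, hK⟩ := hC.bounded_d
  obtain ⟨md, my, hmeas, hver, hs⟩ := hO.smooth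
  have hmean : DifferentiableAt ℝ (meanVec (M.policyLaw μ π) M.d) (pstar π) := by
    refine differentiableAt_euclidean.2 fun j => ?_
    refine differentiableAt_integral_policyLaw (f := fun b p => M.d b p j)
      (m := fun w x p => md w x p j) hM hπ h01 (measurable_d_coord hM j)
      hc'.le (fun b p hp => (abs_apply_le_norm _ j).trans (hK b p hp))
      (fun w p hp => (EuclideanSpace.proj (𝕜 := ℝ) j).continuous.measurable.comp (hmeas w p hp).1)
      (fun w p hp => ?_) (fun w x => (hs w x).1 j) hint
    -- The versions are of vector-valued conditional means; a coordinate projection commutes with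
    -- conditional expectation.
    have h := (EuclideanSpace.proj (𝕜 := ℝ) j).comp_condExp_comm
      (m := MeasurableSpace.comap (M.X 0) inferInstance)
      (integrable_d hM (fun b => hK b p hp) w 0)
    filter_upwards [h, (hver w 0 p hp).1] with ω h1 h2
    rw [h2]
    exact h1
  refine (hmean.sub_const M.cap).congr_of_eventuallyEq ?_
  filter_upwards [isOpen_interior.mem_nhds hint] with p hp
  exact popZ_eq hM hπ h01 fun b => hK b p (interior_subset hp)

omit hM hE hπ h01 hc' hC [MeasurableSpace 𝓑] [IsProbabilityMeasure μ] in
include hc₃ in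
-- All J singular values are at least c₃ > 0.
theorem injective_fderiv_popZ : Function.Injective (fderiv ℝ (M.popZ μ π) (pstar π)) := by
  have h := (LinearMap.injective_iff_forall_lt_finrank_singularValues_pos
    (T := (fderiv ℝ (M.popZ μ π) (pstar π)).toLinearMap)).2 fun i hi =>
      hc₃.trans_le (hO.jacobian π hmem i (by simpa using hi)).1
  exact h

include hc₃

/-- This is where the market assumptions enter the abstract argument. Stability comes from
compactness, uniqueness of the equilibrium and the injective Jacobian; the shadow price is the form
that cancels the first-order effect of the cutoffs. -/
theorem exists_clearingSequence :
    ∃ K, ClearingSequence (M.policyLaw μ π) M.d M.y M.cap M.S M.cutoff (pstar π) K ∧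
      ClearingSequence.remainder (M.policyLaw μ π) M.d M.y M.cap (pstar π)
        (M.shadowPrice μ π (pstar π)) =o[𝓝 (pstar π)] fun p => p - pstar π := by
  have hprob := isProbabilityMeasure_policyLaw hM hπ h01
  have hint := pstar_mem_interior hE hmem
  obtain ⟨hpS, hzero, huniq⟩ := hE.equilibrium π hmem
  obtain ⟨Kd, hKd⟩ := hC.bounded_d
  obtain ⟨Ky, hKy⟩ := hO.bounded_y
  obtain ⟨L, hL0, hL⟩ := hO.weakly_continuous
  obtain ⟨hd, hy, Cov, -, -, hCov, hcd, hcy⟩ := hO.entropy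
  set K := max 0 (max Kd Ky) with hKdef
  have hK1 : ∀ b, ∀ p ∈ M.S, ‖M.d b p‖ ≤ K := fun b p hp =>
    (hKd b p hp).trans ((le_max_left _ _).trans (le_max_right _ _))
  have hK2 : ∀ b, ∀ p ∈ M.S, |M.y b p| ≤ K := fun b p hp =>
    (hKy b p hp).trans ((le_max_right _ _).trans (le_max_right _ _))
  have hK1j : ∀ j b, ∀ p ∈ M.S, |M.d b p j| ≤ K := fun j b p hp =>
    (abs_apply_le_norm _ j).trans (hK1 b p hp)
  have hsq : ∀ {g : 𝓑 → RJ J → ℝ}, (Measurable fun z : 𝓑 × RJ J => g z.1 z.2) →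
      (∀ b, ∀ p ∈ M.S, |g b p| ≤ K) → ∀ p ∈ M.S, ∀ p' ∈ M.S,
      (∀ w, ∫ ω, (g (M.B w 0 ω) p - g (M.B w 0 ω) p') ^ 2 ∂μ ≤ L * ‖p - p'‖) →
      ∫ b, (g b p - g b p') ^ 2 ∂(M.policyLaw μ π) ≤ 2 * L * ‖p - p'‖ := by
    intro g hg hgK p hp p' hp' hgL
    rw [mul_assoc]
    refine integral_policyLaw_le (f := fun b => (g b p - g b p') ^ 2) hM hπ h01
      (((measurable_section hg p).sub (measurable_section hg p')).pow_const 2) (K := (2 * K) ^ 2)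
      (fun b => ?_) (fun b => sq_nonneg _) hgL
    rw [abs_pow]
    exact pow_le_pow_left₀ (abs_nonneg _) ((abs_sub _ _).trans
      (by linarith [hgK b p hp, hgK b p' hp'])) 2
  have hLd : ∀ p ∈ M.S, ∀ p' ∈ M.S, ∀ j,
      ∫ b, (M.d b p j - M.d b p' j) ^ 2 ∂(M.policyLaw μ π) ≤ 2 * L * ‖p - p'‖ :=
    fun p hp p' hp' j => hsq (g := fun b p => M.d b p j) (measurable_d_coord hM j) (hK1j j) p hp
      p' hp' fun w => (hL w p hp p' hp').1 j
  have hZ : ∀ p ∈ M.S, M.popZ μ π p = meanVec (M.policyLaw μ π) M.d p - M.cap := fun p hp =>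
    popZ_eq hM hπ h01 fun b => hK1 b p hp
  have hY : ∀ p ∈ M.S, M.popY μ π p = ∫ b, M.y b p ∂(M.policyLaw μ π) := fun p hp =>
    popY_eq hM hπ h01 fun b => hK2 b p hp
  have hdiffZ := differentiableAt_popZ hM hC hO hE hc' hmem hπ h01
  have hinj := injective_fderiv_popZ hO hc₃ hmem
  have hcont : ContinuousOn (M.popZ μ π) M.S :=
    ((continuousOn_meanVec (measurable_d_coord hM) hK1 hLd).sub continuousOn_const).congr hZ
  refine ⟨K, ⟨hM.measurable_d, hM.measurable_y, hM.measurable_cutoff, hC.cutoff_mem, hpS,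
    le_max_left _ _, hK1, hK2, ⟨Cov, hd, hCov, fun j n hn =>
      (hcd j).empiricalCover_natCast hCov hn⟩, ⟨Cov, hy, hCov, fun n hn =>
      hcy.empiricalCover_natCast hCov hn⟩, ⟨2 * L, fun p hp =>
      ⟨hLd p hp _ hpS, hsq hM.measurable_y hK2 p hp _ hpS fun w => (hL w p hp _ hpS).2⟩⟩,
    tendsto_integral_excess hM hC hmem hπ h01, ?_, ?_⟩, ?_⟩
  · rw [hZ _ hpS] at hzero
    exact sub_eq_zero.1 hzero
  · obtain ⟨κ, hκ, hle⟩ := exists_mul_norm_sub_le hE.compact hcont hzero huniq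
      hdiffZ.hasFDerivAt hinj
    refine ⟨κ, hκ, fun p hp => (hle p hp).trans ?_⟩
    rw [hZ p hp]
    exact norm_le_sum_abs_apply _
  · refine (isLittleO_sub_comp_inverse hzero hdiffZ
      (differentiableAt_popY hM hO hE hc' hmem hπ h01) hinj).congr' ?_ EventuallyEq.rfl
    filter_upwards [isOpen_interior.mem_nhds hint] with p hp
    have hp' := interior_subset hp
    rw [hZ p hp', hY p hp', hY _ hpS]
    rfl

end

end Market

/-! ### Finite markets -/

section PolicyExp

variable {𝓧 : Type*} {π : 𝓧 → ℝ} {n : ℕ}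

theorem policyExp_sub_const (x : Fin n → 𝓧) (f : (Fin n → Bool) → ℝ) (v : ℝ) :
    policyExp π x (fun w => f w - v) = policyExp π x f - v := by
  unfold policyExp
  simp only [mul_sub, Finset.sum_sub_distrib, ← Finset.sum_mul, sum_policyWeight, one_mul]

theorem abs_policyExp_le (h01 : ∀ x, π x ∈ Set.Icc (0 : ℝ) 1) (x : Fin n → 𝓧)
    (f : (Fin n → Bool) → ℝ) : |policyExp π x f| ≤ policyExp π x fun w => |f w| := by
  unfold policyExp
  refine (Finset.abs_sum_le_sum_abs _ _).trans (le_of_eq (Finset.sum_congr rfl fun w _ => ?_))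
  rw [abs_mul, abs_of_nonneg (policyWeight_nonneg h01 x w)]

theorem policyExp_le (h01 : ∀ x, π x ∈ Set.Icc (0 : ℝ) 1) (x : Fin n → 𝓧)
    {f : (Fin n → Bool) → ℝ} {K : ℝ} (hf : ∀ w, f w ≤ K) : policyExp π x f ≤ K := by
  have h : policyExp π x f ≤ ∑ w, policyWeight π x w * K :=
    Finset.sum_le_sum fun w _ => mul_le_mul_of_nonneg_left (hf w) (policyWeight_nonneg h01 x w)
  rwa [← Finset.sum_mul, sum_policyWeight, one_mul] at h

end PolicyExp

/-! ### Linearization of finite-market values and treatment effects. -/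

namespace Market

variable {Ω 𝓧 𝓑 : Type*} {J : ℕ} {M : Market Ω 𝓧 𝓑 J}

/-- The corrected outcome with shadow price `φ` at the cutoffs `p`. -/
def correctedOutcome (M : Market Ω 𝓧 𝓑 J) (φ : RJ J →L[ℝ] ℝ) (p : RJ J) (b : 𝓑) : ℝ :=
  M.y b p - φ (M.d b p - M.cap)

/-- The average outcome, as a function of the submissions. -/
def avgOutcome (M : Market Ω 𝓧 𝓑 J) {n : ℕ} (b : Fin n → 𝓑) : ℝ :=
  (∑ i, M.y (b i) (M.cutoff n b)) / n

/-- Average outcome minus average corrected outcome, as a function of the submissions. -/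
def linearizationError (M : Market Ω 𝓧 𝓑 J) (φ : RJ J →L[ℝ] ℝ) (p : RJ J) {n : ℕ}
    (b : Fin n → 𝓑) : ℝ :=
  M.avgOutcome b - (∑ i, M.correctedOutcome φ p (b i)) / n

theorem avg_outcome_eq (n : ℕ) (w : Fin n → Bool) (ω : Ω) :
    (1 / (n : ℝ)) * ∑ i : Fin n, M.outcome n w i ω = M.avgOutcome (M.bids n w ω) := by
  rw [one_div, inv_mul_eq_div]
  rfl

theorem finiteValue_eq (n : ℕ) (π : 𝓧 → ℝ) (ω : Ω) :
    M.finiteValue n π ω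
      = policyExp π (M.covariates n ω) fun w => M.avgOutcome (M.bids n w ω) := by
  unfold finiteValue
  simp only [avg_outcome_eq]

theorem finiteGTE_eq (n : ℕ) (ω : Ω) :
    M.finiteGTE n ω = M.avgOutcome (M.bids n (fun _ => true) ω)
      - M.avgOutcome (M.bids n (fun _ => false) ω) := by
  rw [← avg_outcome_eq, ← avg_outcome_eq, ← mul_sub, ← Finset.sum_sub_distrib]
  rfl

theorem abs_correctedOutcome_le {S : Set (RJ J)} {K : ℝ} (hd : ∀ b, ∀ p ∈ S, ‖M.d b p‖ ≤ K)
    (hy : ∀ b, ∀ p ∈ S, |M.y b p| ≤ K) (φ : RJ J →L[ℝ] ℝ) {p : RJ J} (hp : p ∈ S) (b : 𝓑) :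
    |M.correctedOutcome φ p b| ≤ K + ‖φ‖ * (K + ‖M.cap‖) := by
  refine (abs_sub _ _).trans (add_le_add (hy b p hp) ((φ.le_opNorm _).trans ?_))
  exact mul_le_mul_of_nonneg_left ((norm_sub_le _ _).trans (add_le_add (hd b p hp) le_rfl))
    (norm_nonneg _)

section

variable [MeasurableSpace Ω] {μ : Measure Ω}

theorem popY_constRule (w : Bool) : M.popY μ (constRule 𝓧 w) = M.meanY μ w := by
  funext p
  cases w <;> simp [popY, meanY, constRule]

theorem popZ_constRule (w : Bool) :
    M.popZ μ (constRule 𝓧 w) = fun p => M.meanD μ w p - M.cap := by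
  funext p
  cases w <;> simp [popZ, meanD, constRule]

theorem shadowPrice_constRule (w : Bool) (p : RJ J) :
    M.shadowPrice μ (constRule 𝓧 w) p = M.nu μ w p := by
  rw [shadowPrice, nu, popY_constRule, popZ_constRule, fderiv_sub_const]

end

variable [MeasurableSpace Ω] [MeasurableSpace 𝓧] [MeasurableSpace 𝓑] {μ : Measure Ω}

theorem measurable_avgOutcome (hM : M.Sampling μ) (n : ℕ) :
    Measurable (M.avgOutcome (n := n)) :=
  measurable_avg hM.measurable_y (hM.measurable_cutoff n)

theorem measurable_correctedOutcome (hM : M.Sampling μ) (φ : RJ J →L[ℝ] ℝ) (p : RJ J) :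
    Measurable (M.correctedOutcome φ p) :=
  (measurable_section hM.measurable_y p).sub (φ.continuous.measurable.comp
    ((hM.measurable_d.comp (measurable_id.prodMk measurable_const)).sub_const M.cap))

theorem measurable_linearizationError (hM : M.Sampling μ) (φ : RJ J →L[ℝ] ℝ) (p : RJ J) (n : ℕ) :
    Measurable (M.linearizationError φ p (n := n)) :=
  (measurable_avgOutcome hM n).sub ((Finset.measurable_sum _ fun i _ =>
    (measurable_correctedOutcome hM φ p).comp (measurable_pi_apply i)).div_const _)

theorem measurable_policyExp_bids (hM : M.Sampling μ) {π : 𝓧 → ℝ} (hπ : Measurable π) (n : ℕ)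
    {F : (Fin n → 𝓑) → ℝ} (hF : Measurable F) :
    Measurable fun ω => policyExp π (M.covariates n ω) fun w => F (M.bids n w ω) :=
  Finset.measurable_sum _ fun w _ => (measurable_policyWeight hM hπ w).mul
    (hF.comp (measurable_bids hM n w))

variable [IsProbabilityMeasure μ]

theorem integral_bids_const (hM : M.Sampling μ) (w : Bool) (n : ℕ) {F : (Fin n → 𝓑) → ℝ}
    (hF : Measurable F) {K : ℝ} (hK : ∀ b, |F b| ≤ K) :
    ∫ ω, F (M.bids n (fun _ => w) ω) ∂μ
      = ∫ b, F b ∂(sampleLaw (M.policyLaw μ (constRule 𝓧 w)) n) := by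
  rw [← integral_policyExp_bids hM (π := constRule 𝓧 w) measurable_const
    (fun x => by cases w <;> simp [constRule]) n hF hK]
  simp only [policyExp_constRule]

section

variable {Pol : Set (𝓧 → ℝ)} {pstar : (𝓧 → ℝ) → RJ J} {c' c₃ c₄ : ℝ}
  (hM : M.Sampling μ) (hC : M.CutoffMechanism μ Pol)
  (hO : M.RegularOutcomes μ Pol pstar c' c₃ c₄) (hE : M.RegularEquilibrium μ Pol pstar c' c₃)
  (hc' : 0 < c') (hc₃ : 0 < c₃) {π : 𝓧 → ℝ} (hmem : π ∈ Pol) (hπ : Measurable π)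
  (h01 : ∀ x, π x ∈ Set.Icc (0 : ℝ) 1)

include hM hC hO hE hc' hc₃ hmem hπ h01

theorem tendsto_integral_abs_linearizationError :
    Tendsto (fun n : ℕ => (n : ℝ) ^ (1 / 2 : ℝ) *
      ∫ b, |M.linearizationError (M.shadowPrice μ π (pstar π)) (pstar π) b|
        ∂(sampleLaw (M.policyLaw μ π) n)) atTop (𝓝 0) := by
  have := isProbabilityMeasure_policyLaw hM hπ h01
  obtain ⟨K, H, hφ⟩ := exists_clearingSequence hM hC hO hE hc' hc₃ hmem hπ h01
  exact H.tendsto_linearization _ hφ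

/-- The deviation splits into the linearization error, eventually below 1 in mean after scaling by
√n, and a centred average of corrected outcomes bounded by B. This gives the constant 1 + B. -/
theorem exists_sqrt_mul_integral_abs_finiteValue_sub_le :
    ∃ C : ℝ, 0 ≤ C ∧ ∀ᶠ n : ℕ in atTop,
      Integrable (fun ω => M.finiteValue n π ω - M.continuumValue μ pstar π) μ ∧
      Real.sqrt n * ∫ ω, |M.finiteValue n π ω - M.continuumValue μ pstar π| ∂μ ≤ C := by
  have hprob := isProbabilityMeasure_policyLaw hM hπ h01
  obtain ⟨K, H, hφ⟩ := exists_clearingSequence hM hC hO hE hc' hc₃ hmem hπ h01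
  have hlim := H.tendsto_linearization _ hφ
  set φ := M.shadowPrice μ π (pstar π) with hφdef
  set V := M.continuumValue μ pstar π with hV
  set ν := M.policyLaw μ π with hν
  set q := M.correctedOutcome φ (pstar π) with hq
  set B := K + ‖φ‖ * (K + ‖M.cap‖) with hB
  have hB0 : 0 ≤ B := by have := H.bound_nonneg; positivity
  have hqm : Measurable q := measurable_correctedOutcome hM φ _
  have hqB : ∀ b, |q b| ≤ B := abs_correctedOutcome_le H.bounded_d H.bounded_y φ H.mem_base
  have hVY : V = ∫ b, M.y b (pstar π) ∂ν :=
    popY_eq hM hπ h01 fun b => H.bounded_y b _ H.mem_base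
  have hVK : |V| ≤ K := by
    rw [hVY]
    exact abs_integral_le_of_abs_le ν fun b => H.bounded_y b _ H.mem_base
  -- The correction has mean zero because the population market clears at p₀.
  have hVq : V = ∫ b, q b ∂ν := by
    have hi1 : Integrable (fun b => M.y b (pstar π)) ν :=
      integrable_of_abs_le (measurable_section hM.measurable_y _)
        fun b => H.bounded_y b _ H.mem_base
    have hi2 : Integrable (fun b => M.d b (pstar π) - M.cap) ν :=
      Integrable.of_bound ((hM.measurable_d.comp
        (measurable_id.prodMk measurable_const)).sub_const M.cap).aestronglyMeasurable
        (K + ‖M.cap‖) (Eventually.of_forall fun b =>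
          (norm_sub_le _ _).trans (add_le_add (H.bounded_d b _ H.mem_base) le_rfl))
    have hzero : ∫ b, (M.d b (pstar π) - M.cap) ∂ν = 0 := by
      ext j
      have h1 := (EuclideanSpace.proj (𝕜 := ℝ) j).integral_comp_comm hi2
      have h2 : ∫ b, (M.d b (pstar π) j - M.cap j) ∂ν = 0 := by
        rw [integral_sub (integrable_of_abs_le (H.measurable_d_base j)
          fun b => H.bounded_d_apply j b _ H.mem_base) (integrable_const _), integral_const,
          probReal_univ, one_smul, ← H.mean_base]
        exact sub_self _
      exact h1.symm.trans h2
    have h3 : ∫ b, q b ∂ν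
        = ∫ b, M.y b (pstar π) ∂ν - ∫ b, φ (M.d b (pstar π) - M.cap) ∂ν :=
      integral_sub hi1 (φ.integrable_comp hi2)
    rw [h3, φ.integral_comp_comm hi2, hzero, map_zero, sub_zero, hVY]
  refine ⟨1 + B, by positivity, ?_⟩
  filter_upwards [hlim.eventually (gt_mem_nhds one_pos), eventually_gt_atTop 0] with n hn1 hn0
  have hn' : (0 : ℝ) < n := by exact_mod_cast hn0
  set F : (Fin n → 𝓑) → ℝ := fun b => M.avgOutcome b - V with hF
  have hFm : Measurable F := (measurable_avgOutcome hM n).sub_const _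
  have hFK : ∀ b, |F b| ≤ 2 * K := fun b => by
    have h1 : |M.avgOutcome b| ≤ K :=
      abs_avg_le H.bound_nonneg fun i => H.bounded_y _ _ (H.mem n hn0 b)
    exact (abs_sub _ _).trans (by linarith)
  have hval : ∀ ω, M.finiteValue n π ω - V
      = policyExp π (M.covariates n ω) fun w => F (M.bids n w ω) := fun ω => by
    rw [finiteValue_eq, hF, policyExp_sub_const]
  have habs : ∀ b, |(fun b => |F b|) b| ≤ 2 * K := fun b => by rw [abs_abs]; exact hFK b
  have hint1 : Integrable (fun ω => M.finiteValue n π ω - V) μ := by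
    simp_rw [hval]
    exact integrable_of_abs_le (measurable_policyExp_bids hM hπ n hFm) fun ω =>
      (abs_policyExp_le h01 _ _).trans (policyExp_le h01 _ fun w => hFK _)
  have hint2 : Integrable (fun ω => policyExp π (M.covariates n ω) fun w => |F (M.bids n w ω)|) μ :=
    integrable_of_abs_le (measurable_policyExp_bids hM hπ n hFm.abs) fun ω =>
      (abs_policyExp_le h01 _ _).trans (policyExp_le h01 _ fun w => habs _)
  refine ⟨hint1, ?_⟩
  have hle1 : ∫ ω, |M.finiteValue n π ω - V| ∂μ ≤ ∫ b, |F b| ∂(sampleLaw ν n) := by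
    rw [← integral_policyExp_bids hM hπ h01 n hFm.abs habs]
    refine integral_mono hint1.abs hint2 fun ω => ?_
    dsimp only
    rw [hval]
    exact abs_policyExp_le h01 _ _
  have hEi : Integrable (fun b => |M.linearizationError φ (pstar π) b|) (sampleLaw ν n) := by
    refine integrable_of_abs_le (K := K + B)
      (measurable_linearizationError hM φ _ n).abs fun b => ?_
    rw [abs_abs]
    exact (abs_sub _ _).trans (add_le_add (abs_avg_le H.bound_nonneg fun i =>
      H.bounded_y _ _ (H.mem n hn0 b)) (abs_avg_le hB0 fun i => hqB _))
  have hqi : Integrable (fun b : Fin n → 𝓑 => |(∑ i, q (b i)) / n - ∫ x, q x ∂ν|)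
      (sampleLaw ν n) := by
    refine integrable_of_abs_le (K := 2 * B) (((Finset.measurable_sum _ fun i _ =>
      hqm.comp (measurable_pi_apply i)).div_const _).sub_const _).abs fun b => ?_
    rw [abs_abs]
    exact (abs_sub _ _).trans (by
      linarith [abs_avg_le hB0 fun i => hqB (b i), abs_integral_le_of_abs_le ν hqB])
  have hle2 : ∫ b, |F b| ∂(sampleLaw ν n)
      ≤ ∫ b, |M.linearizationError φ (pstar π) b| ∂(sampleLaw ν n) + B / Real.sqrt n := by
    refine le_trans ?_ (add_le_add le_rfl (integral_abs_avg_sub_le ν hn0 hqm hqB hB0))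
    rw [← integral_add hEi hqi]
    refine integral_mono (integrable_of_abs_le hFm.abs habs) (hEi.add hqi) fun b => ?_
    have e : F b = M.linearizationError φ (pstar π) b
        + ((∑ i, q (b i)) / n - ∫ x, q x ∂ν) := by
      rw [← hVq]
      simp only [hF, linearizationError, hq]
      ring
    dsimp only
    rw [e]
    exact abs_add_le _ _
  have hsqrt := Real.sqrt_pos.2 hn'
  have h1 : Real.sqrt n * ∫ b, |M.linearizationError φ (pstar π) b| ∂(sampleLaw ν n) < 1 := by
    rw [Real.sqrt_eq_rpow]
    exact hn1
  have h2 := mul_le_mul_of_nonneg_left (hle1.trans hle2) hsqrt.le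
  have h3 : Real.sqrt n * (B / Real.sqrt n) = B := by field_simp
  rw [mul_add, h3] at h2
  linarith

theorem boundedInProbability_finiteValue :
    BoundedInProbability μ fun n ω =>
      Real.sqrt n * (M.finiteValue n π ω - M.continuumValue μ pstar π) := by
  obtain ⟨C, hC0, hev⟩ := exists_sqrt_mul_integral_abs_finiteValue_sub_le hM hC hO hE hc' hc₃ hmem
    hπ h01
  intro ε hε
  -- Markov's inequality; adding 1 keeps the threshold positive when C = 0.
  refine ⟨(C + 1) / ε, ?_⟩
  filter_upwards [hev] with n hn
  have ht : 0 < (C + 1) / ε := by positivity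
  have hsub : {ω | (C + 1) / ε < |Real.sqrt n * (M.finiteValue n π ω - M.continuumValue μ pstar π)|}
      ⊆ {ω | (C + 1) / ε ≤ |Real.sqrt n * (M.finiteValue n π ω - M.continuumValue μ pstar π)|} :=
    Set.ofPred_subset_ofPred.2 fun ω hω => hω.le
  refine (measure_mono hsub).trans
    ((measure_ge_le_of_integral_abs (hn.1.const_mul (Real.sqrt n)) ht).trans
      (ENNReal.ofReal_le_ofReal ?_))
  simp_rw [abs_mul, abs_of_nonneg (Real.sqrt_nonneg (n : ℝ))]
  rw [integral_const_mul, div_le_iff₀ ht, mul_div_cancel₀ _ hε.ne']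
  linarith [hn.2]

omit hmem hπ h01 in
/-- Average outcomes minus average corrected outcomes, when everybody gets the same treatment. -/
theorem tendsto_integral_abs_linearizationError_const
    (hconst : ∀ w : Bool, constRule 𝓧 w ∈ Pol) (w : Bool) :
    (∀ n : ℕ, 0 < n → Integrable (fun ω => M.linearizationError (M.nu μ w (pstar (constRule 𝓧 w)))
      (pstar (constRule 𝓧 w)) (M.bids n (fun _ => w) ω)) μ) ∧
    Tendsto (fun n : ℕ => (n : ℝ) ^ (1 / 2 : ℝ) *
      ∫ ω, |M.linearizationError (M.nu μ w (pstar (constRule 𝓧 w))) (pstar (constRule 𝓧 w))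
        (M.bids n (fun _ => w) ω)| ∂μ) atTop (𝓝 0) := by
  have hm : Measurable (constRule 𝓧 w) := measurable_const
  have h01 : ∀ x, constRule 𝓧 w x ∈ Set.Icc (0 : ℝ) 1 := fun x => by cases w <;> simp [constRule]
  have hlim := tendsto_integral_abs_linearizationError hM hC hO hE hc' hc₃ (hconst w) hm h01
  have hprob := isProbabilityMeasure_policyLaw hM hm h01
  obtain ⟨K, H, -⟩ := exists_clearingSequence hM hC hO hE hc' hc₃ (hconst w) hm h01
  -- Under a constant rule excess and mean demand differ by the constant capacity, so their
  -- derivatives agree and the shadow price is ν*_w.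
  rw [shadowPrice_constRule] at hlim
  set φ := M.nu μ w (pstar (constRule 𝓧 w))
  set B := K + ‖φ‖ * (K + ‖M.cap‖) with hB
  have hB0 : 0 ≤ B := by have := H.bound_nonneg; positivity
  have hbound : ∀ n : ℕ, 0 < n → ∀ b : Fin n → 𝓑,
      |M.linearizationError φ (pstar (constRule 𝓧 w)) b| ≤ K + B := fun n hn b =>
    (abs_sub _ _).trans (add_le_add (abs_avg_le H.bound_nonneg fun i =>
      H.bounded_y _ _ (H.mem n hn b)) (abs_avg_le hB0 fun i =>
        abs_correctedOutcome_le H.bounded_d H.bounded_y φ H.mem_base _))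
  refine ⟨fun n hn => integrable_of_abs_le ((measurable_linearizationError hM φ _ n).comp
    (measurable_bids hM n _)) fun ω => hbound n hn _, hlim.congr' ?_⟩
  filter_upwards [eventually_gt_atTop 0] with n hn
  rw [← integral_bids_const hM w n (F := fun b =>
      |M.linearizationError φ (pstar (constRule 𝓧 w)) b|)
    (measurable_linearizationError hM φ _ n).abs (K := K + B) fun b => by
      rw [abs_abs]; exact hbound n hn b]

end

end Market

end CutoffMarket

end

theorem mainTheorem1 {Ω 𝓧 𝓑 : Type*} [MeasurableSpace Ω] [MeasurableSpace 𝓧]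
    [MeasurableSpace 𝓑] (μ : Measure Ω) [IsProbabilityMeasure μ] {J : ℕ} (hJ : 0 < J)
    (M : CutoffMarket.Market Ω 𝓧 𝓑 J)
    (Pol : Set (𝓧 → ℝ))
    (hPol : ∀ π ∈ Pol, Measurable π ∧ ∀ x, π x ∈ Set.Icc (0 : ℝ) 1)
    (hPol_const : ∀ w : Bool, CutoffMarket.constRule 𝓧 w ∈ Pol)
    (pstar : (𝓧 → ℝ) → CutoffMarket.RJ J)
    (c' c₃ c₄ : ℝ) (hc' : 0 < c') (hc₃ : 0 < c₃)
    (h_sampling : M.Sampling μ)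
    (h_identification : M.Identification μ)
    (h_cutoff : M.CutoffMechanism μ Pol)
    (h_outcomes : M.RegularOutcomes μ Pol pstar c' c₃ c₄)
    (h_equilibrium : M.RegularEquilibrium μ Pol pstar c' c₃) :
    (∀ π ∈ Pol, CutoffMarket.BoundedInProbability μ fun n ω =>
      Real.sqrt n * (M.finiteValue n π ω - M.continuumValue μ pstar π)) ∧
    CutoffMarket.LittleOInProbability μ
      (fun n ω =>
        (M.finiteGTE n ω - M.continuumGTE μ pstar) -
          ((1 / (n : ℝ)) * ∑ i : Fin n,
              (M.score μ true (pstar (CutoffMarket.constRule 𝓧 true))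
                  (M.B true i ω) (pstar (CutoffMarket.constRule 𝓧 true))
                - M.score μ false (pstar (CutoffMarket.constRule 𝓧 false))
                  (M.B false i ω) (pstar (CutoffMarket.constRule 𝓧 false)))
            - M.continuumGTE μ pstar))
      (fun n => (n : ℝ) ^ (-(1 / 2) : ℝ)) := by
  refine ⟨fun π hπ => CutoffMarket.Market.boundedInProbability_finiteValue h_sampling h_cutoff
    h_outcomes h_equilibrium hc' hc₃ hπ (hPol π hπ).1 (hPol π hπ).2, ?_⟩
  have hlin := CutoffMarket.Market.tendsto_integral_abs_linearizationError_const h_sampling h_cutoff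
    h_outcomes h_equilibrium hc' hc₃ hPol_const
  set p₁ := pstar (CutoffMarket.constRule 𝓧 true)
  set p₀ := pstar (CutoffMarket.constRule 𝓧 false)
  set E₁ : ℕ → Ω → ℝ := fun n ω =>
    M.linearizationError (M.nu μ true p₁) p₁ (M.bids n (fun _ => true) ω)
  set E₀ : ℕ → Ω → ℝ := fun n ω =>
    M.linearizationError (M.nu μ false p₀) p₀ (M.bids n (fun _ => false) ω)
  -- The continuum effect cancels, leaving exactly the difference of the linearization errors of the
  -- two constant rules.
  have heq : (fun (n : ℕ) ω => (M.finiteGTE n ω - M.continuumGTE μ pstar) -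
      ((1 / (n : ℝ)) * ∑ i : Fin n,
        (M.score μ true p₁ (M.B true i ω) p₁ - M.score μ false p₀ (M.B false i ω) p₀)
          - M.continuumGTE μ pstar)) = fun n ω => E₁ n ω - E₀ n ω := by
    funext n ω
    have hs : ∀ w p, (∑ i : Fin n, M.score μ w p (M.B w i ω) p)
        = ∑ i : Fin n, M.correctedOutcome (M.nu μ w p) p (M.bids n (fun _ => w) ω i) :=
      fun w p => rfl
    rw [CutoffMarket.Market.finiteGTE_eq, Finset.sum_sub_distrib, hs, hs]
    simp only [E₁, E₀, CutoffMarket.Market.linearizationError]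
    ring
  rw [heq]
  refine tendstoInMeasure_iff_norm.2 fun ε hε => ?_
  have hlim := ((hlin true).2.add (hlin false).2).const_mul ε⁻¹
  rw [add_zero, mul_zero] at hlim
  have hlim' := ENNReal.tendsto_ofReal hlim
  rw [ENNReal.ofReal_zero] at hlim'
  refine tendsto_of_tendsto_of_tendsto_of_le_of_le' tendsto_const_nhds hlim'
    (Eventually.of_forall fun n => zero_le) ?_
  filter_upwards [eventually_gt_atTop 0] with n hn
  have hn' : (0 : ℝ) < n := by exact_mod_cast hn
  have hi₁ : Integrable (E₁ n) μ := (hlin true).1 n hn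
  have hi₀ : Integrable (E₀ n) μ := (hlin false).1 n hn
  -- Dividing by the rate is multiplying by √n, so Markov's inequality and the two limits in mean
  -- finish the proof.
  have hrate : ∀ ω, (E₁ n ω - E₀ n ω) / (n : ℝ) ^ (-(1 / 2) : ℝ)
      = (n : ℝ) ^ (1 / 2 : ℝ) * (E₁ n ω - E₀ n ω) := fun ω => by
    rw [Real.rpow_neg hn'.le, div_inv_eq_mul, mul_comm]
  simp only [sub_zero, Real.norm_eq_abs, hrate]
  refine (CutoffMarket.measure_ge_le_of_integral_abs ((hi₁.sub hi₀).const_mul _) hε).trans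
    (ENNReal.ofReal_le_ofReal ?_)
  rw [div_eq_inv_mul, ← mul_add]
  refine mul_le_mul_of_nonneg_left ?_ (inv_nonneg.2 hε.le)
  simp_rw [abs_mul, abs_of_nonneg (Real.rpow_nonneg hn'.le _)]
  rw [integral_const_mul, ← integral_add hi₁.abs hi₀.abs]
  refine mul_le_mul_of_nonneg_left ?_ (by positivity)
  exact integral_mono (hi₁.sub hi₀).abs (hi₁.abs.add hi₀.abs) fun ω => abs_sub _ _
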